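/- Let $\mathfrak h$ be a complex Hilbert space and $H:[0,\infty)\to\mathcal B(\mathfrak h)$ a locally integrable function with self-adjoint values. Put $\sigma(x)=\begin{pmatrix} I&-\mathrm iH(x)\\0&I\end{pmatrix}$ and $\gamma(x)=\sigma(x)-I$ on $\mathfrak h\otimes\mathbb C^2$. The two basis states of $\mathbb C^2$ are called past ($-$) and future ($+$), and $\mathbb C^2$ carries the Minkowski metric $\sigma_1=\begin{pmatrix}0&1\\1&0\end{pmatrix}$. *Spaces.* The extended clock coordinate runs over $\mathbb R_-\sqcup\mathbb R_+$, the real line with a double origin $(\tilde 0,0)$, where $\tilde x=-x$. Wave functions assign to every finite chain $\varkappa=\{x_1<\dots<x_n\}$ a vector $\psi(\varkappa)\in\mathfrak h\otimes(\mathbb C^2)^{\otimes n}$; its components are $\psi(\upsilon,\omega)\in\mathfrak h$, $\upsilon\sqcup\omega=\varkappa$, where $\upsilon$ (resp. $\omega$) is the set of points with past (resp. future) spin. For $c\ge1$ the extended Minkowski-Fock space $\widetilde{\mathbb H}\otimes\mathbb F$ consists of the measurable $\psi$ with $\|\psi(\upsilon,\omega)\|\le g(\upsilon)c^{|\omega|}$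 a.e. for some $g\ge 0$ with $\int c^{|\upsilon|}g(\upsilon)\,d\upsilon<\infty$ ($c=1$: the space $L^1(\mathcal X;L^\infty(\mathcal X;\mathfrak h))$ over the space $\mathcal X$ of chains). Its pseudo-scalar product is $\int\varphi(\varkappa)^\ddagger\psi(\varkappa)\,d\varkappa$, formed with the metric $\sigma_1^{\otimes n}$ on $n$-point chains; the adjoint with respect to it is denoted by $\ddagger$. Let $[U^t\psi](\varkappa)=\psi(\varkappa+t)$ and $\partial_\varkappa=\sum_{x\in\varkappa}\partial_x$. For $x\in\varkappa$, $\sigma(x)$ and $\gamma(x)$ act on $\mathfrak h$ and on the factor $\mathbb C^2$ of the point $x$; $\sigma(t)$ in a boundary condition acts on $\mathfrak h$ and on the factor of the point at the origin. *Equations.* The Itô–Schrödinger counting equation with initial value $\psi_0$ is $$d\psi_t(\varkappa)=\gamma(t)\psi_t(\varkappa)\,dn_t(\varkappa),\qquad n_t(\varkappa)=|\varkappa\cap[0,t)|,\tag{1}$$ that is, $\psi_t(\varkappa)=\psi_0(\varkappa)+\sum_{x\in\varkappa\cap[0,t)}\gamma(x)\psi_x(\varkappa)$ for all $t\ge0$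 and all chains $\varkappa$. The Schrödinger boundary value problem is $$\mathrm i\partial_t\psi^t(\varkappa)=\mathrm i\partial_\varkappa\psi^t(\varkappa),\qquad \psi^t(\varkappa\sqcup\tilde 0)=\sigma(t)\,\psi^t(\varkappa\sqcup 0),\qquad \psi^0=\psi_0.\tag{2}$$ As $H$ is only locally integrable, in (2) the operator $\partial_t-\partial_\varkappa$ means the derivative along the vector field $(1,-1,\dots,-1)$, taken for $t>0$ at chains avoiding the origin, and $\psi^t(\varkappa\sqcup\tilde0)$, as well as the value $\psi^t(\varkappa\sqcup0)$ for $t>0$ and the initial value at chains avoiding the origin, are limits along the integral curves of this field. *Claim.* 1. For every $t\in\mathbb R$, $U^t$ is a $\ddagger$-unitary operator of the extended Minkowski-Fock space, and $U^rU^t=U^{r+t}$. 2. For all $\psi_0$ and all families $(\psi_t)_{t\ge0}$ of wave functions: $\psi_t$ solves (1) if and only if $\psi^t=U^t\psi_t$ solves (2). 3. For every $t\ge0$, $\sigma(t)$ is $\ddagger$-unitary, and the momentum $\mu=\mathrm i\partial_\varkappa$ is pseudo-selfadjoint, $\mu=\mu^\ddagger$, on the domain of those $\psi$ in the extended Minkowski-Fock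 space with $\mu\psi$ in that space which (for some version) on almost every line $r\mapsto\varkappa+r$ are absolutely continuous as long as no point passes the origin, right-continuous at the origin, and satisfy $\psi(\varkappa\sqcup\tilde0)=\sigma(t)\psi(\varkappa\sqcup0)$ there. 4. For every $\eta\in\mathfrak h$, equation (1) has a solution with the input state $\psi_0=\eta\otimes\xi_\emptyset^{\otimes}$ (all spins future). For every such solution, $\psi_t$ and $\psi^t=U^t\psi_t$ belong to the extended Minkowski-Fock space for all $t\ge0$. If $t>0$, $\varkappa$ contains neither the origin nor $-t$, and $H$ is differentiable at $x+t$ for all $x\in\varkappa\cap(-t,0)$, then the ordinary partial derivatives exist and $\mathrm i\partial_t\psi^t(\varkappa)=\mathrm i\sum_{x\in\varkappa}\partial_x\psi^t(\varkappa)$. If $t>0$ and $H$ is continuous at $t$, then, for fixed $t$ and fixed other points, $\psi^t(\varkappa\sqcup x)\to\psi^t(\varkappa\sqcup0)$ as $x\downarrow0$ and $\psi^t(\varkappa\sqcup x)\to\sigma(t)\psi^t(\varkappa\sqcup0)$ as $x\uparrow0$. 5. Reflect $\mathbb R_-$, so that a chain becomes a pair of chains $(\tau_-,\tau_+)$ of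 $\mathbb R_+$ (output and input channel), $\varkappa=\tilde\tau_-\sqcup\tau_+$, and put $\Phi^t(\tau_-,\tau_+)=\psi^t(\tilde\tau_-\sqcup\tau_+)$. Then $\psi^t$ solves (2) if and only if $\Phi^t$ solves the second quantized "momentumless" Dirac boundary value problem, with initial value the reflection of $\psi_0$, $$(\partial_t+\partial_{\tau_-}-\partial_{\tau_+})\Phi^t=0,\qquad \Phi^t(\tau_-\sqcup0,\tau_+)=\sigma(t)\,\Phi^t(\tau_-,\tau_+\sqcup0),$$ derivative and boundary values being understood as in (2). In particular $\psi_-^t(\tau)=\psi^t(\tilde\tau)$ and $\psi_+^t(\tau)=\psi^t(\tau)$, for chains $\tau$ of $\mathbb R_+$, satisfy $$(\partial_t+\partial_\tau)\psi_-^t=0,\qquad(\partial_t-\partial_\tau)\psi_+^t=0,\qquad\psi_-^t(0)=\sigma(t)\psi_+^t(0),$$ the differential equations at chains avoiding the origin and the last equation on one-point chains. -/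

import Mathlib

open MeasureTheory Filter Topology

/-! ### The clock: chains, temporal spin, and the Minkowski-Fock space -/

/-- The fibre `𝔥 ⊗ (ℂ²)^{⊗ n}` over an `n`-point chain, written in components: a spin configuration
`s : Fin n → Fin 2` is sent to a vector of `𝔥`. Spin `0` is the *past* state `(1,0)ᵀ` (upper index
`-`) and spin `1` is the *future* state `(0,1)ᵀ` (upper index `+`). -/
abbrev Fibre (𝔥 : Type*) (n : ℕ) : Type _ := (Fin n → Fin 2) → 𝔥

/-- Wave functions `ϰ ↦ ψ(ϰ) ∈ 𝔥 ⊗ ⨂_{x ∈ ϰ} ℂ²` of object and clock. A chain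
`ϰ = {x₁ < ⋯ < xₙ} ⊂ ℝ` is given by `n` and the strictly increasing tuple `x : Fin n → ℝ`; values at
tuples that are not strictly increasing are irrelevant. In `ℝ₋ ⊔ ℝ₊` the real number `0` stands for
the origin `0` of `ℝ₊`; the value at the other origin `0̃` of `ℝ₋` is the trace from the left. -/
abbrev WaveFn (𝔥 : Type*) : Type _ := (n : ℕ) → (Fin n → ℝ) → Fibre 𝔥 n

/-- Lebesgue measure on the simplex `{x₁ < ⋯ < xₙ}` of `n`-point chains (for `n = 0`: a unit
atom at the empty chain). -/
noncomputable def chainMeasure (n : ℕ) : Measure (Fin n → ℝ) :=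
  volume.restrict {x | StrictMono x}

/-- The positions of the spins that are in the past state. -/
def pastSites {n : ℕ} (s : Fin n → Fin 2) : Finset (Fin n) :=
  Finset.univ.filter fun i => s i = 0

/-- The subchain `υ` of the points of `x` that carry a past spin, in increasing order. -/
def pastChain {n : ℕ} (x : Fin n → ℝ) (s : Fin n → Fin 2) : Fin (pastSites s).card → ℝ :=
  fun j => x ((pastSites s).orderEmbOfFin rfl j)

section

variable {𝔥 : Type*} [NormedAddCommGroup 𝔥] [InnerProductSpace ℂ 𝔥]

/-- The extended Minkowski-Fock space `L¹(𝒳) ⊗ 𝔥 ⊗ L^∞(𝒳)`, `𝒳` the chains of `ℝ₋ ⊔ ℝ₊`, of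
functions `ψ(υ, ω)` that are integrable in the chain `υ` of past points and essentially bounded in
the chain `ω` of future points: `‖ψ(υ, ω)‖ ≤ g(υ) c^{|ω|}` with `∫ c^{|υ|} g(υ) dυ < ∞`.
For `c = 1` this is `L¹(𝒳; L^∞(𝒳; 𝔥))`; a product function `η ⊗ ξ^⊗` with `ξ = (ξ⁻, ξ⁺)` in
`L¹ ⊕ L^∞` belongs to the space as soon as `‖ξ⁺‖_∞ ≤ c`. -/
def InFock (c : NNReal) (ψ : WaveFn 𝔥) : Prop :=
  (∀ n s, AEStronglyMeasurable (fun x => ψ n x s) (chainMeasure n)) ∧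
  ∃ g : (n : ℕ) → (Fin n → ℝ) → ENNReal,
    (∀ n, AEMeasurable (g n) (chainMeasure n)) ∧
    (∑' n, (c : ENNReal) ^ n * ∫⁻ x, g n x ∂chainMeasure n) < ⊤ ∧
    ∀ n s, ∀ᵐ x ∂chainMeasure n,
      ‖ψ n x s‖ₑ ≤ g (pastSites s).card (pastChain x s) * (c : ENNReal) ^ (n - (pastSites s).card)

/-- The pseudo-scalar product `Φ^‡ Ψ` on a fibre: the metric is `σ₁^{⊗ n}`, which exchanges past
and future at every point. -/
noncomputable def fibreForm {n : ℕ} (Φ Ψ : Fibre 𝔥 n) : ℂ :=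
  ∑ s : Fin n → Fin 2, inner ℂ (Φ fun i => (s i).rev) (Ψ s)

/-- The pseudo-scalar product `∫ φ(ϰ)^‡ ψ(ϰ) dϰ` of the Minkowski-Fock space. -/
noncomputable def fockForm (φ ψ : WaveFn 𝔥) : ℂ :=
  ∑' n, ∫ x, fibreForm (φ n x) (ψ n x) ∂chainMeasure n

/-- `T` is a `‡`-unitary operator of the Minkowski-Fock space: linear, bijective, and preserving
the pseudo-scalar product. -/
def IsPseudoUnitary (c : NNReal) (T : WaveFn 𝔥 → WaveFn 𝔥) : Prop :=
  IsLinearMap ℂ T ∧ (∀ ψ, InFock c ψ → InFock c (T ψ)) ∧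
  (∃ S : WaveFn 𝔥 → WaveFn 𝔥, ∀ ψ, InFock c ψ → InFock c (S ψ) ∧ T (S ψ) = ψ ∧ S (T ψ) = ψ) ∧
  ∀ φ ψ, InFock c φ → InFock c ψ → fockForm (T φ) (T ψ) = fockForm φ ψ

/-- The second quantized shift `[U^t ψ](ϰ) = ψ(ϰ + t)`. -/
def shift (t : ℝ) (ψ : WaveFn 𝔥) : WaveFn 𝔥 :=
  fun n x => ψ n fun i => x i + t

/-! ### The object-clock interaction -/

/-- Action of a `2 × 2` matrix of operators of `𝔥` at the `i`-th point of a chain, as an operator of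
`𝔥` and of the `i`-th factor `ℂ²`, and as the identity on the other factors `ℂ²`. -/
noncomputable def legAct (M : Matrix (Fin 2) (Fin 2) (𝔥 →L[ℂ] 𝔥)) {n : ℕ} (i : Fin n)
    (Ψ : Fibre 𝔥 n) : Fibre 𝔥 n :=
  fun s => ∑ k : Fin 2, M (s i) k (Ψ (Function.update s i k))

/-- The interaction operator `σ(x)` with rows `(I, -iH(x))` and `(0, I)`. -/
noncomputable def sigmaOp (H : ℝ → 𝔥 →L[ℂ] 𝔥) (x : ℝ) :
    Matrix (Fin 2) (Fin 2) (𝔥 →L[ℂ] 𝔥) :=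
  !![1, -(Complex.I • H x); 0, 1]

/-- `γ(x) = σ(x) - I`. -/
noncomputable def gammaOp (H : ℝ → 𝔥 →L[ℂ] 𝔥) (x : ℝ) :
    Matrix (Fin 2) (Fin 2) (𝔥 →L[ℂ] 𝔥) :=
  sigmaOp H x - 1

/-- The input wave function `η ⊗ ξ_∅^⊗`, all spins of the clock being in the future state. -/
def pseudoVacuum (η : 𝔥) : WaveFn 𝔥 :=
  fun _ _ s => if ∀ i, s i = 1 then η else 0

/-- The Itô-Schrödinger counting equation `dψ_t(ϰ) = γ(t) ψ_t(ϰ) dn_t(ϰ)` with `ψ₀` given, where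
`n_t(ϰ) = |ϰ ∩ [0,t)|`, in integrated form
`ψ_t(ϰ) = ψ₀(ϰ) + ∫_{[0,t)} γ(r) ψ_r(ϰ) dn_r(ϰ)`. The points of `ℝ₋` do not interact. -/
def IsItoSchrodinger (H : ℝ → 𝔥 →L[ℂ] 𝔥) (ψ₀ : WaveFn 𝔥) (ψ : ℝ → WaveFn 𝔥) : Prop :=
  ∀ (n : ℕ) (x : Fin n → ℝ), StrictMono x → ∀ t : ℝ, 0 ≤ t →
    ψ t n x = ψ₀ n x +
      ∑ i with 0 ≤ x i ∧ x i < t, legAct (gammaOp H (x i)) i (ψ (x i) n x)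

/-! ### The Schrödinger boundary value problem -/

/-- The Schrödinger boundary value problem `i∂_t ψ^t(ϰ) = i∂_ϰ ψ^t(ϰ)` (at chains without a point at
the origin), `ψ^t(ϰ ⊔ 0̃) = σ(t) ψ^t(ϰ ⊔ 0)`, with initial value `ψ₀`.

As `H` is only locally integrable, `∂_t - ∂_ϰ`, `∂_ϰ = ∑_{x ∈ ϰ} ∂_x`, is the derivative along the
vector field `(1, -1, …, -1)`, and boundary and initial values are traces along its integral
curves. -/
structure IsSchrodingerBVP (H : ℝ → 𝔥 →L[ℂ] 𝔥) (ψ₀ : WaveFn 𝔥) (ψ : ℝ → WaveFn 𝔥) :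
    Prop where
  initial : ∀ (n : ℕ) (x : Fin n → ℝ), StrictMono x → ψ 0 n x = ψ₀ n x
  initial_trace : ∀ (n : ℕ) (x : Fin n → ℝ), StrictMono x → (∀ i, x i ≠ 0) →
    Tendsto (fun h => ψ h n fun i => x i - h) (𝓝[>] 0) (𝓝 (ψ 0 n x))
  equation : ∀ (n : ℕ) (x : Fin n → ℝ), StrictMono x → (∀ i, x i ≠ 0) → ∀ t : ℝ, 0 < t →
    HasDerivAt (fun h => ψ (t + h) n fun i => x i - h) 0 0
  /-- right-continuity at the origin `0` of `ℝ₊` -/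
  right_trace : ∀ (n : ℕ) (x : Fin n → ℝ), StrictMono x → ∀ i, x i = 0 → ∀ t : ℝ, 0 < t →
    Tendsto (fun h => ψ (t - h) n fun j => x j + h) (𝓝[>] 0) (𝓝 (ψ t n x))
  /-- the value at the origin `0̃` of `ℝ₋`, a trace from the left, is `σ(t)` applied to the value
  at the origin `0` of `ℝ₊` -/
  boundary : ∀ (n : ℕ) (x : Fin n → ℝ), StrictMono x → ∀ i, x i = 0 → ∀ t : ℝ, 0 ≤ t →
    Tendsto (fun h => ψ (t + h) n fun j => x j - h) (𝓝[>] 0)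
      (𝓝 (legAct (sigmaOp H t) i (ψ t n x)))

/-- `χ = ∂_ϰ ψ`, where `ψ` satisfies the boundary condition `ψ(ϰ ⊔ 0̃) = S ψ(ϰ ⊔ 0)`: some version
of `ψ` is, on almost every line `r ↦ ϰ + r`, absolutely continuous with derivative `χ` as long as no
point of the chain enters `ℝ₊`, right-continuous when a point is at the origin, and its limit from
the left there is given by the boundary condition. -/
def HasShiftDeriv (S : Matrix (Fin 2) (Fin 2) (𝔥 →L[ℂ] 𝔥)) (ψ χ : WaveFn 𝔥) : Prop :=
  ∃ ψ' : WaveFn 𝔥, ∀ n : ℕ, (∀ᵐ x ∂chainMeasure n, ψ' n x = ψ n x) ∧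
    ∀ᵐ x ∂chainMeasure n,
      (∀ (s : Fin n → Fin 2) (a b : ℝ),
        IntervalIntegrable (fun r => χ n (fun i => x i + r) s) volume a b) ∧
      (∀ (s : Fin n → Fin 2) (a b : ℝ), a ≤ b → (∀ i, ¬(a < -x i ∧ -x i ≤ b)) →
        ψ' n (fun i => x i + b) s - ψ' n (fun i => x i + a) s =
          ∫ r in a..b, χ n (fun i => x i + r) s) ∧
      ∀ i, Tendsto (fun r => ψ' n fun j => x j + r) (𝓝[<] (-x i))
        (𝓝 (legAct S i (ψ' n fun j => x j + -x i)))

/-- The graph of the momentum operator `μ = i∂_ϰ` of the clock in the Minkowski-Fock space, on the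
domain given by the boundary condition `S`: `φ = μ ψ`. -/
def IsMomentum (c : NNReal) (S : Matrix (Fin 2) (Fin 2) (𝔥 →L[ℂ] 𝔥)) (ψ φ : WaveFn 𝔥) : Prop :=
  InFock c ψ ∧ InFock c φ ∧ ∃ χ : WaveFn 𝔥, HasShiftDeriv S ψ χ ∧ φ = Complex.I • χ

/-- `μ = μ^‡`: the graph of `μ` coincides with the graph of its adjoint with respect to the
pseudo-scalar product. -/
def MomentumIsPseudoSelfAdjoint (c : NNReal) (S : Matrix (Fin 2) (Fin 2) (𝔥 →L[ℂ] 𝔥)) : Prop :=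
  ∀ φ χ : WaveFn 𝔥, InFock c φ → InFock c χ →
    (IsMomentum c S φ χ ↔ ∀ ψ ρ, IsMomentum c S ψ ρ → fockForm χ ψ = fockForm φ ρ)

/-! ### The Dirac boundary value problem -/

/-- Second quantized two-channel wave functions on the half-line: each of the `n` points has a
channel (`0` is the output channel `-`, `1` is the input channel `+`) and a coordinate in `ℝ₊`. -/
abbrev TwoChannelWaveFn (𝔥 : Type*) : Type _ :=
  (n : ℕ) → (Fin n → Fin 2) → (Fin n → ℝ) → Fibre 𝔥 n

/-- The point of `ℝ₋ ⊔ ℝ₊` with given channel and coordinate in `ℝ₊`; the output channel is the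
reflection `x ↦ x̃ = -x` of `ℝ₋`. -/
def position {n : ℕ} (k : Fin n → Fin 2) (r : Fin n → ℝ) : Fin n → ℝ :=
  fun i => if k i = 0 then -r i else r i

/-- `(k, r)` is a configuration of points of the two half-lines, numbered by increasing position,
with no point at the end of the output half-line. -/
def IsTwoChannelChain {n : ℕ} (k : Fin n → Fin 2) (r : Fin n → ℝ) : Prop :=
  (∀ i, 0 ≤ r i) ∧ (∀ i, k i = 0 → 0 < r i) ∧ StrictMono (position k r)

/-- Translation by `h` outwards in the output channel and inwards in the input channel. -/
def advance {n : ℕ} (k : Fin n → Fin 2) (r : Fin n → ℝ) (h : ℝ) : Fin n → ℝ :=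
  fun i => if k i = 0 then r i + h else r i - h

/-- Reflection of the negative time domain. -/
def reflectNeg (ψ : WaveFn 𝔥) : TwoChannelWaveFn 𝔥 :=
  fun n k r => ψ n (position k r)

/-- The second quantized Dirac boundary value problem: `∂_t + ∂_r` vanishes on the coordinates of
the output channel and `∂_t - ∂_r` on those of the input channel, that is,
`(∂_t + ∑_{k i = 0} ∂_{r i} - ∑_{k i = 1} ∂_{r i}) Φ = 0` (derivative along this vector field), and
the value at the origin of the output channel is `σ(t)` applied to the value at the origin of the
input channel. -/
structure IsDiracBVP (H : ℝ → 𝔥 →L[ℂ] 𝔥) (Φ₀ : TwoChannelWaveFn 𝔥)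
    (Φ : ℝ → TwoChannelWaveFn 𝔥) : Prop where
  initial : ∀ (n : ℕ) (k : Fin n → Fin 2) (r : Fin n → ℝ), IsTwoChannelChain k r →
    Φ 0 n k r = Φ₀ n k r
  initial_trace : ∀ (n : ℕ) (k : Fin n → Fin 2) (r : Fin n → ℝ), IsTwoChannelChain k r →
    (∀ i, r i ≠ 0) → Tendsto (fun h => Φ h n k (advance k r h)) (𝓝[>] 0) (𝓝 (Φ 0 n k r))
  equation : ∀ (n : ℕ) (k : Fin n → Fin 2) (r : Fin n → ℝ), IsTwoChannelChain k r →
    (∀ i, r i ≠ 0) → ∀ t : ℝ, 0 < t →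
    HasDerivAt (fun h => Φ (t + h) n k (advance k r h)) 0 0
  right_trace : ∀ (n : ℕ) (k : Fin n → Fin 2) (r : Fin n → ℝ), IsTwoChannelChain k r →
    ∀ i, r i = 0 → ∀ t : ℝ, 0 < t →
    Tendsto (fun h => Φ (t - h) n k (advance k r (-h))) (𝓝[>] 0) (𝓝 (Φ t n k r))
  boundary : ∀ (n : ℕ) (k : Fin n → Fin 2) (r : Fin n → ℝ), IsTwoChannelChain k r →
    ∀ i, r i = 0 → ∀ t : ℝ, 0 ≤ t →
    Tendsto
      (fun h => Φ (t + h) n (Function.update k i 0) (advance (Function.update k i 0) r h))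
      (𝓝[>] 0) (𝓝 (legAct (sigmaOp H t) i (Φ t n k r)))

/-- `ψ₋(τ) = [R ψ](τ) = ψ(τ̃)`: reflection of the restriction to chains of `ℝ₋`. (The reflected chain
is numbered in the opposite order.) -/
def reflectedNegPart (ψ : WaveFn 𝔥) : WaveFn 𝔥 :=
  fun n r s => ψ n (fun i => -r i.rev) (fun i => s i.rev)

/-- The Dirac equation for a pair of wave functions on chains of `ℝ₊`: `(∂_t + ∂_τ) ψ₋ = 0`,
`(∂_t - ∂_τ) ψ₊ = 0`, and `ψ₋(0) = σ(t) ψ₊(0)` on one-point chains. -/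
def IsDiracPair (H : ℝ → 𝔥 →L[ℂ] 𝔥) (ψm ψp : ℝ → WaveFn 𝔥) : Prop :=
  (∀ (n : ℕ) (x : Fin n → ℝ), StrictMono x → (∀ i, 0 < x i) → ∀ t : ℝ, 0 < t →
    HasDerivAt (fun h => ψm (t + h) n fun i => x i + h) 0 0 ∧
    HasDerivAt (fun h => ψp (t + h) n fun i => x i - h) 0 0) ∧
  ∀ t : ℝ, 0 ≤ t →
    Tendsto (fun h => ψm (t + h) 1 fun _ => h) (𝓝[>] 0)
      (𝓝 (legAct (sigmaOp H t) 0 (ψp t 1 fun _ => 0)))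

end

set_option linter.unusedSectionVars false

/-! ### The measure on chains -/

/-! The equations become transparent in the frame that moves with the shifts. Along an integral
curve of `∂_t - ∂_ϰ` one has `ψ^{t+h}(x - h) = ψ_{t+h}(x + t)`: a function of time at one fixed
chain. In this frame the boundary value problem says that, at each chain, this function is constant
between the times given by the points of the chain, continuous from the left, and jumps by `γ(x_i)
ψ_{x_i}` at each time `x_i ≥ 0`. By `eq_jumpSum_iff` such functions are exactly the sums of their
jumps, which is the Itô-Schrödinger equation. The Dirac problem is the same system in reflected
coordinates.

Shifts are pseudo-unitary because translations preserve the measure on chains. The matrix `σ` acts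
at a point as `1 + N`, where `N` squares to zero and is skew for the pseudo-scalar product: `-iH` is
skew-adjoint and the metric reverses spins. Hence `σ` preserves the form.

Symmetry of the momentum: for two elements of the domain, the fibre form has no jump when a point
passes the origin, since `σ` preserves it, so along almost every line it is a primitive of the
expression given by the product rule. The integral of that expression over a unit segment is `F(x +
1) - F(x)`, whose integral over all chains vanishes by translation invariance
(`integral_fibreForm_shiftDeriv`). No decay at infinity is needed.

Maximality: multiplication by `σ` at all points of `ℝ₊` (`boundaryGauge`) turns the boundary
condition into continuity. Testing the adjoint identity on inverse gauges of moving averages of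
indicator functions shows that the gauged function has a locally integrable weak derivative along
the shifts (`weak_of_adjoint`). Such a function has a version that is a primitive on almost every
line (`exists_primitive_version`), and undoing the gauge restores the jumps
(`isJumpPrimitive_boundaryGauge`).

With all input spins future, the solution is the time-ordered product of `-iH(x_i)` over the past
points, and vanishes unless they all lie in `[0, t)`. It is unique by induction on the number of
past spins, since `γ` reads a component with one past spin fewer. The simplex contributes `1/n!`, so
the Fock bound is an exponential series. -/

theorem measurableSet_strictMono (n : ℕ) : MeasurableSet {x : Fin n → ℝ | StrictMono x} := by
  have : {x : Fin n → ℝ | StrictMono x} = ⋂ i, ⋂ j, {x | i < j → x i < x j} := by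
    ext x; simp [StrictMono]
  rw [this]
  refine MeasurableSet.iInter fun i => MeasurableSet.iInter fun j => ?_
  by_cases h : i < j
  · simpa [h] using measurableSet_lt (measurable_pi_apply i) (measurable_pi_apply j)
  · simp [h]

theorem strictMono_add_const_iff {n : ℕ} {x : Fin n → ℝ} {t : ℝ} :
    (StrictMono fun i => x i + t) ↔ StrictMono x := by
  simp [StrictMono]

instance sigmaFinite_chainMeasure (n : ℕ) : SigmaFinite (chainMeasure n) := by
  unfold chainMeasure; infer_instance

theorem ae_strictMono (n : ℕ) : ∀ᵐ x ∂chainMeasure n, StrictMono x :=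
  ae_restrict_mem (measurableSet_strictMono n)

theorem measurableEmbedding_chain_add (n : ℕ) (t : ℝ) :
    MeasurableEmbedding fun (x : Fin n → ℝ) i => x i + t :=
  (Homeomorph.addRight (fun _ : Fin n => t)).measurableEmbedding

theorem measurePreserving_chain_add (n : ℕ) (t : ℝ) :
    MeasurePreserving (fun (x : Fin n → ℝ) i => x i + t) (chainMeasure n) (chainMeasure n) := by
  have h := (measurePreserving_add_right (volume : Measure (Fin n → ℝ))
    (fun _ => t)).restrict_preimage (measurableSet_strictMono n)
  have e : ((fun x : Fin n → ℝ => x + fun _ => t) ⁻¹' {x | StrictMono x}) = {x | StrictMono x} := by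
    ext x; exact strictMono_add_const_iff
  rw [e] at h
  exact h

theorem measurable_chain_add (n : ℕ) :
    Measurable fun (p : (Fin n → ℝ) × ℝ) (i : Fin n) => p.1 i + p.2 := by fun_prop

/-- For each fixed `r` the shear is a translation, which preserves the measure on chains; Fubini
does the rest. -/
theorem measurePreserving_chain_shear (n : ℕ) (ν : Measure ℝ) [SFinite ν] :
    MeasurePreserving (fun p : (Fin n → ℝ) × ℝ => ((fun i => p.1 i + p.2 : Fin n → ℝ), p.2))
      ((chainMeasure n).prod ν) ((chainMeasure n).prod ν) := by
  have h := (MeasurePreserving.id ν).skew_product (μc := chainMeasure n) (μd := chainMeasure n)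
    (g := fun r x i => x i + r) (by unfold Function.uncurry; fun_prop)
    (ae_of_all _ fun r => (measurePreserving_chain_add n r).map_eq)
  exact (Measure.measurePreserving_swap.comp h).comp Measure.measurePreserving_swap

theorem quasiMeasurePreserving_chain_line (n : ℕ) (ν : Measure ℝ) [SFinite ν] :
    Measure.QuasiMeasurePreserving (fun (p : (Fin n → ℝ) × ℝ) (i : Fin n) => p.1 i + p.2)
      ((chainMeasure n).prod ν) (chainMeasure n) :=
  Measure.quasiMeasurePreserving_fst.comp (measurePreserving_chain_shear n ν).quasiMeasurePreserving

/-- What holds almost everywhere holds almost everywhere on almost every line. -/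
theorem ae_chain_line {n : ℕ} {p : (Fin n → ℝ) → Prop} (h : ∀ᵐ x ∂chainMeasure n, p x) :
    ∀ᵐ x ∂chainMeasure n, ∀ᵐ r : ℝ, p fun i => x i + r :=
  Measure.ae_ae_of_ae_prod ((quasiMeasurePreserving_chain_line n volume).ae h)

/-! ### Integration along the lines of the shifts -/

section

variable {E : Type*} [NormedAddCommGroup E]

theorem integral_chain_add [NormedSpace ℝ E] (n : ℕ) (t : ℝ) (F : (Fin n → ℝ) → E) :
    ∫ x, F (fun i => x i + t) ∂chainMeasure n = ∫ x, F x ∂chainMeasure n :=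
  (measurePreserving_chain_add n t).integral_comp (measurableEmbedding_chain_add n t) F

theorem integrable_chain_strip {n : ℕ} {F : (Fin n → ℝ) → E} (hF : Integrable F (chainMeasure n))
    (ν : Measure ℝ) [IsFiniteMeasure ν] :
    Integrable (fun p : (Fin n → ℝ) × ℝ => F fun i => p.1 i + p.2) ((chainMeasure n).prod ν) :=
  (measurePreserving_chain_shear n ν).integrable_comp_of_integrable (hF.comp_fst ν)

/-- By Fubini and translation invariance, replacing a function by its averages over unit segments
does not change its integral. This reduces integrals over chains to one-dimensional calculus on
lines. -/
theorem integral_chain_strip [NormedSpace ℝ E] [CompleteSpace E] {n : ℕ} {F : (Fin n → ℝ) → E}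
    (hF : Integrable F (chainMeasure n)) :
    ∫ x, (∫ r in (0 : ℝ)..1, F fun i => x i + r) ∂chainMeasure n = ∫ x, F x ∂chainMeasure n := by
  have h := integrable_chain_strip hF (volume.restrict (Set.Ioc (0 : ℝ) 1))
  simp_rw [intervalIntegral.integral_of_le zero_le_one]
  rw [integral_integral_swap h]
  simp_rw [integral_chain_add]
  simp

/-- Integrability on bounded sets of chains. -/
def ChainLocInt {n : ℕ} (F : (Fin n → ℝ) → E) : Prop :=
  AEStronglyMeasurable F (chainMeasure n) ∧
    ∀ R : ℝ, IntegrableOn F {x | ∀ i, |x i| ≤ R} (chainMeasure n)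

theorem measurableSet_chainBox (n : ℕ) (R : ℝ) : MeasurableSet {x : Fin n → ℝ | ∀ i, |x i| ≤ R} := by
  have : {x : Fin n → ℝ | ∀ i, |x i| ≤ R} = ⋂ i, {x | |x i| ≤ R} := by ext; simp
  rw [this]
  exact MeasurableSet.iInter fun i => measurableSet_le (by fun_prop) (by fun_prop)

/-- Shifting the box of radius `N` by at most `M` stays in the box of radius `N + M`, so `F` may be
truncated there to an integrable function. -/
theorem ChainLocInt.strip {n : ℕ} {F : (Fin n → ℝ) → E} (hF : ChainLocInt F) (N M : ℝ) :
    Integrable (fun p : (Fin n → ℝ) × ℝ => F fun i => p.1 i + p.2)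
      (((chainMeasure n).restrict {x | ∀ i, |x i| ≤ N}).prod
        (volume.restrict (Set.Icc (-M) M))) := by
  have hN := measurableSet_chainBox n N
  have h : Integrable (fun p : (Fin n → ℝ) × ℝ =>
      ({x : Fin n → ℝ | ∀ i, |x i| ≤ N + M}.indicator F) fun i => p.1 i + p.2)
      ((chainMeasure n).prod (volume.restrict (Set.Icc (-M) M))) :=
    integrable_chain_strip ((integrable_indicator_iff (measurableSet_chainBox n _)).2 (hF.2 _)) _
  have h2 : (((chainMeasure n).restrict {x | ∀ i, |x i| ≤ N}).prod
      (volume.restrict (Set.Icc (-M) M))) =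
      ((chainMeasure n).prod volume).restrict ({x | ∀ i, |x i| ≤ N} ×ˢ Set.Icc (-M) M) :=
    Measure.prod_restrict _ _
  have h3 : Integrable (fun p : (Fin n → ℝ) × ℝ =>
      ({x : Fin n → ℝ | ∀ i, |x i| ≤ N + M}.indicator F) fun i => p.1 i + p.2)
      (((chainMeasure n).restrict {x | ∀ i, |x i| ≤ N}).prod
        (volume.restrict (Set.Icc (-M) M))) :=
    h.mono_measure (Measure.prod_mono Measure.restrict_le_self le_rfl)
  refine h3.congr ?_
  rw [h2]
  filter_upwards [ae_restrict_mem (hN.prod measurableSet_Icc)] with p hp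
  refine Set.indicator_of_mem ?_ _
  intro i
  have h4 : |p.2| ≤ M := abs_le.2 hp.2
  exact (abs_add_le _ _).trans (add_le_add (hp.1 i) h4)

theorem ae_chainBox {n : ℕ} {p : (Fin n → ℝ) → Prop}
    (h : ∀ N : ℕ, ∀ᵐ x ∂(chainMeasure n).restrict {x | ∀ i, |x i| ≤ (N : ℝ)}, p x) :
    ∀ᵐ x ∂chainMeasure n, p x := by
  have h' : ∀ᵐ x ∂chainMeasure n, ∀ N : ℕ, (∀ i, |x i| ≤ (N : ℝ)) → p x :=
    ae_all_iff.2 fun N => (ae_restrict_iff' (measurableSet_chainBox n N)).1 (h N)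
  filter_upwards [h'] with x hx
  obtain ⟨N, hN⟩ := exists_nat_ge (∑ i, |x i|)
  exact hx N fun i => (Finset.single_le_sum (f := fun i => |x i|)
    (fun i _ => abs_nonneg _) (Finset.mem_univ i)).trans hN

theorem ChainLocInt.ae_line {n : ℕ} {F : (Fin n → ℝ) → E} (hF : ChainLocInt F) :
    ∀ᵐ x ∂chainMeasure n, ∀ a b : ℝ,
      IntervalIntegrable (fun r => F fun i => x i + r) volume a b := by
  refine ae_chainBox fun N => ?_
  have h : ∀ M : ℕ, ∀ᵐ x ∂(chainMeasure n).restrict {x | ∀ i, |x i| ≤ (N : ℝ)},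
      IntegrableOn (fun r => F fun i => x i + r) (Set.Icc (-(M : ℝ)) M) volume :=
    fun M => (hF.strip N M).prod_right_ae
  filter_upwards [ae_all_iff.2 h] with x hx a b
  obtain ⟨M, hM⟩ := exists_nat_ge (max |a| |b|)
  rw [intervalIntegrable_iff]
  refine (hx M).mono_set fun r hr => ?_
  have ha := abs_le.1 ((le_max_left _ _).trans hM)
  have hb := abs_le.1 ((le_max_right _ _).trans hM)
  rcases Set.mem_uIoc.1 hr with h | h <;> constructor <;> linarith [h.1, h.2]

end

/-! ### Past and future subchains -/

/-- A permutation of coordinates. The complement is a separate variable so that `B` can be the set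
of past sites of the reversed spins without transport between index types. -/
theorem measurePreserving_split {n : ℕ} (A B : Finset (Fin n)) (h : B = Aᶜ) :
    MeasurePreserving (fun x : Fin n → ℝ =>
      ((fun j => x (A.orderEmbOfFin rfl j) : Fin A.card → ℝ),
        (fun j => x (B.orderEmbOfFin rfl j) : Fin B.card → ℝ)))
      volume (volume.prod volume) := by
  subst h
  have h1 := (volume_measurePreserving_piCongrLeft (fun _ : Fin n => ℝ)
    (finSumEquivOfFinset (s := A) rfl rfl)).symm
  have h2 := (volume_measurePreserving_sumPiEquivProdPi
    (fun _ : Fin A.card ⊕ Fin (Aᶜ).card => ℝ))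
  have h3 := h2.comp h1
  have e : (fun x : Fin n → ℝ =>
      ((fun j => x (A.orderEmbOfFin rfl j) : Fin A.card → ℝ),
        (fun j => x (Aᶜ.orderEmbOfFin rfl j) : Fin (Aᶜ).card → ℝ))) =
      (MeasurableEquiv.sumPiEquivProdPi fun _ : Fin A.card ⊕ Fin (Aᶜ).card => ℝ) ∘
        (MeasurableEquiv.piCongrLeft (fun _ : Fin n => ℝ)
          (finSumEquivOfFinset (s := A) rfl rfl)).symm := by
    funext x
    refine Prod.ext ?_ ?_ <;> funext j
    · change _ = x (finSumEquivOfFinset rfl rfl (Sum.inl j))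
      rw [finSumEquivOfFinset_inl]
    · change _ = x (finSumEquivOfFinset rfl rfl (Sum.inr j))
      rw [finSumEquivOfFinset_inr]
  rw [e]
  exact h3

theorem strictMono_pastChain {n : ℕ} {x : Fin n → ℝ} (hx : StrictMono x) (s : Fin n → Fin 2) :
    StrictMono (pastChain x s) :=
  hx.comp (OrderEmbedding.strictMono _)

theorem pastSites_rev {n : ℕ} (s : Fin n → Fin 2) :
    (pastSites fun i => (s i).rev) = (pastSites s)ᶜ := by
  ext i
  simp only [pastSites, Finset.mem_filter, Finset.mem_univ, true_and, Finset.mem_compl]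
  generalize s i = a
  fin_cases a <;> simp

/-- Forgetting the future points is a coordinate projection: it does not preserve the measure, but
preimages of null sets are null, which is enough to move almost-everywhere bounds. -/
theorem quasiMeasurePreserving_pastChain {n : ℕ} (s : Fin n → Fin 2) :
    Measure.QuasiMeasurePreserving (fun x => pastChain x s) (chainMeasure n)
      (chainMeasure (pastSites s).card) := by
  have h : Measure.QuasiMeasurePreserving (fun x : Fin n → ℝ => pastChain x s) volume volume :=
    Measure.quasiMeasurePreserving_fst.comp
      (measurePreserving_split (pastSites s) _ rfl).quasiMeasurePreserving
  refine ⟨h.measurable, Measure.AbsolutelyContinuous.mk fun N hN h0 => ?_⟩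
  rw [Measure.map_apply h.measurable hN]
  rw [chainMeasure, Measure.restrict_apply hN] at h0
  rw [chainMeasure, Measure.restrict_apply (h.measurable hN)]
  refine measure_mono_null ?_ (h.preimage_null h0)
  exact fun x hx => ⟨hx.1, strictMono_pastChain hx.2 s⟩

/-- Chains with given past and future points are split into pairs of chains. -/
theorem lintegral_split_le {n : ℕ} (s : Fin n → Fin 2) {f : (Fin (pastSites s).card → ℝ) → ENNReal}
    {g : (Fin (pastSites fun i => (s i).rev).card → ℝ) → ENNReal}
    (hf : AEMeasurable f (chainMeasure _)) (hg : AEMeasurable g (chainMeasure _)) :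
    ∫⁻ x, f (pastChain x s) * g (pastChain x fun i => (s i).rev) ∂chainMeasure n ≤
      (∫⁻ y, f y ∂chainMeasure _) * ∫⁻ z, g z ∂chainMeasure _ := by
  have e1 := (quasiMeasurePreserving_pastChain s).ae_eq_comp hf.ae_eq_mk
  have e2 := (quasiMeasurePreserving_pastChain fun i => (s i).rev).ae_eq_comp hg.ae_eq_mk
  rw [lintegral_congr_ae hf.ae_eq_mk, lintegral_congr_ae hg.ae_eq_mk]
  have e3 : ∫⁻ x, f (pastChain x s) * g (pastChain x fun i => (s i).rev) ∂chainMeasure n =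
      ∫⁻ x, hf.mk f (pastChain x s) * hg.mk g (pastChain x fun i => (s i).rev)
        ∂chainMeasure n := by
    refine lintegral_congr_ae ?_
    filter_upwards [e1, e2] with x h1 h2
    simp only [Function.comp] at h1 h2
    rw [h1, h2]
  rw [e3]
  have mf := hf.measurable_mk
  have mg := hg.measurable_mk
  set F := hf.mk f
  set G := hg.mk g
  have mF := mf.indicator (measurableSet_strictMono _)
  have mG := mg.indicator (measurableSet_strictMono _)
  unfold chainMeasure
  rw [← lintegral_indicator (measurableSet_strictMono _) F,
    ← lintegral_indicator (measurableSet_strictMono _) G, ← lintegral_prod_mul mF.aemeasurable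
    mG.aemeasurable, ← (measurePreserving_split (pastSites s) _ (pastSites_rev s)).lintegral_comp
    (by fun_prop), ← lintegral_indicator (measurableSet_strictMono _)]
  -- Both subchains of a chain are chains, but a pair of chains need not interleave in the order
  -- prescribed by `s`; hence an inequality only.
  refine lintegral_mono fun x => ?_
  by_cases hx : StrictMono x
  swap
  · rw [Set.indicator_of_notMem hx]
    exact bot_le
  rw [Set.indicator_of_mem hx]
  refine le_of_eq ?_
  congr 1
  · exact (Set.indicator_of_mem (strictMono_pastChain hx s) _).symm
  · exact (Set.indicator_of_mem (strictMono_pastChain hx fun i => (s i).rev) _).symm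

theorem lintegral_pi_prod (f : ℝ → ENNReal) (hf : Measurable f) (n : ℕ) :
    ∫⁻ x : Fin n → ℝ, ∏ i, f (x i) = (∫⁻ y, f y) ^ n := by
  induction n with
  | zero => simp [volume_pi]
  | succ n ih =>
    rw [← (volume_preserving_piFinSuccAbove (fun _ : Fin (n + 1) => ℝ) 0).symm.lintegral_comp
      (by fun_prop)]
    simp only [Fin.prod_univ_succ, MeasurableEquiv.piFinSuccAbove_symm_apply, Fin.insertNthEquiv,
      Fin.zero_succAbove, Equiv.coe_fn_mk, Fin.insertNth_zero', Fin.cons_zero, Fin.cons_succ]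
    rw [Measure.volume_eq_prod, lintegral_prod_mul (f := f) (g := fun x : Fin n → ℝ => ∏ i, f (x i))
      hf.aemeasurable (Finset.measurable_prod _ fun i _ =>
        hf.comp (measurable_pi_apply i)).aemeasurable, ih, pow_succ']

/-- The `n!` orderings of the coordinates fill disjoint parts of `ℝⁿ`. -/
theorem factorial_mul_lintegral_chain_le (f : ℝ → ENNReal) (hf : Measurable f) (n : ℕ) :
    (n.factorial : ENNReal) * ∫⁻ x, ∏ i, f (x i) ∂chainMeasure n ≤ (∫⁻ y, f y) ^ n := by
  rw [← lintegral_pi_prod f hf n]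
  have hS := measurableSet_strictMono n
  have hmp : ∀ π : Equiv.Perm (Fin n), MeasurePreserving (fun x : Fin n → ℝ => x ∘ π) volume volume :=
    fun π => by
      exact (volume_measurePreserving_piCongrLeft (fun _ : Fin n => ℝ) π).symm
  have e : ∀ π : Equiv.Perm (Fin n),
      ∫⁻ x in {x | StrictMono (x ∘ π)}, ∏ i, f (x i) = ∫⁻ x, ∏ i, f (x i) ∂chainMeasure n := by
    intro π
    rw [chainMeasure, ← (hmp π).setLIntegral_comp_preimage hS (by fun_prop)]
    refine lintegral_congr fun x => ?_
    exact (Equiv.prod_comp π fun i => f (x i)).symm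
  have h1 : ∑ π : Equiv.Perm (Fin n), ∫⁻ x in {x | StrictMono (x ∘ π)}, ∏ i, f (x i) =
      (n.factorial : ENNReal) * ∫⁻ x, ∏ i, f (x i) ∂chainMeasure n := by
    simp [e, Fintype.card_perm]
  rw [← h1, ← tsum_fintype (L := .unconditional _), ← lintegral_iUnion]
  · exact setLIntegral_le_lintegral _ _
  · exact fun π => (hmp π).measurable hS
  · intro π ρ hne
    refine Set.disjoint_left.2 fun x hx hy => hne ?_
    have hr : Set.range (x ∘ π) = Set.range (x ∘ ρ) := by
      rw [π.surjective.range_comp, ρ.surjective.range_comp]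
    -- Two increasing enumerations of one set of reals coincide; since `x` is injective, the
    -- permutations do too.
    have he := (StrictMono.range_inj hx hy).1 hr
    have hinj : Function.Injective x := by
      have := hx.injective.comp π.symm.injective
      simpa [Function.comp_assoc] using this
    ext i
    exact congrArg Fin.val (hinj (congrFun he i))

section

variable {𝔥 : Type*} [NormedAddCommGroup 𝔥] [InnerProductSpace ℂ 𝔥]
variable {𝔨 : Type*} [NormedAddCommGroup 𝔨] [InnerProductSpace ℂ 𝔨]

/-! ### Shifts and the pairing of the Minkowski-Fock space -/

theorem lintegral_ne_top_of_fock {c : NNReal} (hc : 1 ≤ c)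
    {g : (n : ℕ) → (Fin n → ℝ) → ENNReal}
    (h : (∑' n, (c : ENNReal) ^ n * ∫⁻ x, g n x ∂chainMeasure n) < ⊤) (n : ℕ) :
    ∫⁻ x, g n x ∂chainMeasure n < ⊤ := by
  have h1 : (1 : ENNReal) ≤ (c : ENNReal) ^ n := one_le_pow₀ (by exact_mod_cast hc)
  calc ∫⁻ x, g n x ∂chainMeasure n = 1 * ∫⁻ x, g n x ∂chainMeasure n := (one_mul _).symm
    _ ≤ (c : ENNReal) ^ n * ∫⁻ x, g n x ∂chainMeasure n := by gcongr
    _ ≤ _ := ENNReal.le_tsum n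
    _ < ⊤ := h

/-- This is what the mixed integrable-bounded norm is for: reversing the spins makes one factor
integrable in the past points and the other in the future points, so the integral is bounded by a
product of two finite ones. The two object spaces may differ, so that scalar test functions can be
paired with vector-valued ones. -/
theorem lintegral_pairing_lt_top {c : NNReal} (hc : 1 ≤ c) {φ : WaveFn 𝔥} {ψ : WaveFn 𝔨}
    (hφ : InFock c φ) (hψ : InFock c ψ) (n : ℕ) (s : Fin n → Fin 2) :
    ∫⁻ x, ‖φ n x s‖ₑ * ‖ψ n x fun i => (s i).rev‖ₑ ∂chainMeasure n < ⊤ := by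
  obtain ⟨-, f, hf, hfi, hfφ⟩ := hφ
  obtain ⟨-, g, hg, hgi, hgψ⟩ := hψ
  set s' : Fin n → Fin 2 := fun i => (s i).rev
  set a := (c : ENNReal) ^ (n - (pastSites s).card)
  set b := (c : ENNReal) ^ (n - (pastSites s').card)
  have hab : a * b ≠ ⊤ := ENNReal.mul_ne_top (by simp [a]) (by simp [b])
  calc ∫⁻ x, ‖φ n x s‖ₑ * ‖ψ n x s'‖ₑ ∂chainMeasure n
      ≤ ∫⁻ x, (a * b) * (f _ (pastChain x s) * g _ (pastChain x s')) ∂chainMeasure n := by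
        refine lintegral_mono_ae ?_
        filter_upwards [hfφ n s, hgψ n s'] with x h1 h2
        refine (mul_le_mul' h1 h2).trans (le_of_eq ?_)
        ring
    _ = (a * b) * ∫⁻ x, f _ (pastChain x s) * g _ (pastChain x s') ∂chainMeasure n :=
        lintegral_const_mul' _ _ hab
    _ ≤ (a * b) * ((∫⁻ y, f _ y ∂chainMeasure _) * ∫⁻ z, g _ z ∂chainMeasure _) := by
        gcongr
        exact lintegral_split_le s (hf _) (hg _)
    _ < ⊤ := ENNReal.mul_lt_top hab.lt_top
        (ENNReal.mul_lt_top (lintegral_ne_top_of_fock hc hfi _) (lintegral_ne_top_of_fock hc hgi _))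

theorem integrable_fibreForm {c : NNReal} (hc : 1 ≤ c) {φ ψ : WaveFn 𝔥}
    (hφ : InFock c φ) (hψ : InFock c ψ) (n : ℕ) :
    Integrable (fun x => fibreForm (φ n x) (ψ n x)) (chainMeasure n) := by
  refine integrable_finsetSum _ fun s _ => ⟨(hφ.1 n _).inner (hψ.1 n s), ?_⟩
  have h := lintegral_pairing_lt_top hc hφ hψ n fun i => (s i).rev
  simp only [Fin.rev_rev] at h
  refine lt_of_le_of_lt (lintegral_mono fun x => ?_) h
  rw [← enorm_norm, ← enorm_norm (φ n x _), ← enorm_norm (ψ n x _), ← enorm_mul]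
  exact enorm_le_iff_norm_le.2 (by simpa using norm_inner_le_norm _ _)

theorem InFock.shift {c : NNReal} {ψ : WaveFn 𝔥} (h : InFock c ψ) (t : ℝ) :
    InFock c (shift t ψ) := by
  obtain ⟨hm, g, hg, hgi, hgψ⟩ := h
  have hq := fun n => (measurePreserving_chain_add n t).quasiMeasurePreserving
  refine ⟨fun n s => (hm n s).comp_quasiMeasurePreserving (hq n),
    fun n x => g n fun i => x i + t, fun n => (hg n).comp_quasiMeasurePreserving (hq n), ?_,
    fun n s => (hq n).ae (hgψ n s)⟩
  refine lt_of_le_of_lt (le_of_eq ?_) hgi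
  congr 1
  funext n
  rw [(measurePreserving_chain_add n t).lintegral_comp_emb (measurableEmbedding_chain_add n t)]

theorem shift_shift (r t : ℝ) (ψ : WaveFn 𝔥) : shift r (shift t ψ) = shift (r + t) ψ := by
  funext n x
  simp only [shift]
  congr 1
  funext i
  ring

theorem shift_zero (ψ : WaveFn 𝔥) : shift 0 ψ = ψ := by
  funext n x
  simp [shift]

theorem isPseudoUnitary_shift (c : NNReal) (t : ℝ) :
    IsPseudoUnitary c (shift t : WaveFn 𝔥 → WaveFn 𝔥) := by
  refine ⟨⟨fun _ _ => rfl, fun _ _ => rfl⟩, fun ψ h => h.shift t,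
    ⟨shift (-t), fun ψ h => ⟨h.shift _, ?_, ?_⟩⟩, fun φ ψ _ _ => ?_⟩
  · rw [shift_shift, add_neg_cancel, shift_zero]
  · rw [shift_shift, neg_add_cancel, shift_zero]
  · unfold fockForm
    congr 1
    funext n
    exact integral_chain_add n t fun x => fibreForm (φ n x) (ψ n x)

/-! ### The reflection of the negative time domain -/

/-- The channels of the points of a tuple. -/
noncomputable def channel {n : ℕ} (x : Fin n → ℝ) : Fin n → Fin 2 := fun i => if x i < 0 then 0 else 1

theorem position_channel {n : ℕ} (x : Fin n → ℝ) : position (channel x) (fun i => |x i|) = x := by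
  funext i
  by_cases h : x i < 0
  · simp [position, channel, h, abs_of_neg h]
  · simp [position, channel, h, abs_of_nonneg (not_lt.1 h)]

theorem isTwoChannelChain_channel {n : ℕ} {x : Fin n → ℝ} (hx : StrictMono x) :
    IsTwoChannelChain (channel x) fun i => |x i| := by
  refine ⟨fun i => abs_nonneg _, fun i hi => ?_, by rwa [position_channel]⟩
  refine abs_pos.2 ?_
  by_contra h
  simp [channel, h] at hi

theorem position_advance {n : ℕ} (k : Fin n → Fin 2) (r : Fin n → ℝ) (h : ℝ) :
    position k (advance k r h) = fun i => position k r i - h := by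
  funext i
  by_cases hi : k i = 0 <;> simp [position, advance, hi]; ring

theorem position_eq_zero_iff {n : ℕ} (k : Fin n → Fin 2) (r : Fin n → ℝ) (i : Fin n) :
    position k r i = 0 ↔ r i = 0 := by
  by_cases hi : k i = 0 <;> simp [position, hi]

/-- Both origins sit at the real number `0`. The trace at the output end can therefore be taken
along the same tuple with its channel switched. -/
theorem position_update_channel {n : ℕ} (k : Fin n → Fin 2) (r : Fin n → ℝ) {i : Fin n}
    (hi : r i = 0) : position (Function.update k i 0) r = position k r := by
  funext j
  rcases eq_or_ne j i with rfl | h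
  · simp [position, hi]
  · simp [position, h]

/-- Signs and absolute values give every chain as a two-channel chain, and `advance` becomes the
common translation by `-h`; each clause then translates separately. -/
theorem isSchrodingerBVP_iff_isDiracBVP (H : ℝ → 𝔥 →L[ℂ] 𝔥) (ψ₀ : WaveFn 𝔥) (ψ : ℝ → WaveFn 𝔥) :
    IsSchrodingerBVP H ψ₀ ψ ↔ IsDiracBVP H (reflectNeg ψ₀) fun t => reflectNeg (ψ t) := by
  constructor
  · intro h
    refine ⟨fun n k r hk => h.initial n _ hk.2.2, fun n k r hk hr => ?_, fun n k r hk hr t ht => ?_,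
      fun n k r hk i hi t ht => ?_, fun n k r hk i hi t ht => ?_⟩
    · simp only [reflectNeg, position_advance]
      exact h.initial_trace n _ hk.2.2 fun i => by simpa [position_eq_zero_iff] using hr i
    · simp only [reflectNeg, position_advance]
      exact h.equation n _ hk.2.2 (fun i => by simpa [position_eq_zero_iff] using hr i) t ht
    · simp only [reflectNeg, position_advance, sub_neg_eq_add]
      exact h.right_trace n _ hk.2.2 i ((position_eq_zero_iff _ _ _).2 hi) t ht
    · simp only [reflectNeg, position_advance, position_update_channel k r hi]
      exact h.boundary n _ hk.2.2 i ((position_eq_zero_iff _ _ _).2 hi) t ht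
  · intro h
    refine ⟨fun n x hx => ?_, fun n x hx h0 => ?_, fun n x hx h0 t ht => ?_,
      fun n x hx i hi t ht => ?_, fun n x hx i hi t ht => ?_⟩
    · have := h.initial n _ _ (isTwoChannelChain_channel hx)
      simpa only [reflectNeg, position_channel] using this
    · have := h.initial_trace n _ _ (isTwoChannelChain_channel hx) fun i => by simpa using h0 i
      simpa only [reflectNeg, position_advance, position_channel] using this
    · have := h.equation n _ _ (isTwoChannelChain_channel hx) (fun i => by simpa using h0 i) t ht
      simpa only [reflectNeg, position_advance, position_channel] using this
    · have := h.right_trace n _ _ (isTwoChannelChain_channel hx) i (by simpa using hi) t ht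
      simpa only [reflectNeg, position_advance, position_channel, sub_neg_eq_add] using this
    · have hi' : |x i| = 0 := by simpa using hi
      have := h.boundary n _ _ (isTwoChannelChain_channel hx) i hi' t ht
      simpa only [reflectNeg, position_advance, position_update_channel (channel x) (fun j => |x j|) hi',
        position_channel] using this

theorem IsSchrodingerBVP.isDiracPair {H : ℝ → 𝔥 →L[ℂ] 𝔥} {ψ₀ : WaveFn 𝔥} {ψ : ℝ → WaveFn 𝔥}
    (h : IsSchrodingerBVP H ψ₀ ψ) : IsDiracPair H (fun t => reflectedNegPart (ψ t)) ψ := by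
  refine ⟨fun n x hx h0 t ht => ⟨?_, h.equation n x hx (fun i => (h0 i).ne') t ht⟩, fun t ht => ?_⟩
  · have hm : StrictMono fun i : Fin n => -x i.rev :=
      fun i j hij => neg_lt_neg (hx (Fin.rev_lt_rev.2 hij))
    have h1 := h.equation n _ hm (fun i => neg_ne_zero.2 (h0 _).ne') t ht
    rw [hasDerivAt_pi] at h1 ⊢
    intro s
    have h2 := h1 fun i => s i.rev
    simp only [reflectedNegPart, neg_add, ← sub_eq_add_neg]
    exact h2
  · have h1 := h.boundary 1 (fun _ => 0) (Subsingleton.strictMono _) 0 rfl t ht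
    have e : ∀ r : ℝ, reflectedNegPart (ψ (t + r)) 1 (fun _ => r) = ψ (t + r) 1 fun _ => 0 - r := by
      intro r
      funext s
      simp only [reflectedNegPart, zero_sub]
      congr 1
      funext i
      congr 1
      exact Subsingleton.elim _ _
    simpa only [e] using h1

end

/-! ### Step functions and the Itô-Schrödinger equation -/

section

variable {E : Type*} [NormedAddCommGroup E] {n : ℕ}

/-- The sum of the jumps `J i` at the times `y i ∈ [0, t)`. -/
noncomputable def jumpSum (y : Fin n → ℝ) (J : Fin n → E) (t : ℝ) : E :=
  ∑ i with 0 ≤ y i ∧ y i < t, J i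

theorem jumpSum_zero (y : Fin n → ℝ) (J : Fin n → E) : jumpSum y J 0 = 0 := by
  refine Finset.sum_eq_zero fun i hi => ?_
  have := (Finset.mem_filter.1 hi).2
  exact absurd this.2 (not_lt.2 this.1)

/-- The interval `[0, t)` excludes its right end, so a jump at `a` is not yet counted at time `a`;
it appears immediately afterwards. -/
theorem eventually_jumpSum_left (y : Fin n → ℝ) (J : Fin n → E) (a : ℝ) :
    ∀ᶠ t in 𝓝[<] a, jumpSum y J t = jumpSum y J a := by
  have h : ∀ᶠ t in 𝓝[<] a, ∀ i, y i < a → y i < t :=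
    eventually_all.2 fun i => by
      by_cases hi : y i < a
      · filter_upwards [nhdsWithin_le_nhds (Ioi_mem_nhds hi)] with t ht _ using ht
      · simp [hi]
  filter_upwards [h, self_mem_nhdsWithin] with t ht hta
  unfold jumpSum
  congr 1
  ext i
  simp only [Finset.mem_filter, Finset.mem_univ, true_and]
  exact ⟨fun h => ⟨h.1, h.2.trans hta⟩, fun h => ⟨h.1, ht i h.2⟩⟩

theorem eventually_jumpSum_right (y : Fin n → ℝ) (J : Fin n → E) {a : ℝ} (ha : 0 ≤ a) :
    ∀ᶠ t in 𝓝[>] a, jumpSum y J t = jumpSum y J a + ∑ i with y i = a, J i := by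
  have h : ∀ᶠ t in 𝓝[>] a, ∀ i, a < y i → t < y i :=
    eventually_all.2 fun i => by
      by_cases hi : a < y i
      · filter_upwards [nhdsWithin_le_nhds (Iio_mem_nhds hi)] with t ht _ using ht
      · simp [hi]
  filter_upwards [h, self_mem_nhdsWithin] with t ht hta
  unfold jumpSum
  rw [← Finset.sum_union]
  · congr 1
    ext i
    simp only [Finset.mem_filter, Finset.mem_univ, true_and, Finset.mem_union]
    constructor
    · rintro ⟨h0, h1⟩
      rcases lt_trichotomy (y i) a with h2 | h2 | h2
      · exact Or.inl ⟨h0, h2⟩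
      · exact Or.inr h2
      · exact absurd h1 (ht i h2).not_gt
    · rintro (⟨h0, h1⟩ | h1)
      · exact ⟨h0, h1.trans hta⟩
      · exact ⟨h1 ▸ ha, h1 ▸ hta⟩
  · refine Finset.disjoint_left.2 fun i hi hj => ?_
    simp only [Finset.mem_filter, Finset.mem_univ, true_and] at hi hj
    exact absurd hj hi.2.ne

theorem eventually_jumpSum_nhds (y : Fin n → ℝ) (J : Fin n → E) {a : ℝ} (ha : 0 ≤ a)
    (hy : ∀ i, y i ≠ a) : ∀ᶠ t in 𝓝 a, jumpSum y J t = jumpSum y J a := by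
  rw [← nhdsNE_sup_pure a, ← nhdsLT_sup_nhdsGT, eventually_sup, eventually_sup]
  refine ⟨⟨eventually_jumpSum_left y J a, ?_⟩, rfl⟩
  filter_upwards [eventually_jumpSum_right y J ha] with t ht
  rw [ht, Finset.sum_eq_zero, add_zero]
  exact fun i hi => absurd (Finset.mem_filter.1 hi).2 (hy i)

theorem sum_jump_at {y : Fin n → ℝ} (hy : Function.Injective y) (J : Fin n → E) (i : Fin n) :
    ∑ j with y j = y i, J j = J i := by
  rw [Finset.sum_eq_single_of_mem i (by simp)]
  exact fun j hj hji => absurd (hy (Finset.mem_filter.1 hj).2) hji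

/-- A left-continuous piecewise constant function is the sum of its jumps. -/
theorem eq_jumpSum_iff [NormedSpace ℝ E] [CompleteSpace E] {y : Fin n → ℝ}
    (hy : Function.Injective y) (J : Fin n → E) (f : ℝ → E) (f₀ : E) :
    (∀ t, 0 ≤ t → f t = f₀ + jumpSum y J t) ↔
      f 0 = f₀ ∧ ((∀ i, y i ≠ 0) → Tendsto f (𝓝[>] 0) (𝓝 (f 0))) ∧
      (∀ t, 0 < t → (∀ i, y i ≠ t) → HasDerivAt f 0 t) ∧
      (∀ i, 0 < y i → Tendsto f (𝓝[<] (y i)) (𝓝 (f (y i)))) ∧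
      ∀ i, 0 ≤ y i → Tendsto f (𝓝[>] (y i)) (𝓝 (f (y i) + J i)) := by
  constructor
  · intro h
    have h0 : f 0 = f₀ := by rw [h 0 le_rfl, jumpSum_zero, add_zero]
    have hr : ∀ a, 0 ≤ a → Tendsto f (𝓝[>] a) (𝓝 (f a + ∑ i with y i = a, J i)) := by
      intro a ha
      refine tendsto_const_nhds.congr' ?_
      filter_upwards [eventually_jumpSum_right y J ha, self_mem_nhdsWithin] with t ht hta
      rw [h t (ha.trans (le_of_lt hta)), ht, h a ha, add_assoc]
    refine ⟨h0, fun hy0 => ?_, fun t ht hyt => ?_, fun i hi => ?_, fun i hi => ?_⟩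
    · have := hr 0 le_rfl
      rwa [Finset.sum_eq_zero (fun i hi => absurd (Finset.mem_filter.1 hi).2 (hy0 i)),
        add_zero] at this
    · refine (hasDerivAt_const t (f t)).congr_of_eventuallyEq ?_
      filter_upwards [eventually_jumpSum_nhds y J ht.le hyt, Ioi_mem_nhds ht] with r hr hr0
      rw [h r (le_of_lt hr0), hr, h t ht.le]
    · refine tendsto_const_nhds.congr' ?_
      filter_upwards [eventually_jumpSum_left y J (y i),
        nhdsWithin_le_nhds (Ioi_mem_nhds hi)] with r hr hr0
      rw [h r (le_of_lt hr0), hr, h _ hi.le]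
    · have := hr (y i) hi
      rwa [sum_jump_at hy] at this
  · rintro ⟨h0, hi, hd, hl, hr⟩ T hT
    -- Subtracting the jumps leaves a function without one-sided discontinuities.
    set g : ℝ → E := fun t => f t - jumpSum y J t with hg
    have gl : ∀ t, 0 < t → Tendsto g (𝓝[<] t) (𝓝 (g t)) := by
      intro t ht
      refine Tendsto.sub ?_ (tendsto_const_nhds.congr' ?_)
      · by_cases h : ∃ i, y i = t
        · obtain ⟨i, rfl⟩ := h
          exact hl i ht
        · push Not at h
          exact (hd t ht h).continuousAt.tendsto.mono_left nhdsWithin_le_nhds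
      · filter_upwards [eventually_jumpSum_left y J t] with r hr using hr.symm
    have gr : ∀ t, 0 ≤ t → Tendsto g (𝓝[>] t) (𝓝 (g t)) := by
      intro t ht
      have h1 : Tendsto f (𝓝[>] t) (𝓝 (f t + ∑ i with y i = t, J i)) := by
        by_cases h : ∃ i, y i = t
        · obtain ⟨i, rfl⟩ := h
          rw [sum_jump_at hy]
          exact hr i ht
        · push Not at h
          rw [Finset.sum_eq_zero (fun i hi => absurd (Finset.mem_filter.1 hi).2 (h i)), add_zero]
          rcases ht.eq_or_lt with rfl | ht
          · exact hi h
          · exact (hd t ht h).continuousAt.tendsto.mono_left nhdsWithin_le_nhds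
      have h2 : Tendsto (jumpSum y J) (𝓝[>] t) (𝓝 (jumpSum y J t + ∑ i with y i = t, J i)) := by
        refine tendsto_const_nhds.congr' ?_
        filter_upwards [eventually_jumpSum_right y J ht] with r hr using hr.symm
      have := h1.sub h2
      rwa [add_sub_add_right_eq_sub] at this
    have gc : ContinuousOn g (Set.Icc 0 T) := by
      intro t ht
      have hR : ContinuousWithinAt g (Set.Ici t) t :=
        continuousWithinAt_Ioi_iff_Ici.1 (gr t ht.1)
      rcases ht.1.eq_or_lt with rfl | h
      · exact hR.mono fun r hr => hr.1
      · have hL : ContinuousWithinAt g (Set.Iic t) t := continuousWithinAt_Iio_iff_Iic.1 (gl t h)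
        have := hL.union hR
        rw [Set.Iic_union_Ici] at this
        exact this.mono (Set.subset_univ _)
    -- The derivative of `g` vanishes off the finitely many jump times and `g` is continuous, so `g
    -- T = g 0`.
    have key := integral_eq_of_hasDerivAt_off_countable_of_le g (fun _ => (0 : E)) hT
      (Set.finite_range y).countable gc (fun t ht => by
        have hyt : ∀ i, y i ≠ t := fun i hi => ht.2 ⟨i, hi⟩
        have h1 : HasDerivAt (jumpSum y J) 0 t :=
          (hasDerivAt_const t (jumpSum y J t)).congr_of_eventuallyEq
            (eventually_jumpSum_nhds y J ht.1.1.le hyt)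
        simpa [hg] using! (hd t ht.1.1 hyt).sub h1) (by simp)
    simp only [intervalIntegral.integral_zero, hg, jumpSum_zero, sub_zero, h0] at key
    rw [eq_comm, sub_sub, sub_eq_zero] at key
    rw [key, add_comm]

end

section

variable {𝔥 : Type*} [NormedAddCommGroup 𝔥] [InnerProductSpace ℂ 𝔥]

theorem legAct_gammaOp (H : ℝ → 𝔥 →L[ℂ] 𝔥) (t : ℝ) {n : ℕ} (i : Fin n) (Ψ : Fibre 𝔥 n)
    (s : Fin n → Fin 2) : legAct (gammaOp H t) i Ψ s =
      if s i = 0 then (-(Complex.I • H t)) (Ψ (Function.update s i 1)) else 0 := by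
  have h : s i = 0 ∨ s i = 1 := by
    generalize s i = a
    fin_cases a <;> simp
  rcases h with h | h <;> simp [legAct, gammaOp, sigmaOp, h, Fin.sum_univ_two]

theorem legAct_sigmaOp (H : ℝ → 𝔥 →L[ℂ] 𝔥) (t : ℝ) {n : ℕ} (i : Fin n) (Ψ : Fibre 𝔥 n) :
    legAct (sigmaOp H t) i Ψ = Ψ + legAct (gammaOp H t) i Ψ := by
  funext s
  rw [Pi.add_apply, legAct_gammaOp]
  have h : s i = 0 ∨ s i = 1 := by
    generalize s i = a
    fin_cases a <;> simp
  rcases h with h | h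
  · have e : Function.update s i 0 = s := by rw [← h, Function.update_eq_self]
    simp [legAct, sigmaOp, h, Fin.sum_univ_two, e]
  · have e : Function.update s i 1 = s := by rw [← h, Function.update_eq_self]
    simp [legAct, sigmaOp, h, Fin.sum_univ_two, e]

theorem tendsto_add_right_iff {E : Type*} [TopologicalSpace E] (f : ℝ → E) (t : ℝ) (l : Filter E) :
    Tendsto (fun h => f (t + h)) (𝓝[>] 0) l ↔ Tendsto f (𝓝[>] t) l := by
  have : 𝓝[>] t = map (fun h => t + h) (𝓝[>] 0) := by
    rw [map_add_left_nhdsGT, add_zero]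
  rw [this, tendsto_map'_iff]
  rfl

theorem tendsto_sub_left_iff {E : Type*} [TopologicalSpace E] (f : ℝ → E) (t : ℝ) (l : Filter E) :
    Tendsto (fun h => f (t - h)) (𝓝[>] 0) l ↔ Tendsto f (𝓝[<] t) l := by
  have : 𝓝[<] t = map (fun h => t - h) (𝓝[>] 0) := by
    simp
  rw [this, tendsto_map'_iff]
  rfl

theorem hasDerivAt_add_left_iff {E : Type*} [NormedAddCommGroup E] [NormedSpace ℝ E] (f : ℝ → E)
    (f' : E) (t : ℝ) : HasDerivAt (fun h => f (t + h)) f' 0 ↔ HasDerivAt f f' t := by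
  constructor
  · intro h
    have := HasDerivAt.comp_const_add (-t) t (by simpa using h)
    simpa using this
  · intro h
    exact HasDerivAt.comp_const_add t 0 (by simpa using h)

/-- Each clause of the boundary value problem, read along an integral curve, is one of the
conditions of `eq_jumpSum_iff` at a fixed chain. A point at the origin at time `t` is a point at `t`
of the unshifted chain, and the limit `σ = 1 + γ` from the left of the origin is a jump by `γ`. -/
theorem isItoSchrodinger_iff_isSchrodingerBVP [CompleteSpace 𝔥] (H : ℝ → 𝔥 →L[ℂ] 𝔥)
    (ψ₀ : WaveFn 𝔥) (ψ : ℝ → WaveFn 𝔥) :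
    IsItoSchrodinger H ψ₀ ψ ↔ IsSchrodingerBVP H ψ₀ fun t => shift t (ψ t) := by
  have key : ∀ (n : ℕ) (x : Fin n → ℝ), StrictMono x → _ := fun n x hx =>
    eq_jumpSum_iff hx.injective (fun i => legAct (gammaOp H (x i)) i (ψ (x i) n x))
      (fun r => ψ r n x) (ψ₀ n x)
  have e1 : ∀ (n : ℕ) (x : Fin n → ℝ) (t h : ℝ),
      (shift (t + h) (ψ (t + h)) n fun i => x i - h) = ψ (t + h) n fun i => x i + t := by
    intro n x t h
    simp only [shift]
    congr 1
    funext i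
    ring
  have e2 : ∀ (n : ℕ) (x : Fin n → ℝ) (t h : ℝ),
      (shift (t - h) (ψ (t - h)) n fun i => x i + h) = ψ (t - h) n fun i => x i + t := by
    intro n x t h
    simp only [shift]
    congr 1
    funext i
    ring
  have e3 : ∀ (n : ℕ) (x : Fin n → ℝ) (h : ℝ),
      (shift h (ψ h) n fun i => x i - h) = ψ h n x := by
    intro n x h
    simp only [shift, sub_add_cancel]
  have hs : ∀ (n : ℕ) (x : Fin n → ℝ) (t : ℝ), StrictMono x → StrictMono fun i => x i + t :=
    fun n x t hx => strictMono_add_const_iff.2 hx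
  constructor
  · intro h
    have h' := fun n x hx => (key n x hx).1 (h n x hx)
    refine ⟨fun n x hx => ?_, fun n x hx h0 => ?_, fun n x hx h0 t ht => ?_,
      fun n x hx i hi t ht => ?_, fun n x hx i hi t ht => ?_⟩
    · rw [shift_zero]
      exact (h' n x hx).1
    · simp only [e3, shift_zero]
      exact (h' n x hx).2.1 h0
    · simp only [e1]
      rw [hasDerivAt_add_left_iff fun r => ψ r n fun i => x i + t]
      exact (h' n _ (hs n x t hx)).2.2.1 t ht fun i => by simpa using h0 i
    · simp only [e2]
      rw [tendsto_sub_left_iff fun r => ψ r n fun i => x i + t]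
      have := (h' n _ (hs n x t hx)).2.2.2.1 i (by simpa [hi] using ht)
      simpa only [hi, zero_add] using! this
    · simp only [e1]
      rw [tendsto_add_right_iff fun r => ψ r n fun i => x i + t, legAct_sigmaOp]
      have := (h' n _ (hs n x t hx)).2.2.2.2 i (by simpa [hi] using ht)
      simpa only [hi, zero_add] using! this
  · intro h n x hx
    -- Conversely, the jump at `x i` is read off from the boundary condition at time `x i` for the
    -- chain translated so that its `i`-th point is the origin.
    have hs' : ∀ i, StrictMono fun j => x j - x i := fun i => by
      simpa only [sub_eq_add_neg] using hs n x (-x i) hx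
    refine (key n x hx).2 ⟨?_, fun h0 => ?_, fun t ht h0 => ?_, fun i hi => ?_, fun i hi => ?_⟩
    · simpa only [shift_zero] using h.initial n x hx
    · simpa only [e3, shift_zero] using h.initial_trace n x hx h0
    · have := h.equation n (fun j => x j - t) (by simpa only [sub_eq_add_neg] using hs n x (-t) hx)
        (fun i => sub_ne_zero.2 (h0 i)) t ht
      simp only [e1, sub_add_cancel] at this
      exact (hasDerivAt_add_left_iff (fun r => ψ r n x) 0 t).1 this
    · have := h.right_trace n _ (hs' i) i (sub_self _) (x i) hi
      simp only [e2] at this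
      simp only [shift, sub_add_cancel] at this
      exact (tendsto_sub_left_iff (fun r => ψ r n x) _ _).1 this
    · have := h.boundary n _ (hs' i) i (sub_self _) (x i) hi
      simp only [e1] at this
      simp only [shift, sub_add_cancel, legAct_sigmaOp] at this
      exact (tendsto_add_right_iff (fun r => ψ r n x) _ _).1 this

end

/-! ### Pseudo-unitarity of the boundary condition -/

section

variable {𝔥 : Type*} [NormedAddCommGroup 𝔥] [InnerProductSpace ℂ 𝔥]

/-- The operator `A` of `𝔥` times the lowering of the spin at the `i`-th point. -/
noncomputable def legNil (A : 𝔥 →L[ℂ] 𝔥) {n : ℕ} (i : Fin n) : Fibre 𝔥 n →L[ℂ] Fibre 𝔥 n :=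
  ContinuousLinearMap.pi fun s =>
    if s i = 0 then A ∘L ContinuousLinearMap.proj (Function.update s i 1) else 0

theorem legNil_apply (A : 𝔥 →L[ℂ] 𝔥) {n : ℕ} (i : Fin n) (Ψ : Fibre 𝔥 n) (s : Fin n → Fin 2) :
    legNil A i Ψ s = if s i = 0 then A (Ψ (Function.update s i 1)) else 0 := by
  simp only [legNil, ContinuousLinearMap.coe_pi']
  split_ifs <;> rfl

/-- The operator reads only components whose `i`-th spin is future and writes only components where
it is past. -/
theorem legNil_mul_self (A : 𝔥 →L[ℂ] 𝔥) {n : ℕ} (i : Fin n) : legNil A i * legNil A i = 0 := by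
  ext Ψ s
  simp [legNil_apply]

/-- The same `A` acts at both points, so the order of the two actions is immaterial. This allows
products over unordered sets of points. -/
theorem legNil_commute (A : 𝔥 →L[ℂ] 𝔥) {n : ℕ} (i j : Fin n) :
    Commute (legNil A i) (legNil A j) := by
  rcases eq_or_ne i j with rfl | hij
  · exact Commute.refl _
  ext Ψ s
  simp only [mul_apply_eq_comp, legNil_apply, Function.update_of_ne hij,
    Function.update_of_ne hij.symm, Function.update_comm hij]
  split_ifs <;> simp

/-- The operator `σ` at the `i`-th point, with its inverse. -/
noncomputable def legSigma (A : 𝔥 →L[ℂ] 𝔥) {n : ℕ} (i : Fin n) :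
    (Fibre 𝔥 n →L[ℂ] Fibre 𝔥 n)ˣ where
  val := 1 + legNil A i
  inv := 1 - legNil A i
  val_inv := by noncomm_ring [legNil_mul_self]
  inv_val := by noncomm_ring [legNil_mul_self]

theorem legSigma_commute (A : 𝔥 →L[ℂ] 𝔥) {n : ℕ} (i j : Fin n) :
    Commute (legSigma A i) (legSigma A j) := by
  refine Units.ext ?_
  exact ((Commute.one_left _).add_left ((Commute.one_right _).add_right (legNil_commute A i j)))

theorem legAct_sigmaOp_eq (H : ℝ → 𝔥 →L[ℂ] 𝔥) (t : ℝ) {n : ℕ} (i : Fin n) (Ψ : Fibre 𝔥 n) :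
    legAct (sigmaOp H t) i Ψ = (legSigma (-(Complex.I • H t)) i).1 Ψ := by
  rw [legAct_sigmaOp]
  funext s
  simp [legAct_gammaOp, legSigma, legNil_apply]

theorem fibreForm_add_left {n : ℕ} (Φ Φ' Ψ : Fibre 𝔥 n) :
    fibreForm (Φ + Φ') Ψ = fibreForm Φ Ψ + fibreForm Φ' Ψ := by
  simp [fibreForm, Finset.sum_add_distrib]

theorem fibreForm_add_right {n : ℕ} (Φ Ψ Ψ' : Fibre 𝔥 n) :
    fibreForm Φ (Ψ + Ψ') = fibreForm Φ Ψ + fibreForm Φ Ψ' := by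
  simp [fibreForm, Finset.sum_add_distrib]

theorem fibreForm_smul_right {n : ℕ} (c : ℂ) (Φ Ψ : Fibre 𝔥 n) :
    fibreForm Φ (c • Ψ) = c * fibreForm Φ Ψ := by
  simp [fibreForm, Finset.mul_sum]

theorem fibreForm_smul_left {n : ℕ} (c : ℂ) (Φ Ψ : Fibre 𝔥 n) :
    fibreForm (c • Φ) Ψ = (starRingEnd ℂ) c * fibreForm Φ Ψ := by
  simp [fibreForm, Finset.mul_sum, mul_comm]

theorem continuous_fibreForm (n : ℕ) :
    Continuous fun p : Fibre 𝔥 n × Fibre 𝔥 n => fibreForm p.1 p.2 := by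
  unfold fibreForm
  fun_prop

/-- Reversal of the spin at the `i`-th point. -/
def flipAt {n : ℕ} (i : Fin n) : Equiv.Perm (Fin n → Fin 2) :=
  Function.Involutive.toPerm (fun s => Function.update s i (s i).rev) fun s => by simp

theorem flipAt_apply {n : ℕ} (i : Fin n) (s : Fin n → Fin 2) :
    flipAt i s = Function.update s i (s i).rev := rfl

theorem fibreForm_legNil {A : 𝔥 →L[ℂ] 𝔥} (hA : ∀ u v, inner ℂ (A u) v = -inner ℂ u (A v)) {n : ℕ}
    (i : Fin n) (Φ Ψ : Fibre 𝔥 n) :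
    fibreForm (legNil A i Φ) Ψ = -fibreForm Φ (legNil A i Ψ) := by
  unfold fibreForm
  -- Moving the operator to the other slot exchanges a configuration with the one flipped at `i`,
  -- because the metric reverses that spin.
  rw [← Finset.sum_neg_distrib, ← Equiv.sum_comp (flipAt i)]
  refine Finset.sum_congr rfl fun s _ => ?_
  have h : s i = 0 ∨ s i = 1 := by
    generalize s i = a
    fin_cases a <;> simp
  have e : (fun j => ((flipAt i s) j).rev) = Function.update (fun j => (s j).rev) i (s i) := by
    funext j
    rcases eq_or_ne j i with rfl | hj
    · simp [flipAt_apply]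
    · simp [flipAt_apply, hj]
  have e2 : ∀ a : Fin 2, Function.update (fun j => (s j).rev) i a.rev =
      fun j => (Function.update s i a j).rev := by
    intro a
    funext j
    rcases eq_or_ne j i with rfl | hj <;> simp [*]
  rw [e]
  rcases h with h | h
  · have e3 : Function.update (fun j => (s j).rev) i 1 = fun j => (s j).rev := by
      have := e2 0
      have h' : Function.update s i 0 = s := by rw [← h, Function.update_eq_self]
      rw [h'] at this
      exact this
    have e4 : flipAt i s = Function.update s i 1 := by
      simp [flipAt_apply, h]
    simp [legNil_apply, h, e3, e4, hA]
  · simp [legNil_apply, h]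

/-- Expanding `(1 + N, 1 + N)`, the linear terms cancel by skewness and the quadratic one is `-(Φ,
N²Ψ) = 0`. -/
theorem fibreForm_legSigma {A : 𝔥 →L[ℂ] 𝔥} (hA : ∀ u v, inner ℂ (A u) v = -inner ℂ u (A v)) {n : ℕ}
    (i : Fin n) (Φ Ψ : Fibre 𝔥 n) :
    fibreForm ((legSigma A i).1 Φ) ((legSigma A i).1 Ψ) = fibreForm Φ Ψ := by
  have h := congrArg (fun T => T Ψ) (legNil_mul_self A i)
  simp only [mul_apply_eq_comp, zero_apply] at h
  simp only [legSigma, add_apply, one_apply_eq_self,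
    fibreForm_add_left, fibreForm_add_right, fibreForm_legNil hA, h]
  simp [fibreForm]

theorem inner_neg_I_smul [CompleteSpace 𝔥] {B : 𝔥 →L[ℂ] 𝔥} (hB : IsSelfAdjoint B) (u v : 𝔥) :
    inner ℂ ((-(Complex.I • B)) u) v = -inner ℂ u ((-(Complex.I • B)) v) := by
  have : inner ℂ (B u) v = inner ℂ u (B v) := hB.isSymmetric u v
  simp [inner_smul_left, inner_smul_right, this]

theorem legAct_sigmaOp_pseudoUnitary [CompleteSpace 𝔥] {H : ℝ → 𝔥 →L[ℂ] 𝔥} {t : ℝ}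
    (h : IsSelfAdjoint (H t)) (n : ℕ) (i : Fin n) :
    Function.Bijective (legAct (sigmaOp H t) i : Fibre 𝔥 n → Fibre 𝔥 n) ∧
      ∀ Φ Ψ : Fibre 𝔥 n,
        fibreForm (legAct (sigmaOp H t) i Φ) (legAct (sigmaOp H t) i Ψ) = fibreForm Φ Ψ := by
  set S := legSigma (n := n) (-(Complex.I • H t)) i with hS
  have e : (legAct (sigmaOp H t) i : Fibre 𝔥 n → Fibre 𝔥 n) = S.1 :=
    funext fun Ψ => legAct_sigmaOp_eq H t i Ψ
  rw [e]
  refine ⟨Function.bijective_iff_has_inverse.2 ⟨S.inv, fun Ψ => ?_, fun Ψ => ?_⟩,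
    fibreForm_legSigma (inner_neg_I_smul h) i⟩
  · exact congrArg (fun T => T Ψ) S.inv_val
  · exact congrArg (fun T => T Ψ) S.val_inv

/-- The operators `σ` at all the points of `J`. -/
noncomputable def legSigmas (A : 𝔥 →L[ℂ] 𝔥) {n : ℕ} (J : Finset (Fin n)) :
    (Fibre 𝔥 n →L[ℂ] Fibre 𝔥 n)ˣ :=
  J.noncommProd (legSigma A) fun i _ j _ _ => legSigma_commute A i j

theorem legSigmas_insert (A : 𝔥 →L[ℂ] 𝔥) {n : ℕ} {J : Finset (Fin n)} {i : Fin n} (hi : i ∉ J) :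
    legSigmas A (insert i J) = legSigmas A J * legSigma A i :=
  Finset.noncommProd_insert_of_notMem' _ _ _ _ hi

theorem fibreForm_legSigmas {A : 𝔥 →L[ℂ] 𝔥} (hA : ∀ u v, inner ℂ (A u) v = -inner ℂ u (A v))
    {n : ℕ} (J : Finset (Fin n)) (Φ Ψ : Fibre 𝔥 n) :
    fibreForm ((legSigmas A J).1 Φ) ((legSigmas A J).1 Ψ) = fibreForm Φ Ψ := by
  induction J using Finset.induction_on generalizing Φ Ψ with
  | empty =>
    simp only [legSigmas]
    rfl
  | insert i J hi ih =>
    rw [legSigmas_insert A hi]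
    exact (ih _ _).trans (fibreForm_legSigma hA i Φ Ψ)

/-- The points of a chain in `ℝ₊`. -/
noncomputable def nonnegSites {n : ℕ} (x : Fin n → ℝ) : Finset (Fin n) :=
  Finset.univ.filter fun i => 0 ≤ x i

/-- Multiplication by `σ` at the points of `ℝ₊`; it turns the boundary condition into continuity. -/
noncomputable def boundaryGauge (A : 𝔥 →L[ℂ] 𝔥) {n : ℕ} (x : Fin n → ℝ) :
    (Fibre 𝔥 n →L[ℂ] Fibre 𝔥 n)ˣ :=
  legSigmas A (nonnegSites x)

/-- The gauge depends on the chain only through the finite datum of which points lie in `ℝ₊`, so it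
takes finitely many values on measurable sets. The same fact gives a uniform norm bound. -/
theorem stronglyMeasurable_boundaryGauge (A : 𝔥 →L[ℂ] 𝔥) {n : ℕ} :
    StronglyMeasurable (fun x : Fin n → ℝ => (boundaryGauge A x).1) ∧
      StronglyMeasurable (fun x : Fin n → ℝ => (boundaryGauge A x)⁻¹.1) := by
  let _ : MeasurableSpace (Finset (Fin n)) := ⊤
  have hm : Measurable (nonnegSites : (Fin n → ℝ) → Finset (Fin n)) := by
    refine measurable_to_countable' fun J => ?_
    have : nonnegSites ⁻¹' {J} = ⋂ i, {x : Fin n → ℝ | 0 ≤ x i ↔ i ∈ J} := by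
      ext x
      simp [nonnegSites, Finset.ext_iff]
    rw [this]
    refine MeasurableSet.iInter fun i => ?_
    by_cases hi : i ∈ J
    · simpa [hi] using measurableSet_le measurable_const (measurable_pi_apply i)
    · simpa [hi] using measurableSet_lt (measurable_pi_apply i) measurable_const
  exact ⟨(StronglyMeasurable.of_discrete (f := fun J => (legSigmas A J).1)).comp_measurable hm,
    (StronglyMeasurable.of_discrete (f := fun J => (legSigmas A J)⁻¹.1)).comp_measurable hm⟩

theorem exists_boundaryGauge_bound (A : 𝔥 →L[ℂ] 𝔥) (n : ℕ) :
    ∃ C : ℝ, 0 ≤ C ∧ ∀ x : Fin n → ℝ, ‖(boundaryGauge A x).1‖ ≤ C ∧ ‖(boundaryGauge A x)⁻¹.1‖ ≤ C := by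
  refine ⟨∑ J : Finset (Fin n), (‖(legSigmas A J).1‖ + ‖(legSigmas A J)⁻¹.1‖), by positivity,
    fun x => ?_⟩
  have := Finset.single_le_sum (f := fun J : Finset (Fin n) =>
    ‖(legSigmas A J).1‖ + ‖(legSigmas A J)⁻¹.1‖) (fun _ _ => by positivity)
    (Finset.mem_univ (nonnegSites x))
  have h1 := norm_nonneg (legSigmas A (nonnegSites x)).1
  have h2 := norm_nonneg (legSigmas A (nonnegSites x))⁻¹.1
  constructor <;> unfold boundaryGauge <;> linarith

/-- On a line, the gauge is constant as long as no point enters `ℝ₊`. -/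
theorem boundaryGauge_line_eq (A : 𝔥 →L[ℂ] 𝔥) {n : ℕ} {x : Fin n → ℝ} {a b : ℝ} (hab : a ≤ b)
    (h : ∀ i, ¬(a < -x i ∧ -x i ≤ b)) :
    boundaryGauge A (fun i => x i + a) = boundaryGauge A fun i => x i + b := by
  unfold boundaryGauge
  congr 1
  ext i
  simp only [nonnegSites, Finset.mem_filter, Finset.mem_univ, true_and]
  have := h i
  push Not at this
  constructor
  · intro h1; linarith
  · intro h1
    by_contra h2
    have := this (by linarith)
    linarith

/-- The gauge just before the `i`-th point enters `ℝ₊`. -/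
theorem boundaryGauge_line_left (A : 𝔥 →L[ℂ] 𝔥) {n : ℕ} {x : Fin n → ℝ} (hx : Function.Injective x)
    (i : Fin n) : ∀ᶠ r in 𝓝[<] (-x i),
      boundaryGauge A (fun j => x j + -x i) = boundaryGauge A (fun j => x j + r) * legSigma A i := by
  have h : ∀ᶠ r in 𝓝[<] (-x i), ∀ j, -x j < -x i → -x j < r :=
    eventually_all.2 fun j => by
      by_cases hj : -x j < -x i
      · filter_upwards [nhdsWithin_le_nhds (Ioi_mem_nhds hj)] with t ht _ using ht
      · simp [hj]
  filter_upwards [h, self_mem_nhdsWithin] with r hr hri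
  have hri : r < -x i := hri
  unfold boundaryGauge
  rw [← legSigmas_insert]
  · congr 1
    ext j
    simp only [nonnegSites, Finset.mem_filter, Finset.mem_univ, true_and, Finset.mem_insert]
    constructor
    · intro h1
      rcases eq_or_ne j i with rfl | hj
      · exact Or.inl rfl
      · have h2 : x j ≠ x i := fun h => hj (hx h)
        have h3 : -x j < -x i := by
          rcases h2.lt_or_gt with h | h <;> linarith
        exact Or.inr (by linarith [hr j h3])
    · rintro (rfl | h1)
      · simp
      · linarith
  · simp only [nonnegSites, Finset.mem_filter, Finset.mem_univ, true_and]
    linarith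

end

/-! ### Absolutely continuous functions with jumps on a line -/

section

variable {E : Type*} [NormedAddCommGroup E] [InnerProductSpace ℂ E]

theorem integrable_inner_of_continuousOn {u v : ℝ → E} {a b : ℝ}
    (hu : IntegrableOn u (Set.Ioc a b)) (hv : ContinuousOn v (Set.Icc a b)) :
    IntegrableOn (fun r => inner ℂ (u r) (v r)) (Set.Ioc a b) ∧
      IntegrableOn (fun r => inner ℂ (v r) (u r)) (Set.Ioc a b) := by
  obtain ⟨C, hC⟩ := isCompact_Icc.exists_bound_of_continuousOn hv
  have hvm := (hv.mono Set.Ioc_subset_Icc_self).aestronglyMeasurable (μ := volume) measurableSet_Ioc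
  have hb : ∀ r ∈ Set.Ioc a b, ‖u r‖ * ‖v r‖ ≤ C * ‖u r‖ := fun r hr => by
    rw [mul_comm]
    exact mul_le_mul_of_nonneg_right (hC r (Set.Ioc_subset_Icc_self hr)) (norm_nonneg _)
  constructor
  · refine (hu.norm.const_mul C).mono' (hu.1.inner hvm) ?_
    filter_upwards [ae_restrict_mem measurableSet_Ioc] with r hr
    exact (norm_inner_le_norm _ _).trans (hb r hr)
  · refine (hu.norm.const_mul C).mono' (hvm.inner hu.1) ?_
    filter_upwards [ae_restrict_mem measurableSet_Ioc] with r hr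
    exact (norm_inner_le_norm _ _).trans ((mul_comm _ _).trans_le (hb r hr))

/-- The product rule for the inner product of two primitives. -/
theorem integral_inner_primitive [CompleteSpace E] {u v u' v' : ℝ → E} {a b : ℝ} (hab : a ≤ b)
    (hu' : IntervalIntegrable u' volume a b) (hv' : IntervalIntegrable v' volume a b)
    (hu : ∀ r ∈ Set.Icc a b, u r = u a + ∫ s in a..r, u' s)
    (hv : ∀ r ∈ Set.Icc a b, v r = v a + ∫ s in a..r, v' s) :
    IntervalIntegrable (fun r => inner ℂ (u' r) (v r) + inner ℂ (u r) (v' r)) volume a b ∧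
    inner ℂ (u b) (v b) - inner ℂ (u a) (v a) =
      ∫ r in a..b, (inner ℂ (u' r) (v r) + inner ℂ (u r) (v' r)) := by
  have hcont : ∀ {w w' : ℝ → E}, IntervalIntegrable w' volume a b →
      (∀ r ∈ Set.Icc a b, w r = w a + ∫ s in a..r, w' s) → ContinuousOn w (Set.Icc a b) := by
    intro w w' hw' hw
    have h := intervalIntegral.continuousOn_primitive_interval (μ := volume)
      ((intervalIntegrable_iff_integrableOn_Icc_of_le hab).1 hw' |>.mono_set
        (Set.uIcc_of_le hab).le)
    rw [Set.uIcc_of_le hab] at h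
    exact (continuousOn_const.add h).congr hw
  have hu1 := (intervalIntegrable_iff_integrableOn_Ioc_of_le hab).1 hu'
  have hv1 := (intervalIntegrable_iff_integrableOn_Ioc_of_le hab).1 hv'
  have i1 := (integrable_inner_of_continuousOn hu1 (hcont hv' hv)).1
  have i2 := (integrable_inner_of_continuousOn hv1 (hcont hu' hu)).2
  refine ⟨(intervalIntegrable_iff_integrableOn_Ioc_of_le hab).2 (i1.add i2), ?_⟩
  set ν := volume.restrict (Set.Ioc a b) with hν
  -- Inserting the primitives writes each product integral as a boundary term plus the integral of
  -- this kernel over one of the two triangles of the square.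
  have hK : Integrable (fun p : ℝ × ℝ => inner ℂ (u' p.1) (v' p.2)) (ν.prod ν) := by
    refine (hu1.norm.mul_prod hv1.norm).mono (hu1.1.comp_fst.inner hv1.1.comp_snd) ?_
    exact ae_of_all _ fun p => by simpa using norm_inner_le_norm _ _
  have hprim : ∀ {w w' : ℝ → E}, (∀ r ∈ Set.Icc a b, w r = w a + ∫ s in a..r, w' s) →
      ∀ r ∈ Set.Ioc a b, w r = w a + ∫ s, (Set.Iic r).indicator w' s ∂ν := by
    intro w w' hw r hr
    rw [hw r ⟨hr.1.le, hr.2⟩, intervalIntegral.integral_of_le hr.1.le,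
      integral_indicator measurableSet_Iic, hν, Measure.restrict_restrict measurableSet_Iic]
    congr 3
    ext s
    simp only [Set.mem_Ioc, Set.mem_inter_iff, Set.mem_Iic]
    exact ⟨fun h => ⟨h.2, h.1, h.2.trans hr.2⟩, fun h => ⟨h.2.1, h.1⟩⟩
  have hle1 : MeasurableSet {p : ℝ × ℝ | p.2 ≤ p.1} := measurableSet_le measurable_snd measurable_fst
  have hle2 : MeasurableSet {p : ℝ × ℝ | p.1 ≤ p.2} := measurableSet_le measurable_fst measurable_snd
  have hK1 := hK.indicator hle1
  have hK2 := hK.indicator hle2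
  have e1 : ∫ r, inner ℂ (u' r) (v r) ∂ν = inner ℂ (∫ r, u' r ∂ν) (v a) +
      ∫ r, (∫ s, {p : ℝ × ℝ | p.2 ≤ p.1}.indicator
        (fun p => inner ℂ (u' p.1) (v' p.2)) (r, s) ∂ν) ∂ν := by
    have h1 : inner ℂ (∫ r, u' r ∂ν) (v a) = ∫ r, inner ℂ (u' r) (v a) ∂ν := by
      rw [← inner_conj_symm, ← integral_inner hu1, ← integral_conj]
      simp only [inner_conj_symm, hν]
    rw [h1, ← integral_add (hu1.inner_const _) hK1.integral_prod_left]
    refine integral_congr_ae ?_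
    filter_upwards [ae_restrict_mem measurableSet_Ioc] with r hr
    have h2 : Integrable ((Set.Iic r).indicator v') ν := hv1.indicator measurableSet_Iic
    rw [hprim hv r hr, inner_add_right, ← integral_inner h2]
    congr 2
    funext s
    by_cases hs : s ≤ r <;> simp [hs]
  have e2 : ∫ s, inner ℂ (u s) (v' s) ∂ν = inner ℂ (u a) (∫ r, v' r ∂ν) +
      ∫ r, (∫ s, {p : ℝ × ℝ | p.1 ≤ p.2}.indicator
        (fun p => inner ℂ (u' p.1) (v' p.2)) (r, s) ∂ν) ∂ν := by
    rw [integral_integral_swap (f := fun r s => {p : ℝ × ℝ | p.1 ≤ p.2}.indicator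
        (fun p => inner ℂ (u' p.1) (v' p.2)) (r, s)) hK2, ← integral_inner hv1,
      ← integral_add (hv1.const_inner _) hK2.integral_prod_right]
    refine integral_congr_ae ?_
    filter_upwards [ae_restrict_mem measurableSet_Ioc] with s hs
    have h2 : Integrable ((Set.Iic s).indicator u') ν := hu1.indicator measurableSet_Iic
    rw [hprim hu s hs, inner_add_left, ← inner_conj_symm (∫ r, _ ∂ν), ← integral_inner h2,
      ← integral_conj]
    congr 2
    funext r
    rw [inner_conj_symm]
    by_cases hr : r ≤ s <;> simp [hr]
  -- The triangles fill the square and overlap only in the diagonal, whose sections are null.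
  have e3 : (∫ r, (∫ s, {p : ℝ × ℝ | p.2 ≤ p.1}.indicator
        (fun p => inner ℂ (u' p.1) (v' p.2)) (r, s) ∂ν) ∂ν) +
      ∫ r, (∫ s, {p : ℝ × ℝ | p.1 ≤ p.2}.indicator
        (fun p => inner ℂ (u' p.1) (v' p.2)) (r, s) ∂ν) ∂ν =
      inner ℂ (∫ r, u' r ∂ν) (∫ s, v' s ∂ν) := by
    rw [← integral_add hK1.integral_prod_left hK2.integral_prod_left, ← inner_conj_symm,
      ← integral_inner hu1, ← integral_conj]
    refine integral_congr_ae ?_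
    filter_upwards [hK1.prod_right_ae, hK2.prod_right_ae] with r h1 h2
    rw [← integral_add h1 h2, inner_conj_symm, ← integral_inner hv1]
    refine integral_congr_ae ?_
    have h0 : ∀ᵐ s ∂ν, s ≠ r := ae_restrict_of_ae (by simp [ae_iff])
    filter_upwards [h0] with s hs
    rcases hs.lt_or_gt with h | h
    · simp [h.le, h.not_ge]
    · simp [h.le, h.not_ge]
  rw [intervalIntegral.integral_of_le hab, integral_add i1 i2, e1, e2,
    hu b (Set.right_mem_Icc.2 hab), hv b (Set.right_mem_Icc.2 hab),
    intervalIntegral.integral_of_le hab, intervalIntegral.integral_of_le hab]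
  simp only [inner_add_left, inner_add_right]
  linear_combination -e3

end

section

variable {E : Type*} [NormedAddCommGroup E] [NormedSpace ℝ E]

/-- The function is constant on each piece that starts at a point `p i` and ends before the next
one; continuity from the left glues the pieces. It is thus continuous with zero right derivative
everywhere. -/
theorem eq_of_locally_constant_of_left_continuous {n : ℕ} {p : Fin n → ℝ} {G : ℝ → E}
    (h : ∀ a b, a ≤ b → (∀ i, ¬(a < p i ∧ p i ≤ b)) → G a = G b)
    (hl : ∀ i, Tendsto G (𝓝[<] (p i)) (𝓝 (G (p i)))) {a b : ℝ} (hab : a ≤ b) : G a = G b := by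
  have hr : ∀ r, ∀ᶠ t in 𝓝[>] r, G t = G r := by
    intro r
    have h1 : ∀ᶠ t in 𝓝[>] r, ∀ i, r < p i → t < p i :=
      eventually_all.2 fun i => by
        by_cases hi : r < p i
        · filter_upwards [nhdsWithin_le_nhds (Iio_mem_nhds hi)] with t ht _ using ht
        · simp [hi]
    filter_upwards [h1, self_mem_nhdsWithin] with t ht hrt
    exact (h r t (le_of_lt hrt) fun i hi => absurd (ht i hi.1) hi.2.not_gt).symm
  have hr' : ∀ r, G =ᶠ[𝓝[≥] r] fun _ => G r := by
    intro r
    rw [← Set.Ioi_union_left]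
    refine eventually_nhdsWithin_iff.2 ?_
    filter_upwards [eventually_nhdsWithin_iff.1 (hr r)] with t ht hm
    rcases hm with hm | hm
    · exact ht hm
    · rw [Set.mem_singleton_iff.1 hm]
  have hc : Continuous G := by
    refine continuous_iff_continuousAt.2 fun r => continuousAt_iff_continuous_left_right.2 ⟨?_, ?_⟩
    · refine continuousWithinAt_Iio_iff_Iic.1 ?_
      by_cases hp : ∃ i, p i = r
      · obtain ⟨i, rfl⟩ := hp
        exact hl i
      · push Not at hp
        have h1 : ∀ᶠ t in 𝓝[<] r, ∀ i, p i < r → p i < t :=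
          eventually_all.2 fun i => by
            by_cases hi : p i < r
            · filter_upwards [nhdsWithin_le_nhds (Ioi_mem_nhds hi)] with t ht _ using ht
            · simp [hi]
        refine tendsto_const_nhds.congr' ?_
        filter_upwards [h1, self_mem_nhdsWithin] with t ht htr
        exact (h t r (le_of_lt htr) fun i hi =>
          absurd hi.1 (ht i (lt_of_le_of_ne hi.2 (hp i))).not_gt).symm
    · exact tendsto_const_nhds.congr' (hr' r).symm
  refine (constant_of_has_deriv_right_zero hc.continuousOn (fun r _ => ?_) b
    (Set.right_mem_Icc.2 hab)).symm
  exact (hasDerivWithinAt_const r _ (G r)).congr_of_eventuallyEq (hr' r) rfl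

end

/-! ### The product rule across the origin -/

section

variable {𝔥 : Type*} [NormedAddCommGroup 𝔥] [InnerProductSpace ℂ 𝔥]

/-- `u` is absolutely continuous with derivative `u'`, except for jumps at the points `p i`, where
it is right-continuous and the limit from the left is given by `T i`. -/
structure IsJumpPrimitive {n : ℕ} (p : Fin n → ℝ) (T : Fin n → Fibre 𝔥 n → Fibre 𝔥 n)
    (u u' : ℝ → Fibre 𝔥 n) : Prop where
  integrable : ∀ (s : Fin n → Fin 2) (a b : ℝ), IntervalIntegrable (fun r => u' r s) volume a b
  primitive : ∀ (s : Fin n → Fin 2) (a b : ℝ), a ≤ b → (∀ i, ¬(a < p i ∧ p i ≤ b)) →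
    u b s - u a s = ∫ r in a..b, u' r s
  jump : ∀ i, Tendsto u (𝓝[<] (p i)) (𝓝 (T i (u (p i))))

/-- Between the jumps this is the product rule. At a jump both arguments change by the same `T i`,
which preserves the form, so the form itself is continuous there. -/
theorem IsJumpPrimitive.fibreForm_sub [CompleteSpace 𝔥] {n : ℕ} {p : Fin n → ℝ}
    {T : Fin n → Fibre 𝔥 n → Fibre 𝔥 n} (hT : ∀ i Φ Ψ, fibreForm (T i Φ) (T i Ψ) = fibreForm Φ Ψ)
    {u u' v v' : ℝ → Fibre 𝔥 n} (hu : IsJumpPrimitive p T u u') (hv : IsJumpPrimitive p T v v')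
    (hi : ∀ a b, IntervalIntegrable (fun r => fibreForm (u' r) (v r) + fibreForm (u r) (v' r))
      volume a b) {a b : ℝ} (hab : a ≤ b) :
    fibreForm (u b) (v b) - fibreForm (u a) (v a) =
      ∫ r in a..b, (fibreForm (u' r) (v r) + fibreForm (u r) (v' r)) := by
  set F' := fun r => fibreForm (u' r) (v r) + fibreForm (u r) (v' r) with hF'
  have h1 : ∀ a b, a ≤ b → (∀ i, ¬(a < p i ∧ p i ≤ b)) →
      fibreForm (u b) (v b) - fibreForm (u a) (v a) = ∫ r in a..b, F' r := by
    intro a b hab hp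
    have hprim : ∀ {w w' : ℝ → Fibre 𝔥 n}, IsJumpPrimitive p T w w' → ∀ s, ∀ r ∈ Set.Icc a b,
        w r s = w a s + ∫ q in a..r, w' q s := by
      intro w w' hw s r hr
      rw [← hw.primitive s a r hr.1 fun i h => hp i ⟨h.1, h.2.trans hr.2⟩]
      abel
    have h2 := fun s : Fin n → Fin 2 => integral_inner_primitive hab
      (hu.integrable (fun i => (s i).rev) a b) (hv.integrable s a b)
      (hprim hu fun i => (s i).rev) (hprim hv s)
    simp only [hF', fibreForm, ← Finset.sum_sub_distrib, ← Finset.sum_add_distrib]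
    rw [intervalIntegral.integral_finsetSum fun s _ => (h2 s).1]
    exact Finset.sum_congr rfl fun s _ => (h2 s).2
  -- The form minus its candidate primitive is locally constant off the jumps and left-continuous at
  -- them.
  set G : ℝ → ℂ := fun r => fibreForm (u r) (v r) - ∫ q in (0 : ℝ)..r, F' q with hG
  have h3 : G a = G b := by
    refine eq_of_locally_constant_of_left_continuous (p := p) (fun a b hab hp => ?_) (fun i => ?_) hab
    · have := h1 a b hab hp
      have h4 := intervalIntegral.integral_add_adjacent_intervals (hi 0 a) (hi a b)
      simp only [hG]
      linear_combination -this - h4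
    · refine Tendsto.sub ?_ ?_
      · rw [← hT i]
        exact ((continuous_fibreForm n).tendsto _).comp ((hu.jump i).prodMk_nhds (hv.jump i))
      · exact ((intervalIntegral.continuous_primitive hi 0).tendsto _).mono_left nhdsWithin_le_nhds
  have h4 := intervalIntegral.integral_add_adjacent_intervals (hi 0 a) (hi a b)
  simp only [hG] at h3
  linear_combination -h3 - h4

end

/-! ### The momentum is pseudo-symmetric -/

section

variable {E : Type*} [NormedAddCommGroup E]

theorem MeasureTheory.Integrable.chainLocInt {n : ℕ} {F : (Fin n → ℝ) → E}
    (hF : Integrable F (chainMeasure n)) : ChainLocInt F :=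
  ⟨hF.1, fun _ => hF.integrableOn⟩

end

section

variable {𝔥 : Type*} [NormedAddCommGroup 𝔥] [InnerProductSpace ℂ 𝔥]

theorem hasShiftDeriv_iff {S : Matrix (Fin 2) (Fin 2) (𝔥 →L[ℂ] 𝔥)} {ψ χ : WaveFn 𝔥} :
    HasShiftDeriv S ψ χ ↔ ∀ n, ∃ ψ' : (Fin n → ℝ) → Fibre 𝔥 n,
      (∀ᵐ x ∂chainMeasure n, ψ' x = ψ n x) ∧
      ∀ᵐ x ∂chainMeasure n, IsJumpPrimitive (fun i => -x i) (fun i => legAct S i)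
        (fun r => ψ' fun i => x i + r) fun r => χ n fun i => x i + r := by
  constructor
  · rintro ⟨ψ', h⟩ n
    refine ⟨ψ' n, (h n).1, ?_⟩
    filter_upwards [(h n).2] with x hx
    exact ⟨hx.1, hx.2.1, hx.2.2⟩
  · intro h
    choose ψ' h1 h2 using h
    refine ⟨ψ', fun n => ⟨h1 n, ?_⟩⟩
    filter_upwards [h2 n] with x hx
    exact ⟨hx.1, hx.2, hx.3⟩

/-- Integrate `F'` by averaging over unit segments: on almost every line the average is `F(x + 1) -
F(x)`. Both terms are integrable with equal integrals. -/
theorem integral_fibreForm_shiftDeriv [CompleteSpace 𝔥] {c : NNReal} (hc : 1 ≤ c)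
    {S : Matrix (Fin 2) (Fin 2) (𝔥 →L[ℂ] 𝔥)}
    (hS : ∀ n (i : Fin n) (Φ Ψ : Fibre 𝔥 n),
      fibreForm (legAct S i Φ) (legAct S i Ψ) = fibreForm Φ Ψ)
    {φ ψ χ ρ : WaveFn 𝔥} (hφ : InFock c φ) (hψ : InFock c ψ) (hχ : InFock c χ) (hρ : InFock c ρ)
    (h1 : HasShiftDeriv S φ χ) (h2 : HasShiftDeriv S ψ ρ) (n : ℕ) :
    ∫ x, fibreForm (χ n x) (ψ n x) ∂chainMeasure n +
      ∫ x, fibreForm (φ n x) (ρ n x) ∂chainMeasure n = 0 := by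
  obtain ⟨φ', hφ', hφj⟩ := hasShiftDeriv_iff.1 h1 n
  obtain ⟨ψ', hψ', hψj⟩ := hasShiftDeriv_iff.1 h2 n
  have i1 := integrable_fibreForm hc hχ hψ n
  have i2 := integrable_fibreForm hc hφ hρ n
  set F' : (Fin n → ℝ) → ℂ := fun x => fibreForm (χ n x) (ψ' x) + fibreForm (φ' x) (ρ n x)
  set F : (Fin n → ℝ) → ℂ := fun x => fibreForm (φ' x) (ψ' x)
  have hF'e : (fun x => fibreForm (χ n x) (ψ n x) + fibreForm (φ n x) (ρ n x))
      =ᵐ[chainMeasure n] F' := by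
    filter_upwards [hφ', hψ'] with x e1 e2
    simp only [F', e1, e2]
  have hF' : Integrable F' (chainMeasure n) := (i1.add i2).congr hF'e
  have hF : Integrable F (chainMeasure n) := by
    refine (integrable_fibreForm hc hφ hψ n).congr ?_
    filter_upwards [hφ', hψ'] with x e1 e2
    simp only [F, e1, e2]
  have hF1 : Integrable (fun x : Fin n → ℝ => F fun i => x i + 1) (chainMeasure n) :=
    ((measurePreserving_chain_add n 1).integrable_comp_emb
      (measurableEmbedding_chain_add n 1)).2 hF
  rw [← integral_add i1 i2, integral_congr_ae hF'e, ← integral_chain_strip hF']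
  have key : ∀ᵐ x ∂chainMeasure n, (F fun i => x i + 1) - F x =
      ∫ r in (0 : ℝ)..1, F' fun i => x i + r := by
    filter_upwards [hφj, hψj, hF'.chainLocInt.ae_line] with x hx1 hx2 hx3
    have := hx1.fibreForm_sub (hS n) hx2 hx3 zero_le_one
    simpa only [add_zero] using this
  rw [← integral_congr_ae key, integral_sub hF1 hF, integral_chain_add n 1 F, sub_self]

theorem InFock.const_smul {c : NNReal} {ψ : WaveFn 𝔥} (h : InFock c ψ) (z : ℂ) :
    InFock c (z • ψ) := by
  obtain ⟨hm, g, hg, hgi, hgψ⟩ := h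
  refine ⟨fun n s => (hm n s).const_smul z, fun n x => ‖z‖ₑ * g n x,
    fun n => (hg n).const_mul _, ?_, fun n s => ?_⟩
  · have : ∀ n, (c : ENNReal) ^ n * ∫⁻ x, ‖z‖ₑ * g n x ∂chainMeasure n =
        ‖z‖ₑ * ((c : ENNReal) ^ n * ∫⁻ x, g n x ∂chainMeasure n) := fun n => by
      rw [lintegral_const_mul' _ _ enorm_ne_top]
      ring
    simp only [this, ENNReal.tsum_mul_left]
    exact ENNReal.mul_lt_top enorm_lt_top hgi
  · filter_upwards [hgψ n s] with x hx
    rw [mul_assoc]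
    calc ‖(z • ψ) n x s‖ₑ = ‖z‖ₑ * ‖ψ n x s‖ₑ := enorm_smul _ _
      _ ≤ _ := by gcongr

theorem IsMomentum.fockForm_eq [CompleteSpace 𝔥] {c : NNReal} (hc : 1 ≤ c)
    {S : Matrix (Fin 2) (Fin 2) (𝔥 →L[ℂ] 𝔥)}
    (hS : ∀ n (i : Fin n) (Φ Ψ : Fibre 𝔥 n),
      fibreForm (legAct S i Φ) (legAct S i Ψ) = fibreForm Φ Ψ)
    {φ χ ψ ρ : WaveFn 𝔥} (h1 : IsMomentum c S φ χ) (h2 : IsMomentum c S ψ ρ) :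
    fockForm χ ψ = fockForm φ ρ := by
  obtain ⟨hφ, hχ, χ', hχ', rfl⟩ := h1
  obtain ⟨hψ, hρ, ρ', hρ', rfl⟩ := h2
  have hI : ∀ ω : WaveFn 𝔥, InFock c (Complex.I • ω) → InFock c ω := fun ω hω => by
    have := hω.const_smul (-Complex.I)
    rwa [smul_smul, neg_mul, Complex.I_mul_I, neg_neg, one_smul] at this
  unfold fockForm
  congr 1
  funext n
  have key := integral_fibreForm_shiftDeriv hc hS hφ hψ (hI _ hχ) (hI _ hρ) hχ' hρ' n
  have e1 : ∀ x, fibreForm ((Complex.I • χ') n x) (ψ n x) =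
      -Complex.I * fibreForm (χ' n x) (ψ n x) := fun x => by
    rw [← Complex.conj_I]
    exact fibreForm_smul_left _ _ _
  have e2 : ∀ x, fibreForm (φ n x) ((Complex.I • ρ') n x) =
      Complex.I * fibreForm (φ n x) (ρ' n x) := fun x => fibreForm_smul_right _ _ _
  simp only [e1, e2, integral_const_mul]
  -- The form is conjugate-linear in its first slot, so the factors `i` come out with opposite
  -- signs.
  linear_combination -Complex.I * key

end

/-! ### Test functions in the domain of the momentum -/

section

variable {𝔥 : Type*} [NormedAddCommGroup 𝔥] [InnerProductSpace ℂ 𝔥]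

theorem aestronglyMeasurable_clm_apply {α F G : Type*} [MeasurableSpace α] {μ : Measure α}
    [NormedAddCommGroup F] [NormedSpace ℂ F] [NormedAddCommGroup G] [NormedSpace ℂ G]
    {T : α → F →L[ℂ] G} {f : α → F} (hT : AEStronglyMeasurable T μ)
    (hf : AEStronglyMeasurable f μ) : AEStronglyMeasurable (fun x => T x (f x)) μ :=
  (ContinuousLinearMap.id ℂ (F →L[ℂ] G)).aestronglyMeasurable_comp₂ hT hf

theorem aestronglyMeasurable_pi {α ι F : Type*} [MeasurableSpace α] {μ : Measure α} [Fintype ι]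
    [NormedAddCommGroup F] {f : α → ι → F} (h : ∀ i, AEStronglyMeasurable (fun x => f x i) μ) :
    AEStronglyMeasurable f μ := by
  classical
  have : f = fun x => ∑ i, Pi.single i (f x i) := funext fun x => (Finset.univ_sum_single _).symm
  rw [this]
  exact Finset.aestronglyMeasurable_fun_sum _ fun i _ =>
    (continuous_single i).comp_aestronglyMeasurable (h i)

/-- The gauge is constant until a point enters `ℝ₊` and then acquires the factor `σ` of that point.
Its inverse, applied to a continuous `θ`, therefore has a left limit equal to `σ` times the value:
the boundary condition holds by construction. -/
theorem isJumpPrimitive_boundaryGauge [CompleteSpace 𝔥] (H : ℝ → 𝔥 →L[ℂ] 𝔥) (t : ℝ) {n : ℕ}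
    {x : Fin n → ℝ} (hx : Function.Injective x) {θ y : ℝ → Fibre 𝔥 n}
    (hy : ∀ a b, IntervalIntegrable y volume a b)
    (hθ : ∀ a b, a ≤ b → θ b - θ a = ∫ r in a..b, y r) :
    IsJumpPrimitive (fun i => -x i) (fun i => legAct (sigmaOp H t) i)
      (fun r => (boundaryGauge (-(Complex.I • H t)) fun i => x i + r)⁻¹.1 (θ r))
      (fun r => (boundaryGauge (-(Complex.I • H t)) fun i => x i + r)⁻¹.1 (y r)) := by
  set B := -(Complex.I • H t)
  have hθc : Continuous θ := by
    have e : θ = fun b => θ 0 + ∫ r in (0 : ℝ)..b, y r := by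
      funext b
      rcases le_total 0 b with hb | hb
      · rw [← hθ 0 b hb, add_sub_cancel]
      · rw [intervalIntegral.integral_symm, ← hθ b 0 hb]
        abel
    rw [e]
    exact continuous_const.add (intervalIntegral.continuous_primitive hy 0)
  refine ⟨fun s a b => ?_, fun s a b hab hp => ?_, fun i => ?_⟩
  · obtain ⟨C, -, hC⟩ := exists_boundaryGauge_bound B n
    have hm : StronglyMeasurable fun r : ℝ => (boundaryGauge B fun i => x i + r)⁻¹.1 :=
      (stronglyMeasurable_boundaryGauge B).2.comp_measurable (by fun_prop)
    have h1 := intervalIntegrable_iff.1 (hy a b)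
    rw [intervalIntegrable_iff]
    refine (h1.norm.const_mul C).mono' ?_ (ae_of_all _ fun r => ?_)
    · exact (continuous_apply s).comp_aestronglyMeasurable
        (aestronglyMeasurable_clm_apply hm.aestronglyMeasurable h1.1)
    · exact (norm_le_pi_norm _ s).trans (((boundaryGauge B fun i => x i + r)⁻¹.1.le_opNorm _).trans
        (mul_le_mul_of_nonneg_right (hC _).2 (norm_nonneg _)))
  · set L : Fibre 𝔥 n →L[ℂ] 𝔥 :=
      (ContinuousLinearMap.proj s).comp (boundaryGauge B fun i => x i + b)⁻¹.1
    have h1 : ∀ r ∈ Set.Icc a b, ∀ Ψ, (boundaryGauge B fun i => x i + r)⁻¹.1 Ψ s = L Ψ := by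
      intro r hr Ψ
      rw [boundaryGauge_line_eq B hr.2 fun i h => hp i ⟨hr.1.trans_lt h.1, h.2⟩]
      rfl
    simp only [h1 b (Set.right_mem_Icc.2 hab), h1 a (Set.left_mem_Icc.2 hab)]
    rw [← map_sub, hθ a b hab, ← L.intervalIntegral_comp_comm (hy a b)]
    refine intervalIntegral.integral_congr fun r hr => ?_
    rw [Set.uIcc_of_le hab] at hr
    exact (h1 r hr _).symm
  · have h1 : ∀ᶠ r in 𝓝[<] (-x i), legAct (sigmaOp H t) i
        ((boundaryGauge B fun j => x j + -x i)⁻¹.1 (θ r)) =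
        (boundaryGauge B fun j => x j + r)⁻¹.1 (θ r) := by
      filter_upwards [boundaryGauge_line_left B hx i] with r hr
      rw [legAct_sigmaOp_eq, hr, mul_inv_rev]
      have : (legSigma B i).1 * ((legSigma B i)⁻¹ * (boundaryGauge B fun j => x j + r)⁻¹).1 =
          (boundaryGauge B fun j => x j + r)⁻¹.1 := by
        rw [← Units.val_mul, mul_inv_cancel_left]
      exact congrArg (fun T => T (θ r)) this
    refine Tendsto.congr' h1 ?_
    simp only [legAct_sigmaOp_eq]
    have hc : Continuous fun r => (legSigma B i).1
        ((boundaryGauge B fun j => x j + -x i)⁻¹.1 (θ r)) := by fun_prop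
    exact (hc.tendsto _).mono_left nhdsWithin_le_nhds

theorem isBounded_chainBox (n : ℕ) (R : ℝ) : Bornology.IsBounded {x : Fin n → ℝ | ∀ i, |x i| ≤ R} := by
  refine (Metric.isBounded_Icc (fun _ => -R) fun _ => R).subset fun x hx => ?_
  exact ⟨fun i => (abs_le.1 (hx i)).1, fun i => (abs_le.1 (hx i)).2⟩

theorem chainMeasure_chainBox_lt_top (n : ℕ) (R : ℝ) :
    chainMeasure n {x | ∀ i, |x i| ≤ R} < ⊤ :=
  (Measure.restrict_apply_le _ _).trans_lt (isBounded_chainBox n R).measure_lt_top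

/-- Bounded functions with bounded support on the chains of `n` points are in the Fock space. -/
theorem inFock_single {c : NNReal} (hc : 1 ≤ c) {n : ℕ} {F : (Fin n → ℝ) → Fibre 𝔥 n} {C R : ℝ}
    (hm : AEStronglyMeasurable F (chainMeasure n)) (hC : ∀ x, ‖F x‖ ≤ C)
    (hR : ∀ x, ¬(∀ i, |x i| ≤ R) → F x = 0) : InFock c (Pi.single n F : WaveFn 𝔥) := by
  -- Past subchains of an `n`-point chain have at most `n` points and stay in the box, so a majorant
  -- with finitely many nonzero levels suffices.
  refine ⟨fun m s => ?_, fun m y => if m ≤ n then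
    {y : Fin m → ℝ | ∀ i, |y i| ≤ R}.indicator (fun _ => ENNReal.ofReal C) y else 0,
    fun m => ?_, ?_, fun m s => ?_⟩
  · rcases eq_or_ne m n with rfl | h
    · simp only [Pi.single_eq_same]
      exact (continuous_apply s).comp_aestronglyMeasurable hm
    · simp only [Pi.single_eq_of_ne h]
      exact aestronglyMeasurable_const
  · beta_reduce
    split_ifs
    · exact (measurable_const.indicator (measurableSet_chainBox m R)).aemeasurable
    · exact aemeasurable_const
  · rw [tsum_eq_sum (s := Finset.range (n + 1))]
    · refine ENNReal.sum_lt_top.2 fun m _ => ENNReal.mul_lt_top (by simp) ?_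
      beta_reduce
      split_ifs
      · rw [lintegral_indicator_const (measurableSet_chainBox m R)]
        exact ENNReal.mul_lt_top ENNReal.ofReal_lt_top (chainMeasure_chainBox_lt_top m R)
      · simp
    · intro m hm
      have : ¬ m ≤ n := by simpa using hm
      simp [this]
  · refine ae_of_all _ fun x => ?_
    rcases eq_or_ne m n with rfl | h
    · simp only [Pi.single_eq_same]
      by_cases hx : ∀ i, |x i| ≤ R
      · have h1 : (pastSites s).card ≤ m := by simpa using (pastSites s).card_le_univ
        have h2 : (1 : ENNReal) ≤ (c : ENNReal) ^ (m - (pastSites s).card) :=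
          one_le_pow₀ (by exact_mod_cast hc)
        rw [if_pos h1, Set.indicator_of_mem (show pastChain x s ∈ {y : Fin _ → ℝ | ∀ i, |y i| ≤ R} from
          fun j => hx _)]
        calc ‖F x s‖ₑ = ENNReal.ofReal ‖F x s‖ := (ofReal_norm _).symm
          _ ≤ ENNReal.ofReal C := ENNReal.ofReal_le_ofReal ((norm_le_pi_norm _ s).trans (hC x))
          _ = ENNReal.ofReal C * 1 := (mul_one _).symm
          _ ≤ _ := by gcongr
      · simp [hR x hx]
    · simp [Pi.single_eq_of_ne h]

/-- Pairing with the indicator function of a box, taken in the Fock space with object space `ℂ` and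
with all spin components equal to `1`, gives finite integrals over the box for each component. -/
theorem InFock.chainLocInt {c : NNReal} (hc : 1 ≤ c) {φ : WaveFn 𝔥} (h : InFock c φ) (n : ℕ) :
    ChainLocInt (φ n) := by
  have hm : AEStronglyMeasurable (φ n) (chainMeasure n) :=
    aestronglyMeasurable_pi fun s => h.1 n s
  refine ⟨hm, fun R => ?_⟩
  refine Integrable.of_eval fun s => ⟨(h.1 n s).restrict, ?_⟩
  set F : (Fin n → ℝ) → Fibre ℂ n := {x | ∀ i, |x i| ≤ R}.indicator fun _ _ => 1
  have hF : InFock c (Pi.single n F : WaveFn ℂ) := by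
    refine inFock_single hc (C := 1) (R := R) ?_ (fun x => ?_) fun x hx => ?_
    · exact (stronglyMeasurable_const.indicator (measurableSet_chainBox n R)).aestronglyMeasurable
    · refine (norm_indicator_le_norm_self _ _).trans ?_
      exact (pi_norm_le_iff_of_nonneg zero_le_one).2 fun s => by simp
    · exact Set.indicator_of_notMem (s := {x : Fin n → ℝ | ∀ i, |x i| ≤ R}) hx _
  have key := lintegral_pairing_lt_top hc h hF n s
  refine lt_of_le_of_lt ?_ key
  rw [← lintegral_indicator (measurableSet_chainBox n R)]
  refine lintegral_mono fun x => ?_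
  by_cases hx : x ∈ {x : Fin n → ℝ | ∀ i, |x i| ≤ R}
  · rw [Set.indicator_of_mem hx]
    simp [F, Set.indicator_of_mem hx]
  · rw [Set.indicator_of_notMem hx]
    exact bot_le

/-- The average of the indicator function of `A` over the segment of length `h` to the left. -/
noncomputable def slideAvg {n : ℕ} (A : Set (Fin n → ℝ)) (h : ℝ) (x : Fin n → ℝ) : ℝ :=
  ∫ r in (0 : ℝ)..h, A.indicator (fun _ => (1 : ℝ)) fun i => x i + -r

/-- The derivative of `slideAvg` along the shifts. -/
noncomputable def slideDiff {n : ℕ} (A : Set (Fin n → ℝ)) (h : ℝ) (x : Fin n → ℝ) : ℝ :=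
  A.indicator (fun _ => (1 : ℝ)) x - A.indicator (fun _ => (1 : ℝ)) fun i => x i + -h

section

variable {n : ℕ} {A : Set (Fin n → ℝ)} (hA : MeasurableSet A) {h : ℝ}

include hA

theorem intervalIntegrable_indicator_line (x : Fin n → ℝ) (a b : ℝ) :
    IntervalIntegrable (fun r => A.indicator (fun _ => (1 : ℝ)) fun i => x i + r) volume a b := by
  rw [intervalIntegrable_iff]
  refine Integrable.mono' (g := fun _ => (1 : ℝ))
      (intervalIntegrable_iff.1 intervalIntegrable_const) ?_ (ae_of_all _ fun r => ?_)
  · exact ((stronglyMeasurable_const.indicator hA).comp_measurable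
      (by fun_prop)).aestronglyMeasurable
  · exact (norm_indicator_le_norm_self _ _).trans (by simp)

/-- On a line the average is an integral over the moving window `[b - h, b]`; its derivative is the
integrand at the front end minus that at the rear end. -/
theorem slideAvg_line_sub (x : Fin n → ℝ) (a b : ℝ) :
    (slideAvg A h fun i => x i + b) - (slideAvg A h fun i => x i + a) =
      ∫ r in a..b, slideDiff A h fun i => x i + r := by
  set k : ℝ → ℝ := fun r => A.indicator (fun _ => (1 : ℝ)) fun i => x i + r with hk
  have hki : ∀ a b, IntervalIntegrable k volume a b := intervalIntegrable_indicator_line hA x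
  have e : ∀ b, (slideAvg A h fun i => x i + b) = ∫ r in (b - h)..b, k r := by
    intro b
    have := intervalIntegral.integral_comp_sub_left k b (a := 0) (b := h)
    rw [sub_zero] at this
    rw [← this]
    simp only [slideAvg, hk, add_assoc, sub_eq_add_neg]
  have e2 : ∀ r, (slideDiff A h fun i => x i + r) = k r - k (r - h) := by
    intro r
    simp only [slideDiff, hk, add_assoc, sub_eq_add_neg]
  have e3 : IntervalIntegrable (fun r => k (r - h)) volume a b := by
    have := (hki (a - h) (b - h)).comp_sub_right h
    simpa using this
  simp only [e, e2]
  rw [intervalIntegral.integral_sub (hki a b) e3, intervalIntegral.integral_comp_sub_right,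
    intervalIntegral.integral_interval_sub_interval_comm (hki _ _) (hki _ _) (hki _ _),
    intervalIntegral.integral_symm (a - h), intervalIntegral.integral_symm a b]
  ring

theorem stronglyMeasurable_slideDiff : StronglyMeasurable (slideDiff A h) :=
  (stronglyMeasurable_const.indicator hA).sub
    ((stronglyMeasurable_const.indicator hA).comp_measurable (by fun_prop))

theorem stronglyMeasurable_slideAvg (hh : 0 ≤ h) : StronglyMeasurable (slideAvg A h) := by
  have : slideAvg A h = fun x => ∫ r in Set.Ioc 0 h,
      A.indicator (fun _ => (1 : ℝ)) fun i => x i + -r := by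
    funext x
    exact intervalIntegral.integral_of_le hh
  rw [this]
  refine StronglyMeasurable.integral_prod_right
    (f := fun (x : Fin n → ℝ) r => A.indicator (fun _ => (1 : ℝ)) fun i => x i + -r) ?_
  have hm : Measurable fun (p : (Fin n → ℝ) × ℝ) (i : Fin n) => p.1 i + -p.2 := by fun_prop
  exact (stronglyMeasurable_const.indicator hA).comp_measurable hm

end

theorem abs_slideDiff_le {n : ℕ} (A : Set (Fin n → ℝ)) (h : ℝ) (x : Fin n → ℝ) :
    |slideDiff A h x| ≤ 1 := by
  have h1 : ∀ y, A.indicator (fun _ => (1 : ℝ)) y = 0 ∨ A.indicator (fun _ => (1 : ℝ)) y = 1 :=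
    fun y => by by_cases hy : y ∈ A <;> simp [hy]
  unfold slideDiff
  rcases h1 x with e | e <;> rcases h1 fun i => x i + -h with e' | e' <;> rw [e, e'] <;> norm_num

theorem abs_slideAvg_le {n : ℕ} (A : Set (Fin n → ℝ)) {h : ℝ} (hh : 0 ≤ h) (x : Fin n → ℝ) :
    |slideAvg A h x| ≤ h := by
  have := intervalIntegral.norm_integral_le_of_norm_le_const (a := 0) (b := h) (C := 1)
    (f := fun r => A.indicator (fun _ => (1 : ℝ)) fun i => x i + -r) fun r _ =>
    (norm_indicator_le_norm_self _ _).trans (by simp)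
  simpa [slideAvg, abs_of_nonneg hh] using this

theorem slide_eq_zero {n : ℕ} {A : Set (Fin n → ℝ)} {N h : ℝ} (hAN : A ⊆ {x | ∀ i, |x i| ≤ N})
    (hh : 0 ≤ h) {x : Fin n → ℝ} (hx : ¬∀ i, |x i| ≤ N + h) :
    slideAvg A h x = 0 ∧ slideDiff A h x = 0 := by
  have h1 : ∀ r, 0 ≤ r → r ≤ h → (fun i => x i + -r) ∉ A := by
    intro r h0 hr hm
    refine hx fun i => ?_
    have h2 := abs_le.1 (hAN hm i)
    exact abs_le.2 ⟨by linarith [h2.1], by linarith [h2.2]⟩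
  constructor
  · unfold slideAvg
    rw [intervalIntegral.integral_congr (g := fun _ => (0 : ℝ)), intervalIntegral.integral_zero]
    intro r hr
    rw [Set.uIcc_of_le hh] at hr
    exact Set.indicator_of_notMem (h1 r hr.1 hr.2) _
  · have h2 := h1 0 le_rfl hh
    simp only [neg_zero, add_zero] at h2
    simp [slideDiff, Set.indicator_of_notMem h2, Set.indicator_of_notMem (h1 h hh le_rfl)]

/-- A test function in the domain of the momentum. -/
theorem isMomentum_slide [CompleteSpace 𝔥] {c : NNReal} (hc : 1 ≤ c) (H : ℝ → 𝔥 →L[ℂ] 𝔥) (t : ℝ)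
    {n : ℕ} {A : Set (Fin n → ℝ)} (hA : MeasurableSet A) {N h : ℝ}
    (hAN : A ⊆ {x | ∀ i, |x i| ≤ N}) (hh : 0 ≤ h) (e : Fibre 𝔥 n) :
    IsMomentum c (sigmaOp H t)
      (Pi.single n fun x => (boundaryGauge (-(Complex.I • H t)) x)⁻¹.1 (slideAvg A h x • e))
      (Complex.I • Pi.single n fun x =>
        (boundaryGauge (-(Complex.I • H t)) x)⁻¹.1 (slideDiff A h x • e)) := by
  set B := -(Complex.I • H t) with hB
  obtain ⟨C, hC0, hC⟩ := exists_boundaryGauge_bound B n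
  have hF : ∀ (f : (Fin n → ℝ) → ℝ) (D : ℝ), StronglyMeasurable f → (∀ x, |f x| ≤ D) →
      (∀ x, (¬∀ i, |x i| ≤ N + h) → f x = 0) →
      InFock c (Pi.single n fun x => (boundaryGauge B x)⁻¹.1 (f x • e) : WaveFn 𝔥) := by
    intro f D hf hD h0
    refine inFock_single hc (C := C * (D * ‖e‖)) (R := N + h) ?_ (fun x => ?_) fun x hx => ?_
    · exact aestronglyMeasurable_clm_apply
        (stronglyMeasurable_boundaryGauge B).2.aestronglyMeasurable
        (hf.smul_const e).aestronglyMeasurable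
    · refine ((boundaryGauge B x)⁻¹.1.le_opNorm _).trans
        (mul_le_mul (hC x).2 ?_ (norm_nonneg _) hC0)
      rw [norm_smul]
      exact mul_le_mul_of_nonneg_right (hD x) (norm_nonneg _)
    · rw [h0 x hx, zero_smul, map_zero]
  refine ⟨hF _ h (stronglyMeasurable_slideAvg hA hh) (abs_slideAvg_le A hh)
    fun x hx => (slide_eq_zero hAN hh hx).1,
    (hF _ 1 (stronglyMeasurable_slideDiff hA) (abs_slideDiff_le A h)
    fun x hx => (slide_eq_zero hAN hh hx).2).const_smul _, _, ?_, rfl⟩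
  rw [hasShiftDeriv_iff]
  intro m
  rcases eq_or_ne m n with rfl | hm
  · refine ⟨_, ae_of_all _ fun x => rfl, ?_⟩
    filter_upwards [ae_strictMono m] with x hx
    simp only [Pi.single_eq_same]
    have hi : ∀ a b, IntervalIntegrable (fun r => slideDiff A h fun i => x i + r) volume a b := by
      intro a b
      rw [intervalIntegrable_iff]
      refine Integrable.mono' (g := fun _ => (1 : ℝ))
        (intervalIntegrable_iff.1 intervalIntegrable_const) ?_ (ae_of_all _ fun r => ?_)
      · exact ((stronglyMeasurable_slideDiff hA).comp_measurable
          (by fun_prop)).aestronglyMeasurable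
      · exact abs_slideDiff_le A h _
    refine isJumpPrimitive_boundaryGauge H t hx.injective (θ := fun r =>
      (slideAvg A h fun i => x i + r) • e) (y := fun r => (slideDiff A h fun i => x i + r) • e)
      (fun a b => ⟨(hi a b).1.smul_const e, (hi a b).2.smul_const e⟩) fun a b _ => ?_
    rw [← sub_smul, slideAvg_line_sub hA, intervalIntegral.integral_smul_const]
  · refine ⟨fun _ => 0, ae_of_all _ fun x => by simp [Pi.single_eq_of_ne hm], ?_⟩
    refine ae_of_all _ fun x => ?_
    simp only [Pi.single_eq_of_ne hm]
    refine ⟨fun s a b => by simp, fun s a b _ _ => by simp, fun i => ?_⟩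
    simp only [legAct_sigmaOp_eq, map_zero]
    exact tendsto_const_nhds

end

/-! ### Weak derivatives along the shifts -/

section

variable {E : Type*} [NormedAddCommGroup E] [NormedSpace ℝ E] {n : ℕ}

theorem ChainLocInt.integrableOn_shift {F : (Fin n → ℝ) → E} (hF : ChainLocInt F) (N h : ℝ) :
    IntegrableOn (fun x => F fun i => x i + h) {x | ∀ i, |x i| ≤ N} (chainMeasure n) := by
  have h1 := ((measurePreserving_chain_add n h).restrict_preimage
    (measurableSet_chainBox n (N + |h|))).integrable_comp_emb (measurableEmbedding_chain_add n h)
    |>.2 (hF.2 (N + |h|))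
  refine Integrable.mono_measure h1 (Measure.restrict_mono (fun x hx i => ?_) le_rfl)
  exact (abs_add_le _ _).trans (add_le_add_left (hx i) _)

theorem ChainLocInt.strip_Ioc {F : (Fin n → ℝ) → E} (hF : ChainLocInt F) (N h : ℝ) :
    Integrable (fun p : (Fin n → ℝ) × ℝ => F fun i => p.1 i + p.2)
      (((chainMeasure n).restrict {x | ∀ i, |x i| ≤ N}).prod (volume.restrict (Set.Ioc 0 h))) :=
  have hsub : Set.Ioc 0 h ⊆ Set.Icc (-h) h := fun r hr => ⟨by linarith [hr.1, hr.2], hr.2⟩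
  (hF.strip N h).mono_measure (Measure.prod_mono le_rfl (Measure.restrict_mono hsub le_rfl))

/-- Fubini and the substitution `x ↦ x + r` transfer the averaging from the indicator function of
`A` to `F`. -/
theorem integral_slideAvg_smul [CompleteSpace E] {F : (Fin n → ℝ) → E} (hF : ChainLocInt F)
    {A : Set (Fin n → ℝ)} (hA : MeasurableSet A) {N h : ℝ} (hAN : A ⊆ {x | ∀ i, |x i| ≤ N})
    (hh : 0 ≤ h) :
    ∫ x, slideAvg A h x • F x ∂chainMeasure n =
      ∫ x in A, (∫ r in (0 : ℝ)..h, F fun i => x i + r) ∂chainMeasure n := by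
  have hbox := measurableSet_chainBox n (N + h)
  set k : (Fin n → ℝ) → ℝ := A.indicator fun _ => 1
  have hk : ∀ x, ‖k x‖ ≤ 1 := fun x => (norm_indicator_le_norm_self _ _).trans (by simp)
  have hkm : StronglyMeasurable k := stronglyMeasurable_const.indicator hA
  have i1 : Integrable (fun p : (Fin n → ℝ) × ℝ => (k fun i => p.1 i + -p.2) • F p.1)
      ((chainMeasure n).prod (volume.restrict (Set.Ioc 0 h))) := by
    have h1 : Integrable (fun p : (Fin n → ℝ) × ℝ =>
        {x : Fin n → ℝ | ∀ i, |x i| ≤ N + h}.indicator F p.1)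
        ((chainMeasure n).prod (volume.restrict (Set.Ioc 0 h))) :=
      ((integrable_indicator_iff hbox).2 (hF.2 _)).comp_fst _
    have hm : Measurable fun (p : (Fin n → ℝ) × ℝ) (i : Fin n) => p.1 i + -p.2 := by fun_prop
    refine h1.norm.mono' (((hkm.comp_measurable hm).aestronglyMeasurable).smul hF.1.comp_fst) ?_
    have h2 : ∀ᵐ p : (Fin n → ℝ) × ℝ ∂(chainMeasure n).prod (volume.restrict (Set.Ioc 0 h)),
        p.2 ∈ Set.Ioc 0 h :=
      Measure.quasiMeasurePreserving_snd.ae (ae_restrict_mem measurableSet_Ioc)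
    filter_upwards [h2] with p hp
    by_cases hx : (fun i => p.1 i + -p.2) ∈ A
    · have h3 : p.1 ∈ {x : Fin n → ℝ | ∀ i, |x i| ≤ N + h} := fun i => by
        have h4 := abs_le.1 (hAN hx i)
        exact abs_le.2 ⟨by linarith [h4.1, hp.1, hp.2], by linarith [h4.2, hp.1, hp.2]⟩
      rw [Set.indicator_of_mem h3, norm_smul]
      exact mul_le_of_le_one_left (norm_nonneg _) (hk _)
    · have : k (fun i => p.1 i + -p.2) = 0 := Set.indicator_of_notMem hx _
      rw [this, zero_smul, norm_zero]
      exact norm_nonneg _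
  have i2 : Integrable (fun p : (Fin n → ℝ) × ℝ => k p.1 • F fun i => p.1 i + p.2)
      ((chainMeasure n).prod (volume.restrict (Set.Ioc 0 h))) := by
    have h1 := hF.strip_Ioc N h
    have h2 : (((chainMeasure n).restrict {x | ∀ i, |x i| ≤ N}).prod
        (volume.restrict (Set.Ioc 0 h))) = ((chainMeasure n).prod
          (volume.restrict (Set.Ioc 0 h))).restrict ({x | ∀ i, |x i| ≤ N} ×ˢ Set.univ) := by
      rw [← Measure.prod_restrict, Measure.restrict_univ]
    rw [h2, ← IntegrableOn, ← integrable_indicator_iff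
      ((measurableSet_chainBox n N).prod MeasurableSet.univ)] at h1
    have hFm : AEStronglyMeasurable (fun p : (Fin n → ℝ) × ℝ => F fun i => p.1 i + p.2)
        ((chainMeasure n).prod (volume.restrict (Set.Ioc 0 h))) :=
      hF.1.comp_quasiMeasurePreserving (quasiMeasurePreserving_chain_line n _)
    refine h1.norm.mono' ((hkm.comp_measurable measurable_fst).aestronglyMeasurable.smul hFm)
      (ae_of_all _ fun p => ?_)
    by_cases hx : p.1 ∈ A
    · rw [Set.indicator_of_mem (show p ∈ {x : Fin n → ℝ | ∀ i, |x i| ≤ N} ×ˢ Set.univ from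
        ⟨hAN hx, trivial⟩), norm_smul]
      exact mul_le_of_le_one_left (norm_nonneg _) (hk _)
    · have : k p.1 = 0 := Set.indicator_of_notMem hx _
      rw [this, zero_smul, norm_zero]
      exact norm_nonneg _
  have e1 : ∀ x, slideAvg A h x • F x = ∫ r in Set.Ioc 0 h, (k fun i => x i + -r) • F x := by
    intro x
    rw [integral_smul_const, slideAvg, intervalIntegral.integral_of_le hh]
  have e2 : ∀ x, A.indicator (fun x => ∫ r in (0 : ℝ)..h, F fun i => x i + r) x =
      ∫ r in Set.Ioc 0 h, k x • F fun i => x i + r := by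
    intro x
    rw [integral_smul, ← intervalIntegral.integral_of_le hh]
    by_cases hx : x ∈ A <;> simp [k, hx]
  rw [← integral_indicator hA]
  simp only [e1, e2]
  rw [integral_integral_swap (f := fun (x : Fin n → ℝ) r => (k fun i => x i + -r) • F x) i1,
    integral_integral_swap (f := fun (x : Fin n → ℝ) r => k x • F fun i => x i + r) i2]
  congr 1
  funext r
  rw [← integral_chain_add n r fun x => (k fun i => x i + -r) • F x]
  simp only [add_assoc, add_neg_cancel, add_zero]

theorem integral_slideDiff_smul {F : (Fin n → ℝ) → E} (hF : ChainLocInt F)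
    {A : Set (Fin n → ℝ)} (hA : MeasurableSet A) {N : ℝ} (hAN : A ⊆ {x | ∀ i, |x i| ≤ N}) (h : ℝ) :
    ∫ x, slideDiff A h x • F x ∂chainMeasure n =
      ∫ x in A, (F x - F fun i => x i + h) ∂chainMeasure n := by
  have i1 : IntegrableOn F A (chainMeasure n) := (hF.2 N).mono_set hAN
  have i2 : IntegrableOn (fun x => F fun i => x i + h) A (chainMeasure n) :=
    (hF.integrableOn_shift N h).mono_set hAN
  have e1 : Integrable (A.indicator F) (chainMeasure n) := (integrable_indicator_iff hA).2 i1
  have e2 := (integrable_indicator_iff hA).2 i2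
  have e3 : Integrable (fun x : Fin n → ℝ =>
      A.indicator (fun x => F fun i => x i + h) fun i => x i + -h) (chainMeasure n) :=
    (measurePreserving_chain_add n (-h)).integrable_comp_emb
      (measurableEmbedding_chain_add n (-h)) |>.2 e2
  have e : ∀ x, slideDiff A h x • F x = A.indicator F x -
      A.indicator (fun x => F fun i => x i + h) fun i => x i + -h := by
    intro x
    have h1 : (fun i => x i + -h + h) = x := funext fun i => by ring
    by_cases hx : x ∈ A <;> by_cases hx' : (fun i => x i + -h) ∈ A <;>
      simp only [slideDiff, Set.indicator_of_mem, Set.indicator_of_notMem, hx, hx', h1,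
        not_false_eq_true, sub_zero, sub_self, zero_sub, one_smul, zero_smul, neg_smul]
  simp only [e]
  rw [integral_sub e1 e3, integral_sub i1 i2, ← integral_indicator hA, ← integral_indicator hA]
  congr 1
  exact integral_chain_add n (-h) _

/-- A function with a locally integrable weak derivative along the shifts. -/
theorem ae_sub_eq_integral_of_weak [CompleteSpace E] {Φ Y : (Fin n → ℝ) → E} (hΦ : ChainLocInt Φ)
    (hY : ChainLocInt Y) {h : ℝ} (hh : 0 ≤ h)
    (hw : ∀ (A : Set (Fin n → ℝ)) (N : ℝ), MeasurableSet A → A ⊆ {x | ∀ i, |x i| ≤ N} →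
      ∫ x, slideAvg A h x • Y x ∂chainMeasure n = -∫ x, slideDiff A h x • Φ x ∂chainMeasure n) :
    ∀ᵐ x ∂chainMeasure n, (Φ fun i => x i + h) - Φ x = ∫ r in (0 : ℝ)..h, Y fun i => x i + r := by
  refine ae_chainBox fun N => ?_
  have hbox := measurableSet_chainBox n N
  have i1 := hΦ.2 N
  have i2 := hΦ.integrableOn_shift N h
  have i3 : IntegrableOn (fun x : Fin n → ℝ => ∫ r in (0 : ℝ)..h, Y fun i => x i + r)
      {x | ∀ i, |x i| ≤ (N : ℝ)} (chainMeasure n) := by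
    simp only [intervalIntegral.integral_of_le hh]
    exact (hY.strip_Ioc N h).integral_prod_left
  have key : (fun x => (∫ r in (0 : ℝ)..h, Y fun i => x i + r) + (Φ x - Φ fun i => x i + h))
      =ᵐ[(chainMeasure n).restrict {x | ∀ i, |x i| ≤ (N : ℝ)}] 0 := by
    -- The weak identity gives zero integral over every measurable part of the box, because the part
    -- itself can be used as the test set `A`.
    refine (i3.add (i1.sub i2)).ae_eq_zero_of_forall_setIntegral_eq_zero fun s hs _ => ?_
    rw [Measure.restrict_restrict hs]
    set A := s ∩ {x : Fin n → ℝ | ∀ i, |x i| ≤ (N : ℝ)}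
    have hAN : A ⊆ {x : Fin n → ℝ | ∀ i, |x i| ≤ (N : ℝ)} := Set.inter_subset_right
    have hA : MeasurableSet A := hs.inter hbox
    have e := hw A N hA hAN
    rw [integral_slideAvg_smul hY hA hAN hh, integral_slideDiff_smul hΦ hA hAN] at e
    have i4 : IntegrableOn (fun x => Φ x - Φ fun i => x i + h) A (chainMeasure n) :=
      (i1.sub i2).mono_set hAN
    have : ∫ x in A, ((∫ r in (0 : ℝ)..h, Y fun i => x i + r) + (Φ x - Φ fun i => x i + h))
        ∂chainMeasure n = 0 := by
      rw [integral_add (i3.mono_set hAN) i4, e, neg_add_cancel]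
    exact this
  filter_upwards [key] with x hx
  have hx : (∫ r in (0 : ℝ)..h, Y fun i => x i + r) + (Φ x - Φ fun i => x i + h) = 0 := hx
  rw [eq_comm, ← sub_eq_zero, ← hx]
  abel

theorem ae_sub_eq_integral_neg {Φ Y : (Fin n → ℝ) → E} {h : ℝ}
    (hw : ∀ᵐ x ∂chainMeasure n, (Φ fun i => x i + h) - Φ x =
      ∫ r in (0 : ℝ)..h, Y fun i => x i + r) :
    ∀ᵐ x ∂chainMeasure n, (Φ fun i => x i + -h) - Φ x =
      ∫ r in (0 : ℝ)..(-h), Y fun i => x i + r := by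
  filter_upwards [(measurePreserving_chain_add n (-h)).quasiMeasurePreserving.ae hw] with x hx
  simp only [add_assoc, neg_add_cancel, add_zero] at hx
  have e : ∫ r in (0 : ℝ)..h, (Y fun i => x i + (-h + r)) = ∫ r in (-h)..0, Y fun i => x i + r := by
    rw [intervalIntegral.integral_comp_add_left fun r => Y fun i => x i + r]
    simp
  rw [intervalIntegral.integral_symm, ← e, ← hx, neg_sub]

/-- The exceptional null set of chains depends on `h`, which ranges over an uncountable set. Fubini
exchanges the quantifiers at the price of an exceptional null set of `h`; it needs a measurable set
of pairs, hence the measurable representatives. -/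
theorem ae_ae_sub_eq_integral [CompleteSpace E] {Φ Y : (Fin n → ℝ) → E}
    (hΦ : AEStronglyMeasurable Φ (chainMeasure n)) (hY : AEStronglyMeasurable Y (chainMeasure n))
    (hw : ∀ h : ℝ, ∀ᵐ x ∂chainMeasure n, (Φ fun i => x i + h) - Φ x =
      ∫ r in (0 : ℝ)..h, Y fun i => x i + r) :
    ∀ᵐ x ∂chainMeasure n, ∀ᵐ h : ℝ, (Φ fun i => x i + h) - Φ x =
      ∫ r in (0 : ℝ)..h, Y fun i => x i + r := by
  set Φ' := hΦ.mk Φ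
  set Y' := hY.mk Y
  have eΦ : ∀ᵐ x ∂chainMeasure n, Φ x = Φ' x := hΦ.ae_eq_mk
  have eY : ∀ᵐ x ∂chainMeasure n, Y x = Y' x := hY.ae_eq_mk
  have mΦ : StronglyMeasurable Φ' := hΦ.stronglyMeasurable_mk
  have mY : StronglyMeasurable Y' := hY.stronglyMeasurable_mk
  have hYI : ∀ᵐ x ∂chainMeasure n, ∀ h : ℝ, ∫ r in (0 : ℝ)..h, Y (fun i => x i + r) =
      ∫ r in (0 : ℝ)..h, Y' fun i => x i + r := by
    filter_upwards [ae_chain_line eY] with x hx h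
    refine intervalIntegral.integral_congr_ae ?_
    filter_upwards [hx] with r hr _ using hr
  have hm : Measurable fun p : (Fin n → ℝ) × ℝ => (fun i => p.1 i + p.2 : Fin n → ℝ) :=
    measurable_chain_add n
  have mI : StronglyMeasurable fun p : (Fin n → ℝ) × ℝ =>
      ∫ r in (0 : ℝ)..p.2, Y' fun i => p.1 i + r := by
    -- The oriented integral with a variable end is a difference of two integrals over all of `ℝ`
    -- with planar indicator functions, to which measurability of parametric integrals applies.
    have hJ : ∀ s : Set (ℝ × ℝ), MeasurableSet s → StronglyMeasurable fun p : (Fin n → ℝ) × ℝ =>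
        ∫ r, s.indicator (fun q => Y' fun i => p.1 i + q.2) (p.2, r) := by
      intro s hs
      refine StronglyMeasurable.integral_prod_right
        (f := fun (p : (Fin n → ℝ) × ℝ) r => s.indicator (fun q => Y' fun i => p.1 i + q.2) (p.2, r)) ?_
      have h1 : Measurable fun q : ((Fin n → ℝ) × ℝ) × ℝ =>
          (fun i => q.1.1 i + q.2 : Fin n → ℝ) := by fun_prop
      have h2 : Measurable fun q : ((Fin n → ℝ) × ℝ) × ℝ => (q.1.2, q.2) := by fun_prop
      exact (mY.comp_measurable h1).indicator (h2 hs)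
    have e : (fun p : (Fin n → ℝ) × ℝ => ∫ r in (0 : ℝ)..p.2, Y' fun i => p.1 i + r) = fun p =>
        (∫ r, {q : ℝ × ℝ | 0 < q.2 ∧ q.2 ≤ q.1}.indicator (fun q => Y' fun i => p.1 i + q.2) (p.2, r)) -
        ∫ r, {q : ℝ × ℝ | q.1 < q.2 ∧ q.2 ≤ 0}.indicator (fun q => Y' fun i => p.1 i + q.2) (p.2, r) := by
      funext p
      rw [intervalIntegral, ← integral_indicator measurableSet_Ioc,
        ← integral_indicator measurableSet_Ioc]
      rfl
    rw [e]
    refine (hJ _ ?_).sub (hJ _ ?_)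
    · exact (measurableSet_lt measurable_const measurable_snd).inter
        (measurableSet_le measurable_snd measurable_fst)
    · exact (measurableSet_lt measurable_fst measurable_snd).inter
        (measurableSet_le measurable_snd measurable_const)
  have hset : MeasurableSet {p : (Fin n → ℝ) × ℝ | (Φ' fun i => p.1 i + p.2) - Φ' p.1 =
      ∫ r in (0 : ℝ)..p.2, Y' fun i => p.1 i + r} :=
    (((mΦ.comp_measurable hm).sub (mΦ.comp_measurable measurable_fst)).measurableSet_eq_fun mI)
  have h1 : ∀ᵐ h : ℝ, ∀ᵐ x ∂chainMeasure n, (Φ' fun i => x i + h) - Φ' x =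
      ∫ r in (0 : ℝ)..h, Y' fun i => x i + r := by
    refine ae_of_all _ fun h => ?_
    filter_upwards [hw h, eΦ, (measurePreserving_chain_add n h).quasiMeasurePreserving.ae eΦ, hYI]
      with x h1 h2 h3 h4
    rw [← h2, ← h3, h1, h4]
  have h2 := (Measure.ae_ae_comm (μ := chainMeasure n) (ν := volume)
    (p := fun x h => (Φ' fun i => x i + h) - Φ' x =
      ∫ r in (0 : ℝ)..h, Y' fun i => x i + r) hset).2 h1
  filter_upwards [h2, eΦ, ae_chain_line eΦ, hYI] with x h3 h4 h5 h6
  filter_upwards [h3, h5] with h h7 h8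
  rw [h8, h4, h7, h6]

/-- A version that is a primitive on almost every line. -/
theorem exists_primitive_version [CompleteSpace E] {Φ Y : (Fin n → ℝ) → E}
    (hΦ : AEStronglyMeasurable Φ (chainMeasure n)) (hY : ChainLocInt Y)
    (hw : ∀ h : ℝ, ∀ᵐ x ∂chainMeasure n, (Φ fun i => x i + h) - Φ x =
      ∫ r in (0 : ℝ)..h, Y fun i => x i + r) :
    ∃ Φ' : (Fin n → ℝ) → E, ∀ᵐ x ∂chainMeasure n, ∀ b : ℝ,
      (Φ' fun i => x i + b) = Φ x + ∫ r in (0 : ℝ)..b, Y fun i => x i + r := by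
  -- For almost every `h` the integrand equals `Φ x`. At the shifted chain `x + b` it is `Φ x + ∫₀ᵇ
  -- Y` for almost every `h`, so averaging over `h` gives this value for every `b`, not just almost
  -- every one.
  refine ⟨fun x => ∫ h in (0 : ℝ)..1, ((Φ fun i => x i + h) -
    ∫ r in (0 : ℝ)..h, Y fun i => x i + r), ?_⟩
  filter_upwards [ae_ae_sub_eq_integral hΦ hY.1 hw, hY.ae_line] with x hx hi b
  have h1 := (measurePreserving_add_left volume b).quasiMeasurePreserving.ae hx
  rw [intervalIntegral.integral_congr_ae
    (g := fun _ => Φ x + ∫ r in (0 : ℝ)..b, Y fun i => x i + r)]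
  · simp
  filter_upwards [h1] with h hh _
  have e : ∫ r in (0 : ℝ)..h, (Y fun i => x i + b + r) = ∫ r in b..(b + h), Y fun i => x i + r := by
    have := intervalIntegral.integral_comp_add_left (a := 0) (b := h)
      (fun r => Y fun i => x i + r) b
    simp only [← add_assoc, add_zero] at this
    exact this
  have h2 := intervalIntegral.integral_add_adjacent_intervals (hi 0 b) (hi b (b + h))
  rw [e]
  simp only [← add_assoc] at hh
  rw [sub_eq_iff_eq_add.1 hh, ← h2]
  abel

end

/-! ### The momentum is pseudo-selfadjoint -/

section

variable {𝔥 : Type*} [NormedAddCommGroup 𝔥] [InnerProductSpace ℂ 𝔥]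

theorem ChainLocInt.eval {n : ℕ} {F : (Fin n → ℝ) → Fibre 𝔥 n} (hF : ChainLocInt F)
    (s : Fin n → Fin 2) : ChainLocInt fun x => F x s :=
  ⟨(continuous_apply s).comp_aestronglyMeasurable hF.1, fun R => (hF.2 R).eval s⟩

theorem ChainLocInt.boundaryGauge {n : ℕ} {F : (Fin n → ℝ) → Fibre 𝔥 n} (hF : ChainLocInt F)
    (B : 𝔥 →L[ℂ] 𝔥) : ChainLocInt fun x => (boundaryGauge B x).1 (F x) := by
  obtain ⟨C, -, hC⟩ := exists_boundaryGauge_bound B n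
  have hm : AEStronglyMeasurable (fun x => (_root_.boundaryGauge B x).1 (F x)) (chainMeasure n) :=
    aestronglyMeasurable_clm_apply (stronglyMeasurable_boundaryGauge B).1.aestronglyMeasurable hF.1
  refine ⟨hm, fun R => ((hF.2 R).norm.const_mul C).mono' hm.restrict (ae_of_all _ fun x => ?_)⟩
  exact ((_root_.boundaryGauge B x).1.le_opNorm _).trans
    (mul_le_mul_of_nonneg_right (hC x).1 (norm_nonneg _))

theorem ChainLocInt.const_smul {n : ℕ} {F : (Fin n → ℝ) → Fibre 𝔥 n} (hF : ChainLocInt F)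
    (z : ℂ) : ChainLocInt fun x => z • F x :=
  ⟨hF.1.const_smul z, fun R => (hF.2 R).smul z⟩

theorem ChainLocInt.integrable_smul {n : ℕ} {F : (Fin n → ℝ) → 𝔥} (hF : ChainLocInt F)
    {f : (Fin n → ℝ) → ℝ} (hf : StronglyMeasurable f) {D R : ℝ} (hD : ∀ x, |f x| ≤ D)
    (hR : ∀ x, (¬∀ i, |x i| ≤ R) → f x = 0) :
    Integrable (fun x => f x • F x) (chainMeasure n) := by
  have h1 := (integrable_indicator_iff (measurableSet_chainBox n R)).2 (hF.2 R)
  refine (h1.norm.const_mul D).mono' (hf.aestronglyMeasurable.smul hF.1) (ae_of_all _ fun x => ?_)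
  rw [norm_smul]
  by_cases hx : x ∈ {x : Fin n → ℝ | ∀ i, |x i| ≤ R}
  · rw [Set.indicator_of_mem hx]
    exact mul_le_mul_of_nonneg_right (hD x) (norm_nonneg _)
  · rw [hR x hx, Set.indicator_of_notMem hx]
    simp

/-- Since the metric reverses spins, the test vector sits at the reversed configuration in order to
select the component `s`. -/
theorem fibreForm_smul_single {n : ℕ} (Ψ : Fibre 𝔥 n) (r : ℝ) (s : Fin n → Fin 2) (v : 𝔥) :
    fibreForm Ψ (r • (Pi.single (fun i => (s i).rev) v : Fibre 𝔥 n)) = inner ℂ (r • Ψ s) v := by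
  unfold fibreForm
  rw [Finset.sum_eq_single fun i => (s i).rev]
  · simp only [Fin.rev_rev, Pi.smul_apply, Pi.single_eq_same]
    rw [RCLike.real_smul_eq_coe_smul (K := ℂ) r (Ψ s), RCLike.real_smul_eq_coe_smul (K := ℂ) r v,
      inner_smul_left, inner_smul_right, RCLike.conj_ofReal]
  · intro s' _ h
    simp [Pi.single_eq_of_ne h]
  · simp

theorem integral_inner_const' [CompleteSpace 𝔥] {α : Type*} [MeasurableSpace α] {μ : Measure α}
    {w : α → 𝔥} (hw : Integrable w μ) (v : 𝔥) :
    ∫ x, inner ℂ (w x) v ∂μ = inner ℂ (∫ x, w x ∂μ) v := by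
  rw [← inner_conj_symm, ← integral_inner hw, ← integral_conj]
  simp only [inner_conj_symm]

theorem fibreForm_boundaryGauge_inv {B : 𝔥 →L[ℂ] 𝔥}
    (hB : ∀ u v, inner ℂ (B u) v = -inner ℂ u (B v)) {n : ℕ} (x : Fin n → ℝ) (Φ Ψ : Fibre 𝔥 n) :
    fibreForm Φ ((boundaryGauge B x)⁻¹.1 Ψ) = fibreForm ((boundaryGauge B x).1 Φ) Ψ := by
  rw [← fibreForm_legSigmas hB (nonnegSites x) Φ]
  congr 1
  exact congrArg (fun T => T Ψ) (Units.mul_inv (boundaryGauge B x))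

theorem fockForm_single (φ : WaveFn 𝔥) (n : ℕ) (F : (Fin n → ℝ) → Fibre 𝔥 n) :
    fockForm φ (Pi.single n F : WaveFn 𝔥) = ∫ x, fibreForm (φ n x) (F x) ∂chainMeasure n := by
  unfold fockForm
  rw [tsum_eq_single n fun m hm => ?_]
  · simp only [Pi.single_eq_same]
  · simp [Pi.single_eq_of_ne hm, fibreForm]

/-- In the gauge, the adjoint of the momentum is a weak derivative along the shifts. -/
theorem weak_of_adjoint [CompleteSpace 𝔥] {c : NNReal} (hc : 1 ≤ c) {H : ℝ → 𝔥 →L[ℂ] 𝔥} {t : ℝ}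
    (hsa : IsSelfAdjoint (H t)) {φ χ : WaveFn 𝔥} (hφ : InFock c φ) (hχ : InFock c χ)
    (hadj : ∀ ψ ρ, IsMomentum c (sigmaOp H t) ψ ρ → fockForm χ ψ = fockForm φ ρ) {n : ℕ}
    (s : Fin n → Fin 2) {h : ℝ} (hh : 0 ≤ h) {A : Set (Fin n → ℝ)} {N : ℝ} (hA : MeasurableSet A)
    (hAN : A ⊆ {x | ∀ i, |x i| ≤ N}) :
    ∫ x, slideAvg A h x • (-Complex.I • (boundaryGauge (-(Complex.I • H t)) x).1 (χ n x)) s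
        ∂chainMeasure n =
      -∫ x, slideDiff A h x • (boundaryGauge (-(Complex.I • H t)) x).1 (φ n x) s
        ∂chainMeasure n := by
  set B := -(Complex.I • H t) with hBdef
  have hB : ∀ u v, inner ℂ (B u) v = -inner ℂ u (B v) := inner_neg_I_smul hsa
  have lΦ := ((hφ.chainLocInt hc n).boundaryGauge B).eval s
  have lX := ((hχ.chainLocInt hc n).boundaryGauge B).eval s
  have iX := lX.integrable_smul (stronglyMeasurable_slideAvg hA hh) (abs_slideAvg_le A hh)
    fun x hx => (slide_eq_zero hAN hh hx).1
  have iΦ := lΦ.integrable_smul (stronglyMeasurable_slideDiff (h := h) hA) (abs_slideDiff_le A h)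
    fun x hx => (slide_eq_zero hAN hh hx).2
  have key : ∫ x, slideAvg A h x • (boundaryGauge B x).1 (χ n x) s ∂chainMeasure n =
      -Complex.I • ∫ x, slideDiff A h x • (boundaryGauge B x).1 (φ n x) s ∂chainMeasure n := by
    -- The gauge is pseudo-unitary, so the inverse gauge of the test function passes to `χ` and `φ`
    -- as the gauge; an arbitrary `v` then yields an identity between vectors of `𝔥`.
    refine ext_inner_right ℂ fun v => ?_
    have h1 := hadj _ _ (isMomentum_slide hc H t hA hAN hh (Pi.single (fun i => (s i).rev) v))
    rw [← Pi.single_smul, fockForm_single, fockForm_single] at h1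
    simp only [Pi.smul_apply, fibreForm_smul_right, ← hBdef, fibreForm_boundaryGauge_inv hB,
      fibreForm_smul_single] at h1
    rw [integral_const_mul, integral_inner_const' iX, integral_inner_const' iΦ] at h1
    rw [h1, inner_smul_left]
    simp
  have e : ∀ x, slideAvg A h x • (-Complex.I • (boundaryGauge B x).1 (χ n x)) s =
      -Complex.I • (slideAvg A h x • (boundaryGauge B x).1 (χ n x) s) :=
    fun x => smul_comm _ _ _
  simp only [e]
  rw [integral_smul, key, smul_smul]
  simp

/-- In the gauge the boundary condition disappears: the adjoint identity makes `-i` times the gauged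
`χ` the weak derivative of the gauged `φ`. Primitive versions are chosen for each spin component,
and the inverse gauge brings back the jumps. -/
theorem isMomentum_of_adjoint [CompleteSpace 𝔥] {c : NNReal} (hc : 1 ≤ c) {H : ℝ → 𝔥 →L[ℂ] 𝔥}
    {t : ℝ} (hsa : IsSelfAdjoint (H t)) {φ χ : WaveFn 𝔥} (hφ : InFock c φ) (hχ : InFock c χ)
    (hadj : ∀ ψ ρ, IsMomentum c (sigmaOp H t) ψ ρ → fockForm χ ψ = fockForm φ ρ) :
    IsMomentum c (sigmaOp H t) φ χ := by
  set B := -(Complex.I • H t) with hBdef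
  refine ⟨hφ, hχ, -Complex.I • χ, ?_, by simp [smul_smul]⟩
  rw [hasShiftDeriv_iff]
  intro n
  set Φ : (Fin n → ℝ) → Fibre 𝔥 n := fun x => (boundaryGauge B x).1 (φ n x)
  set Y : (Fin n → ℝ) → Fibre 𝔥 n := fun x => -Complex.I • (boundaryGauge B x).1 (χ n x)
  have lΦ : ChainLocInt Φ := (hφ.chainLocInt hc n).boundaryGauge B
  have lY : ChainLocInt Y := ((hχ.chainLocInt hc n).boundaryGauge B).const_smul _
  have hw : ∀ (s : Fin n → Fin 2) (h : ℝ), ∀ᵐ x ∂chainMeasure n,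
      Φ (fun i => x i + h) s - Φ x s = ∫ r in (0 : ℝ)..h, Y (fun i => x i + r) s := by
    intro s
    have hpos : ∀ h : ℝ, 0 ≤ h → ∀ᵐ x ∂chainMeasure n,
        Φ (fun i => x i + h) s - Φ x s = ∫ r in (0 : ℝ)..h, Y (fun i => x i + r) s :=
      fun h hh => ae_sub_eq_integral_of_weak (lΦ.eval s) (lY.eval s) hh fun A N hA hAN =>
        weak_of_adjoint hc hsa hφ hχ hadj s hh hA hAN
    intro h
    rcases le_total 0 h with hh | hh
    · exact hpos h hh
    · have := ae_sub_eq_integral_neg (Φ := fun x => Φ x s) (Y := fun x => Y x s)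
        (hpos (-h) (neg_nonneg.2 hh))
      simpa only [neg_neg] using this
  choose Φ' hΦ' using fun s => exists_primitive_version (lΦ.eval s).1 (lY.eval s) (hw s)
  have hΦ'' := ae_all_iff.2 hΦ'
  refine ⟨fun x => (boundaryGauge B x)⁻¹.1 fun s => Φ' s x, ?_, ?_⟩
  · filter_upwards [hΦ''] with x hx
    have e : (fun s => Φ' s x) = Φ x := by
      funext s
      have := hx s 0
      simpa only [add_zero, intervalIntegral.integral_same] using this
    rw [e]
    exact congrArg (fun T => T (φ n x)) (Units.inv_mul (boundaryGauge B x))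
  · filter_upwards [hΦ'', lY.ae_line, ae_strictMono n] with x hx hi hsm
    have h1 := isJumpPrimitive_boundaryGauge H t hsm.injective
      (θ := fun r s => Φ' s fun i => x i + r) (y := fun r => Y fun i => x i + r) hi
      fun a b _ => by
        funext s
        have h2 : (∫ r in a..b, Y fun i => x i + r) s = ∫ r in a..b, Y (fun i => x i + r) s :=
          ((ContinuousLinearMap.proj (R := ℂ) (φ := fun _ : Fin n → Fin 2 => 𝔥)
            s).intervalIntegral_comp_comm (hi a b)).symm
        have h3 : ∀ a b, IntervalIntegrable (fun r => Y (fun i => x i + r) s) volume a b :=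
          fun a b => ⟨(hi a b).1.eval s, (hi a b).2.eval s⟩
        have h4 := intervalIntegral.integral_add_adjacent_intervals (h3 0 a) (h3 a b)
        rw [h2, Pi.sub_apply, hx s a, hx s b, ← h4]
        abel
    have e : (fun r => (-Complex.I • χ) n fun i => x i + r) = fun r =>
        (boundaryGauge B fun i => x i + r)⁻¹.1 (Y fun i => x i + r) := by
      funext r
      simp only [Y, map_smul]
      have := congrArg (fun T => T (χ n fun i => x i + r))
        (Units.inv_mul (boundaryGauge B fun i => x i + r))
      exact congrArg (fun Ψ => -Complex.I • Ψ) this.symm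
    rw [e]
    exact h1

theorem momentumIsPseudoSelfAdjoint_sigmaOp [CompleteSpace 𝔥] {c : NNReal} (hc : 1 ≤ c)
    {H : ℝ → 𝔥 →L[ℂ] 𝔥} {t : ℝ} (hsa : IsSelfAdjoint (H t)) :
    MomentumIsPseudoSelfAdjoint c (sigmaOp H t) :=
  fun _ _ hφ hχ => ⟨fun h _ _ h' =>
    h.fockForm_eq hc (fun n i => (legAct_sigmaOp_pseudoUnitary hsa n i).2) h',
    isMomentum_of_adjoint hc hsa hφ hχ⟩

end

/-! ### The solution with the canonical input state -/

section

variable {𝔥 : Type*} [NormedAddCommGroup 𝔥] [InnerProductSpace ℂ 𝔥]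

/-- The product `A i_k ⋯ A i_1 η` over the elements `i_1 < ⋯ < i_k` of `P`. -/
noncomputable def chainProd {n : ℕ} (A : Fin n → 𝔥 →L[ℂ] 𝔥) (η : 𝔥) (P : Finset (Fin n)) : 𝔥 :=
  if h : P.Nonempty then A (P.max' h) (chainProd A η (P.erase (P.max' h))) else η
termination_by P.card
decreasing_by exact Finset.card_erase_lt_of_mem (P.max'_mem h)

theorem chainProd_empty {n : ℕ} (A : Fin n → 𝔥 →L[ℂ] 𝔥) (η : 𝔥) : chainProd A η ∅ = η := by
  rw [chainProd]
  simp

theorem chainProd_insert {n : ℕ} (A : Fin n → 𝔥 →L[ℂ] 𝔥) (η : 𝔥) {a : Fin n} {Q : Finset (Fin n)}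
    (h : ∀ j ∈ Q, j < a) : chainProd A η (insert a Q) = A a (chainProd A η Q) := by
  have hne : (insert a Q).Nonempty := Finset.insert_nonempty a Q
  have hmax : (insert a Q).max' hne = a := by
    refine le_antisymm (Finset.max'_le _ _ _ fun j hj => ?_)
      (Finset.le_max' _ _ (Finset.mem_insert_self a Q))
    rcases Finset.mem_insert.1 hj with rfl | hj
    · exact le_rfl
    · exact (h j hj).le
  have ha : a ∉ Q := fun ha => lt_irrefl a (h a ha)
  rw [chainProd, dif_pos hne, hmax, Finset.erase_insert ha]

theorem chainProd_congr {n : ℕ} {A A' : Fin n → 𝔥 →L[ℂ] 𝔥} (η : 𝔥) {P : Finset (Fin n)}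
    (h : ∀ i ∈ P, A i = A' i) : chainProd A η P = chainProd A' η P := by
  induction P using Finset.induction_on_max with
  | empty => rw [chainProd_empty, chainProd_empty]
  | insert a Q ha ih =>
    rw [chainProd_insert A η ha, chainProd_insert A' η ha, h a (Finset.mem_insert_self a Q),
      ih fun i hi => h i (Finset.mem_insert_of_mem hi)]

theorem chainProd_eq_zero {n : ℕ} {A : Fin n → 𝔥 →L[ℂ] 𝔥} (η : 𝔥) {P : Finset (Fin n)} {j : Fin n}
    (hj : j ∈ P) (h : A j = 0) : chainProd A η P = 0 := by
  induction P using Finset.induction_on_max with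
  | empty => simp at hj
  | insert a Q ha ih =>
    rw [chainProd_insert A η ha]
    rcases Finset.mem_insert.1 hj with rfl | hj
    · rw [h, zero_apply]
    · rw [ih hj, map_zero]

theorem enorm_chainProd_le {n : ℕ} (A : Fin n → 𝔥 →L[ℂ] 𝔥) (η : 𝔥) (P : Finset (Fin n)) :
    ‖chainProd A η P‖ₑ ≤ ‖η‖ₑ * ∏ i ∈ P, ‖A i‖ₑ := by
  induction P using Finset.induction_on_max with
  | empty => simp [chainProd_empty]
  | insert a Q ha ih =>
    rw [chainProd_insert A η ha, Finset.prod_insert fun h => lt_irrefl a (ha a h)]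
    calc _ ≤ ‖A a‖ₑ * ‖chainProd A η Q‖ₑ := (A a).le_opENorm _
      _ ≤ ‖A a‖ₑ * (‖η‖ₑ * ∏ i ∈ Q, ‖A i‖ₑ) := by gcongr
      _ = _ := by ring

theorem aestronglyMeasurable_chainProd {α : Type*} [MeasurableSpace α] {μ : Measure α} {n : ℕ}
    {A : α → Fin n → 𝔥 →L[ℂ] 𝔥} (hA : ∀ i, AEStronglyMeasurable (fun x => A x i) μ) (η : 𝔥)
    (P : Finset (Fin n)) : AEStronglyMeasurable (fun x => chainProd (A x) η P) μ := by
  induction P using Finset.induction_on_max with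
  | empty =>
    simp only [chainProd_empty]
    exact aestronglyMeasurable_const
  | insert a Q ha ih =>
    simp only [chainProd_insert _ η ha]
    exact aestronglyMeasurable_clm_apply (hA a) ih

theorem tendsto_chainProd {α : Type*} {l : Filter α} {n : ℕ} {A : α → Fin n → 𝔥 →L[ℂ] 𝔥}
    {A₀ : Fin n → 𝔥 →L[ℂ] 𝔥} (hA : ∀ i, Tendsto (fun x => A x i) l (𝓝 (A₀ i))) (η : 𝔥)
    (P : Finset (Fin n)) : Tendsto (fun x => chainProd (A x) η P) l (𝓝 (chainProd A₀ η P)) := by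
  induction P using Finset.induction_on_max with
  | empty =>
    simp only [chainProd_empty]
    exact tendsto_const_nhds
  | insert a Q ha ih =>
    simp only [chainProd_insert _ η ha]
    exact ((isBoundedBilinearMap_apply (𝕜 := ℂ) (E := 𝔥) (F := 𝔥)).continuous.tendsto
      (A₀ a, chainProd A₀ η Q)).comp ((hA a).prodMk_nhds ih)

theorem differentiableAt_chainProd {F : Type*} [NormedAddCommGroup F] [NormedSpace ℝ F] {n : ℕ}
    {A : F → Fin n → 𝔥 →L[ℂ] 𝔥} {y : F} (hA : ∀ i, DifferentiableAt ℝ (fun x => A x i) y) (η : 𝔥)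
    (P : Finset (Fin n)) : DifferentiableAt ℝ (fun x => chainProd (A x) η P) y := by
  induction P using Finset.induction_on_max with
  | empty =>
    simp only [chainProd_empty]
    exact differentiableAt_const _
  | insert a Q ha ih =>
    simp only [chainProd_insert _ η ha]
    have h := ((isBoundedBilinearMap_apply (𝕜 := ℂ) (E := 𝔥) (F := 𝔥)).differentiableAt
      (A y a, chainProd (A y) η Q)).restrictScalars ℝ
    exact h.comp y ((hA a).prodMk ih)

/-- The interaction of the points of a tuple up to the time `t`. -/
noncomputable def pastOp (H : ℝ → 𝔥 →L[ℂ] 𝔥) (t : ℝ) {n : ℕ} (x : Fin n → ℝ) (i : Fin n) :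
    𝔥 →L[ℂ] 𝔥 :=
  if 0 ≤ x i ∧ x i < t then -(Complex.I • H (x i)) else 0

/-- The solution of the Itô-Schrödinger equation with the input state `η ⊗ ξ_∅^⊗`. -/
noncomputable def vacuumSolution (H : ℝ → 𝔥 →L[ℂ] 𝔥) (η : 𝔥) (t : ℝ) : WaveFn 𝔥 :=
  fun _ x s => chainProd (pastOp H t x) η (pastSites s)

/-- Only the last point `a` of `P` contributes to the sum: for any earlier `i`, the product stopped
at time `x i` still contains the factor of `a`, which is zero. For `a` itself, stopping at `x a` or
at `t > x a` makes no difference to the earlier factors. -/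
theorem chainProd_pastOp (H : ℝ → 𝔥 →L[ℂ] 𝔥) (η : 𝔥) {n : ℕ} {x : Fin n → ℝ} (hx : StrictMono x)
    (t : ℝ) (P : Finset (Fin n)) :
    chainProd (pastOp H t x) η P = (if P = ∅ then η else 0) +
      ∑ i with 0 ≤ x i ∧ x i < t,
        if i ∈ P then (-(Complex.I • H (x i))) (chainProd (pastOp H (x i) x) η (P.erase i))
        else 0 := by
  induction P using Finset.induction_on_max with
  | empty => simp [chainProd_empty]
  | insert a Q ha _ =>
    have haQ : a ∉ Q := fun h => lt_irrefl a (ha a h)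
    rw [chainProd_insert _ η ha, if_neg (Finset.insert_ne_empty a Q), zero_add, Finset.sum_filter,
      Finset.sum_eq_single a]
    · rw [if_pos (Finset.mem_insert_self a Q), Finset.erase_insert haQ]
      by_cases h : 0 ≤ x a ∧ x a < t
      · rw [if_pos h]
        have e : chainProd (pastOp H (x a) x) η Q = chainProd (pastOp H t x) η Q := by
          refine chainProd_congr η fun j hj => ?_
          have h1 : x j < x a := hx (ha j hj)
          have h2 : x j < t := h1.trans h.2
          simp only [pastOp, h1, h2]
        rw [e]
        simp only [pastOp, if_pos h]
      · rw [if_neg h]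
        simp only [pastOp, if_neg h, zero_apply]
    · intro i _ hia
      by_cases hiQ : i ∈ insert a Q
      · have hi : i ∈ Q := (Finset.mem_insert.1 hiQ).resolve_left hia
        have h1 : x i < x a := hx (ha i hi)
        rw [chainProd_eq_zero η (j := a)]
        · simp
        · exact Finset.mem_erase.2 ⟨hia.symm, Finset.mem_insert_self a Q⟩
        · simp only [pastOp]
          rw [if_neg fun h => h1.not_gt h.2]
      · simp [hiQ]
    · simp

theorem mem_pastSites {n : ℕ} {s : Fin n → Fin 2} {i : Fin n} : i ∈ pastSites s ↔ s i = 0 := by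
  simp [pastSites]

theorem pastSites_update {n : ℕ} (s : Fin n → Fin 2) (i : Fin n) :
    pastSites (Function.update s i 1) = (pastSites s).erase i := by
  ext j
  rw [Finset.mem_erase, mem_pastSites, mem_pastSites]
  rcases eq_or_ne j i with rfl | h
  · simp
  · simp [h]

theorem pseudoVacuum_apply (η : 𝔥) (n : ℕ) (x : Fin n → ℝ) (s : Fin n → Fin 2) :
    pseudoVacuum η n x s = if pastSites s = ∅ then η else 0 := by
  have : (∀ i, s i = 1) ↔ pastSites s = ∅ := by
    rw [Finset.eq_empty_iff_forall_notMem]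
    refine forall_congr' fun i => ?_
    rw [mem_pastSites]
    generalize s i = a
    fin_cases a <;> simp
  simp only [pseudoVacuum, this]

theorem isItoSchrodinger_vacuumSolution (H : ℝ → 𝔥 →L[ℂ] 𝔥) (η : 𝔥) :
    IsItoSchrodinger H (pseudoVacuum η) (vacuumSolution H η) := by
  intro n x hx t _
  funext s
  rw [Pi.add_apply, Finset.sum_apply, pseudoVacuum_apply]
  simp only [legAct_gammaOp, vacuumSolution, pastSites_update, ← mem_pastSites]
  exact chainProd_pastOp H η hx t (pastSites s)

/-- The equation is triangular: a component is determined by components with one past spin fewer, so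
induction on the number of past spins proves uniqueness on increasing tuples. -/
theorem IsItoSchrodinger.eq_vacuumSolution {H : ℝ → 𝔥 →L[ℂ] 𝔥} {η : 𝔥} {ψ : ℝ → WaveFn 𝔥}
    (h : IsItoSchrodinger H (pseudoVacuum η) ψ) {n : ℕ} {x : Fin n → ℝ} (hx : StrictMono x) {t : ℝ}
    (ht : 0 ≤ t) : ψ t n x = vacuumSolution H η t n x := by
  have key : ∀ (k : ℕ) (s : Fin n → Fin 2), (pastSites s).card = k → ∀ t, 0 ≤ t →
      ψ t n x s = vacuumSolution H η t n x s := by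
    intro k
    induction k using Nat.strong_induction_on with
    | _ k ih =>
      intro s hs t ht
      rw [h n x hx t ht, isItoSchrodinger_vacuumSolution H η n x hx t ht]
      simp only [Pi.add_apply, Finset.sum_apply]
      congr 1
      refine Finset.sum_congr rfl fun i hi => ?_
      rw [legAct_gammaOp, legAct_gammaOp]
      split_ifs with hsi
      · have hlt : (pastSites (Function.update s i 1)).card < k := by
          rw [pastSites_update, ← hs]
          exact Finset.card_erase_lt_of_mem (mem_pastSites.2 hsi)
        rw [ih _ hlt _ rfl _ (Finset.mem_filter.1 hi).2.1]
      · rfl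
  funext s
  exact key _ s rfl t ht

/-! ### The solution belongs to the Minkowski-Fock space -/

theorem InFock.congr {c : NNReal} {φ ψ : WaveFn 𝔥} (h : InFock c φ)
    (e : ∀ n (x : Fin n → ℝ), StrictMono x → φ n x = ψ n x) : InFock c ψ := by
  obtain ⟨hm, g, hg, hgi, hgφ⟩ := h
  have e' : ∀ n, ∀ᵐ x ∂chainMeasure n, φ n x = ψ n x := fun n => by
    filter_upwards [ae_strictMono n] with x hx using e n x hx
  refine ⟨fun n s => (hm n s).congr ?_, g, hg, hgi, fun n s => ?_⟩
  · filter_upwards [e' n] with x hx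
    rw [hx]
  · filter_upwards [e' n, hgφ n s] with x hx h1
    rwa [← hx]

theorem quasiMeasurePreserving_chain_eval {n : ℕ} (i : Fin n) :
    Measure.QuasiMeasurePreserving (fun x : Fin n → ℝ => x i) (chainMeasure n) volume :=
  (Measure.quasiMeasurePreserving_eval (fun _ : Fin n => (volume : Measure ℝ)) i).mono_left
    Measure.restrict_le_self.absolutelyContinuous

theorem prod_pastChain {n : ℕ} (x : Fin n → ℝ) (s : Fin n → Fin 2) (f : ℝ → ENNReal) :
    ∏ j, f (pastChain x s j) = ∏ i ∈ pastSites s, f (x i) := by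
  have := Finset.prod_map Finset.univ ((pastSites s).orderEmbOfFin rfl).toEmbedding fun i => f (x i)
  rw [Finset.map_orderEmbOfFin_univ] at this
  exact this.symm

theorem tsum_exp_lt_top (K : NNReal) :
    (∑' n : ℕ, (K : ENNReal) ^ n / (n.factorial : ENNReal)) < ⊤ := by
  have h : ∀ n : ℕ, (K : ENNReal) ^ n / (n.factorial : ENNReal) =
      ((K ^ n / (n.factorial : NNReal) : NNReal) : ENNReal) := fun n => by
    rw [ENNReal.coe_div (by exact_mod_cast n.factorial_ne_zero)]
    simp
  simp only [h]
  refine lt_top_iff_ne_top.2 (ENNReal.tsum_coe_ne_top_iff_summable.2 ?_)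
  rw [← NNReal.summable_coe]
  simpa using Real.summable_pow_div_factorial (K : ℝ)

/-- The solution is bounded by the product of `‖H‖` over the past points, cut off to `[0, t)`, and
this bound ignores the future points. Integrating over the simplex costs a factor `1/n!`, so every
`c` is absorbed by the exponential series of `c ∫ ‖B‖`. -/
theorem inFock_vacuumSolution {H : ℝ → 𝔥 →L[ℂ] 𝔥}
    (hH : LocallyIntegrableOn H (Set.Ici 0) volume) (c : NNReal) (hc : 1 ≤ c) (η : 𝔥) (t : ℝ) :
    InFock c (vacuumSolution H η t) := by
  set B : ℝ → 𝔥 →L[ℂ] 𝔥 := (Set.Ico 0 t).indicator fun r => -(Complex.I • H r) with hBdef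
  have hpB : ∀ (n : ℕ) (x : Fin n → ℝ) i, pastOp H t x i = B (x i) := fun n x i => by
    simp only [pastOp, hBdef, Set.indicator_apply, Set.mem_Ico]
  have hB : Integrable B := by
    have h1 : IntegrableOn H (Set.Icc 0 t) volume :=
      hH.integrableOn_compact_subset Set.Icc_subset_Ici_self isCompact_Icc
    have h2 : IntegrableOn (fun r => -(Complex.I • H r)) (Set.Ico 0 t) volume :=
      (Integrable.smul Complex.I (h1.mono_set Set.Ico_subset_Icc_self)).neg
    exact IntegrableOn.integrable_indicator (ε' := 𝔥 →L[ℂ] 𝔥) h2 measurableSet_Ico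
  have hBm : ∀ n (i : Fin n), AEStronglyMeasurable (fun x : Fin n → ℝ => B (x i)) (chainMeasure n) :=
    fun n i => hB.1.comp_quasiMeasurePreserving (quasiMeasurePreserving_chain_eval i)
  refine ⟨fun n s => ?_, fun n x => ‖η‖ₑ * ∏ i, ‖B (x i)‖ₑ, fun n => ?_, ?_, fun n s => ?_⟩
  · refine aestronglyMeasurable_chainProd (fun i => ?_) η _
    simp only [hpB]
    exact hBm n i
  · exact (Finset.aemeasurable_fun_prod _ fun i _ => (hBm n i).enorm).const_mul _
  · set B' := hB.1.mk B
    have hB' : Measurable fun r => ‖B' r‖ₑ := hB.1.stronglyMeasurable_mk.enorm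
    have eB : ∀ᵐ r : ℝ, B r = B' r := hB.1.ae_eq_mk
    have hI : ∫⁻ r, ‖B' r‖ₑ < ⊤ := (hB.congr eB).2
    have h1 : ∀ n, ∫⁻ x, ‖η‖ₑ * ∏ i, ‖B (x i)‖ₑ ∂chainMeasure n ≤
        ‖η‖ₑ * ((∫⁻ r, ‖B' r‖ₑ) ^ n / (n.factorial : ENNReal)) := by
      intro n
      rw [lintegral_const_mul' _ _ enorm_ne_top]
      gcongr
      have e : ∫⁻ x, ∏ i, ‖B (x i)‖ₑ ∂chainMeasure n = ∫⁻ x, ∏ i, ‖B' (x i)‖ₑ ∂chainMeasure n := by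
        refine lintegral_congr_ae ?_
        have h2 : ∀ᵐ x ∂chainMeasure n, ∀ i, B (x i) = B' (x i) :=
          ae_all_iff.2 fun i => (quasiMeasurePreserving_chain_eval i).ae eB
        filter_upwards [h2] with x hx
        simp only [hx]
      rw [e, ENNReal.le_div_iff_mul_le (Or.inl (by exact_mod_cast n.factorial_ne_zero))
        (Or.inl (ENNReal.natCast_ne_top _)), mul_comm]
      exact factorial_mul_lintegral_chain_le _ hB' n
    lift (∫⁻ r, ‖B' r‖ₑ) to NNReal using hI.ne with I
    calc _ ≤ ∑' n : ℕ, ‖η‖ₑ * (((c * I : NNReal) : ENNReal) ^ n / (n.factorial : ENNReal)) := by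
          refine ENNReal.tsum_le_tsum fun n => ?_
          calc _ ≤ (c : ENNReal) ^ n * (‖η‖ₑ * ((I : ENNReal) ^ n / (n.factorial : ENNReal))) := by
                gcongr
                exact h1 n
            _ = _ := by
                rw [ENNReal.coe_mul, mul_pow, div_eq_mul_inv, div_eq_mul_inv]
                ring
      _ = ‖η‖ₑ * ∑' n : ℕ, (((c * I : NNReal) : ENNReal) ^ n / (n.factorial : ENNReal)) :=
          ENNReal.tsum_mul_left
      _ < ⊤ := ENNReal.mul_lt_top enorm_lt_top (tsum_exp_lt_top _)
  · refine ae_of_all _ fun x => ?_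
    beta_reduce
    rw [prod_pastChain x s fun r => ‖B r‖ₑ]
    have h2 : (1 : ENNReal) ≤ (c : ENNReal) ^ (n - (pastSites s).card) :=
      one_le_pow₀ (by exact_mod_cast hc)
    have h3 := enorm_chainProd_le (pastOp H t x) η (pastSites s)
    simp only [hpB] at h3
    calc _ ≤ _ := h3
      _ = _ * 1 := (mul_one _).symm
      _ ≤ _ := by gcongr

end

/-! ### Ordinary derivatives and boundary values for regular `H` -/

section

variable {𝔥 : Type*} [NormedAddCommGroup 𝔥] [InnerProductSpace ℂ 𝔥]

theorem eventually_strictMono {n : ℕ} {x : Fin n → ℝ} (hx : StrictMono x) :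
    ∀ᶠ y in 𝓝 x, StrictMono y := by
  have h : ∀ᶠ y : Fin n → ℝ in 𝓝 x, ∀ i j, i < j → y i < y j := by
    refine eventually_all.2 fun i => eventually_all.2 fun j => ?_
    by_cases hij : i < j
    · have h1 : Tendsto (fun y : Fin n → ℝ => y j - y i) (𝓝 x) (𝓝 (x j - x i)) :=
        Continuous.tendsto (by fun_prop) x
      filter_upwards [h1 (Ioi_mem_nhds (sub_pos.2 (hx hij)))] with y hy _
      exact sub_pos.1 hy
    · simp [hij]
  filter_upwards [h] with y hy i j hij using hy i j hij

theorem tendsto_update_nhds {n : ℕ} (x : Fin n → ℝ) (i : Fin n) :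
    Tendsto (fun r => Function.update x i r) (𝓝 (x i)) (𝓝 x) := by
  have h : Continuous fun r => Function.update x i r := continuous_const.update i continuous_id
  simpa using h.tendsto (x i)

/-- As no point is at `0` or `-t`, the set of points that have interacted is locally frozen. Near
the given time and chain the solution is then one function `G` of the shifted tuple `x + t`; its
derivative along `(1, …, 1)` is both the time derivative and the sum of the partial derivatives. -/
theorem vacuumSolution_regular {H : ℝ → 𝔥 →L[ℂ] 𝔥} {η : 𝔥} {ψ : ℝ → WaveFn 𝔥}
    (h : IsItoSchrodinger H (pseudoVacuum η) ψ) {n : ℕ} {x : Fin n → ℝ} {t : ℝ}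
    (hx : StrictMono x) (ht : 0 < t) (h0 : ∀ i, x i ≠ 0 ∧ x i ≠ -t)
    (hd : ∀ i, -t < x i → x i < 0 → DifferentiableAt ℝ H (x i + t)) :
    ∃ (Dt : Fibre 𝔥 n) (Dx : Fin n → Fibre 𝔥 n),
      HasDerivAt (fun r => shift r (ψ r) n x) Dt t ∧
      (∀ i, HasDerivAt (fun r => shift t (ψ t) n (Function.update x i r)) (Dx i) (x i)) ∧
      Complex.I • Dt = Complex.I • ∑ i, Dx i := by
  -- The case distinction is made at the fixed `x`, not at the variable `y`, so that `G` is
  -- differentiable at `x + t`.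
  set A : (Fin n → ℝ) → Fin n → 𝔥 →L[ℂ] 𝔥 := fun y i =>
    if -t < x i ∧ x i < 0 then -(Complex.I • H (y i)) else 0 with hA
  set G : (Fin n → ℝ) → Fibre 𝔥 n := fun y s => chainProd (A y) η (pastSites s)
  have hG : DifferentiableAt ℝ G fun i => x i + t := by
    refine differentiableAt_pi.2 fun s => differentiableAt_chainProd (fun i => ?_) η _
    by_cases hi : -t < x i ∧ x i < 0
    · simp only [hA, if_pos hi]
      have h1 : DifferentiableAt ℝ (fun y : Fin n → ℝ => y i) fun i => x i + t :=
        differentiableAt_apply i _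
      exact (((hd i hi.1 hi.2).comp (fun i => x i + t) h1).const_smul Complex.I).neg
    · simp only [hA, if_neg hi]
      exact differentiableAt_const _
  obtain ⟨G', hG'⟩ := hG
  have e1 : ∀ᶠ r in 𝓝 t, shift r (ψ r) n x = G fun i => x i + r := by
    have h1 : ∀ᶠ r in 𝓝 t, ∀ i, (0 ≤ x i + r ∧ x i + r < r) ↔ (-t < x i ∧ x i < 0) := by
      refine eventually_all.2 fun i => ?_
      rcases (h0 i).2.lt_or_gt with hi | hi
      · filter_upwards [Iio_mem_nhds (show t < -x i by linarith)] with r hr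
        have hr : r < -x i := hr
        exact ⟨fun h => by linarith [h.1], fun h => by linarith [h.1]⟩
      · filter_upwards [Ioi_mem_nhds (show -x i < t by linarith)] with r hr
        have hr : -x i < r := hr
        exact ⟨fun h => ⟨hi, by linarith [h.2]⟩, fun h => ⟨by linarith, by linarith [h.2]⟩⟩
    filter_upwards [h1, Ioi_mem_nhds ht] with r hr hr0
    refine (h.eq_vacuumSolution (strictMono_add_const_iff.2 hx) (le_of_lt hr0)).trans ?_
    funext s
    refine chainProd_congr η fun i _ => ?_
    simp only [pastOp, hA, hr i]
  have e2 : ∀ i, ∀ᶠ r in 𝓝 (x i), shift t (ψ t) n (Function.update x i r) =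
      G fun j => Function.update x i r j + t := by
    intro i
    have h1 : ∀ᶠ y in 𝓝 x, StrictMono y ∧
        ∀ j, (0 ≤ y j + t ∧ y j + t < t) ↔ (-t < x j ∧ x j < 0) := by
      refine (eventually_strictMono hx).and (eventually_all.2 fun j => ?_)
      have hc : Tendsto (fun y : Fin n → ℝ => y j) (𝓝 x) (𝓝 (x j)) :=
        (continuous_apply j).tendsto x
      have ha : ∀ᶠ y in 𝓝 x, 0 ≤ y j + t ↔ -t < x j := by
        rcases (h0 j).2.lt_or_gt with hi | hi
        · filter_upwards [hc (Iio_mem_nhds hi)] with y hy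
          have hy : y j < -t := hy
          exact ⟨fun h => by linarith, fun h => by linarith⟩
        · filter_upwards [hc (Ioi_mem_nhds hi)] with y hy
          have hy : -t < y j := hy
          exact ⟨fun _ => hi, fun _ => by linarith⟩
      have hb : ∀ᶠ y in 𝓝 x, y j + t < t ↔ x j < 0 := by
        rcases (h0 j).1.lt_or_gt with hi | hi
        · filter_upwards [hc (Iio_mem_nhds hi)] with y hy
          have hy : y j < 0 := hy
          exact ⟨fun _ => hi, fun _ => by linarith⟩
        · filter_upwards [hc (Ioi_mem_nhds hi)] with y hy
          have hy : 0 < y j := hy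
          exact ⟨fun h => by linarith, fun h => by linarith⟩
      filter_upwards [ha, hb] with y h1 h2
      rw [h1, h2]
    filter_upwards [(tendsto_update_nhds x i).eventually h1] with r hr
    refine (h.eq_vacuumSolution (strictMono_add_const_iff.2 hr.1) ht.le).trans ?_
    funext s
    refine chainProd_congr η fun j _ => ?_
    simp only [pastOp, hA, hr.2 j]
  refine ⟨G' fun _ => 1, fun i => G' (Pi.single i 1), ?_, fun i => ?_, ?_⟩
  · have hc : HasDerivAt (fun r : ℝ => fun i => x i + r) (fun _ => (1 : ℝ)) t :=
      hasDerivAt_pi.2 fun i => (hasDerivAt_id t).const_add (x i)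
    have hd : HasDerivAt (fun r => G fun i => x i + r) (G' fun _ => 1) t :=
      HasFDerivAt.comp_hasDerivAt (l := G) (l' := G') t hG' hc
    exact hd.congr_of_eventuallyEq e1
  · have hc : HasDerivAt (fun r : ℝ => fun j => Function.update x i r j + t)
        (Pi.single i (1 : ℝ)) (x i) := by
      refine hasDerivAt_pi.2 fun j => ?_
      exact (hasDerivAt_pi.1 (hasDerivAt_update x i (x i)) j).add_const t
    have hG'' : HasFDerivAt G G' (fun j => Function.update x i (x i) j + t) := by
      simpa using hG'
    have hd : HasDerivAt (fun r => G fun j => Function.update x i r j + t)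
        (G' (Pi.single i 1)) (x i) := 
      HasFDerivAt.comp_hasDerivAt (l := G) (l' := G') (x i) hG'' hc
    exact hd.congr_of_eventuallyEq (e2 i)
  · rw [← map_sum]
    congr 2
    exact (Finset.univ_sum_single (fun _ : Fin n => (1 : ℝ))).symm

/-- If `P` has a point beyond `i`, both sides contain a zero factor; otherwise `i` is the last point
of `P` and its factor is outermost. -/
theorem chainProd_update {n : ℕ} {A : Fin n → 𝔥 →L[ℂ] 𝔥} (η : 𝔥) (B : 𝔥 →L[ℂ] 𝔥)
    {P : Finset (Fin n)} {i : Fin n} (hi : i ∈ P) (hA : ∀ j, i < j → A j = 0) :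
    chainProd (Function.update A i B) η P = B (chainProd A η (P.erase i)) := by
  by_cases h : ∃ j ∈ P, i < j
  · obtain ⟨j, hj, hij⟩ := h
    rw [chainProd_eq_zero η hj (by rw [Function.update_of_ne hij.ne', hA j hij]),
      chainProd_eq_zero η (Finset.mem_erase.2 ⟨hij.ne', hj⟩) (hA j hij), map_zero]
  · push Not at h
    have h1 : ∀ j ∈ P.erase i, j < i := fun j hj =>
      lt_of_le_of_ne (h j (Finset.mem_of_mem_erase hj)) (Finset.ne_of_mem_erase hj)
    rw [← Finset.insert_erase hi, chainProd_insert _ η h1, Function.update_self,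
      Finset.erase_insert (Finset.notMem_erase i P)]
    congr 1
    exact chainProd_congr η fun j hj => Function.update_of_ne (Finset.ne_of_mem_erase hj) _ _

/-- A point at the origin is shifted to `t`, just outside `[0, t)`, so its factor is zero there and
also to the right. Slightly to the left the factor is `-iH(r + t)`, which tends to `-iH(t)`: the
entry by which `σ(t)` differs from the identity. -/
theorem vacuumSolution_boundary {H : ℝ → 𝔥 →L[ℂ] 𝔥} {η : 𝔥} {ψ : ℝ → WaveFn 𝔥}
    (h : IsItoSchrodinger H (pseudoVacuum η) ψ) {n : ℕ} {x : Fin n → ℝ} {t : ℝ} {i : Fin n}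
    (hx : StrictMono x) (ht : 0 < t) (hi : x i = 0) (hH : ContinuousAt H t) :
    Tendsto (fun r => shift t (ψ t) n (Function.update x i r)) (𝓝[>] 0)
      (𝓝 (shift t (ψ t) n x)) ∧
    Tendsto (fun r => shift t (ψ t) n (Function.update x i r)) (𝓝[<] 0)
      (𝓝 (legAct (sigmaOp H t) i (shift t (ψ t) n x))) := by
  set A : Fin n → 𝔥 →L[ℂ] 𝔥 := pastOp H t fun j => x j + t with hA
  have hAi : A i = 0 := by simp [hA, pastOp, hi]
  have hAj : ∀ j, i < j → A j = 0 := fun j hj => by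
    have : 0 < x j := hi ▸ hx hj
    simp only [hA, pastOp]
    exact if_neg fun h => by linarith [h.2]
  have hx0 : shift t (ψ t) n x = fun s => chainProd A η (pastSites s) :=
    h.eq_vacuumSolution (strictMono_add_const_iff.2 hx) ht.le
  have hsm : ∀ᶠ r in 𝓝 (0 : ℝ), StrictMono (Function.update x i r) := by
    have := tendsto_update_nhds x i
    rw [hi] at this
    exact this.eventually (eventually_strictMono hx)
  have hup : ∀ r, (pastOp H t fun j => Function.update x i r j + t) =
      Function.update A i (if 0 ≤ r + t ∧ r + t < t then -(Complex.I • H (r + t)) else 0) := by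
    intro r
    funext j
    rcases eq_or_ne j i with rfl | hj
    · simp [pastOp]
    · simp [pastOp, hA, hj]
  have hsol : ∀ᶠ r in 𝓝 (0 : ℝ), shift t (ψ t) n (Function.update x i r) = fun s =>
      chainProd (Function.update A i
        (if 0 ≤ r + t ∧ r + t < t then -(Complex.I • H (r + t)) else 0)) η (pastSites s) := by
    filter_upwards [hsm] with r hr
    refine (h.eq_vacuumSolution (strictMono_add_const_iff.2 hr) ht.le).trans ?_
    funext s
    simp only [vacuumSolution]
    rw [← hup r]
  constructor
  · refine tendsto_const_nhds.congr' ?_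
    filter_upwards [nhdsWithin_le_nhds hsol, self_mem_nhdsWithin] with r hr hr0
    have hr0 : 0 < r := hr0
    rw [hr, hx0, if_neg fun h => by linarith [h.2], ← hAi, Function.update_eq_self]
  · have hlim : Tendsto (fun r : ℝ => -(Complex.I • H (r + t))) (𝓝[<] 0) (𝓝 (-(Complex.I • H t))) := by
      have h1 : Tendsto (fun r : ℝ => r + t) (𝓝 0) (𝓝 t) :=
        Continuous.tendsto' (by fun_prop) 0 t (zero_add t)
      exact (((hH.tendsto.comp h1).const_smul Complex.I).neg).mono_left nhdsWithin_le_nhds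
    have hval : legAct (sigmaOp H t) i (shift t (ψ t) n x) = fun s =>
        chainProd (Function.update A i (-(Complex.I • H t))) η (pastSites s) := by
      rw [legAct_sigmaOp, hx0]
      funext s
      rw [Pi.add_apply, legAct_gammaOp, pastSites_update]
      by_cases hs : s i = 0
      · rw [if_pos hs, chainProd_eq_zero η (mem_pastSites.2 hs) hAi, zero_add,
          chainProd_update η _ (mem_pastSites.2 hs) hAj]
      · rw [if_neg hs, add_zero]
        refine chainProd_congr η fun j hj => ?_
        have : j ≠ i := fun e => hs (mem_pastSites.1 (e ▸ hj))
        rw [Function.update_of_ne this]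
    rw [hval]
    have hlim2 : Tendsto (fun r s => chainProd (Function.update A i (-(Complex.I • H (r + t)))) η
        (pastSites s)) (𝓝[<] 0)
        (𝓝 fun s => chainProd (Function.update A i (-(Complex.I • H t))) η (pastSites s)) := by
      refine tendsto_pi_nhds.2 fun s => tendsto_chainProd (fun j => ?_) η _
      rcases eq_or_ne j i with rfl | hj
      · simpa using hlim
      · simp only [Function.update_of_ne hj]
        exact tendsto_const_nhds
    refine hlim2.congr' ?_
    filter_upwards [nhdsWithin_le_nhds hsol, self_mem_nhdsWithin,
      nhdsWithin_le_nhds (Ioi_mem_nhds (neg_lt_zero.2 ht))] with r hr hr0 hrt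
    have hr0 : r < 0 := hr0
    have hrt : -t < r := hrt
    rw [hr, if_pos ⟨by linarith, by linarith⟩]

end

/-! ### Assembly of the theorem -/

theorem mainTheorem3 {𝔥 : Type*} [NormedAddCommGroup 𝔥] [InnerProductSpace ℂ 𝔥]
    [CompleteSpace 𝔥] (H : ℝ → 𝔥 →L[ℂ] 𝔥)
    (hH : LocallyIntegrableOn H (Set.Ici 0) volume)
    (hsa : ∀ x : ℝ, 0 ≤ x → IsSelfAdjoint (H x)) (c : NNReal) (hc : 1 ≤ c) :
    -- the shifts form a group of `‡`-unitary operators of the extended Minkowski-Fock space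
    (∀ t : ℝ, IsPseudoUnitary c (shift t : WaveFn 𝔥 → WaveFn 𝔥)) ∧
    (∀ (r t : ℝ) (ψ : WaveFn 𝔥), shift r (shift t ψ) = shift (r + t) ψ) ∧
    -- they carry the Itô-Schrödinger equation into the Schrödinger boundary value problem
    (∀ (ψ₀ : WaveFn 𝔥) (ψ : ℝ → WaveFn 𝔥),
      IsItoSchrodinger H ψ₀ ψ ↔ IsSchrodingerBVP H ψ₀ fun t => shift t (ψ t)) ∧
    -- the boundary condition is pseudo-unitary and the momentum of the clock pseudo-selfadjoint
    (∀ t : ℝ, 0 ≤ t →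
      (∀ (n : ℕ) (i : Fin n),
        Function.Bijective (legAct (sigmaOp H t) i : Fibre 𝔥 n → Fibre 𝔥 n) ∧
        ∀ Φ Ψ : Fibre 𝔥 n,
          fibreForm (legAct (sigmaOp H t) i Φ) (legAct (sigmaOp H t) i Ψ) = fibreForm Φ Ψ) ∧
      MomentumIsPseudoSelfAdjoint c (sigmaOp H t)) ∧
    -- the solution with the canonical input state, in the extended Minkowski-Fock space
    (∀ η : 𝔥, (∃ ψ : ℝ → WaveFn 𝔥, IsItoSchrodinger H (pseudoVacuum η) ψ) ∧
      ∀ ψ : ℝ → WaveFn 𝔥, IsItoSchrodinger H (pseudoVacuum η) ψ →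
        (∀ t : ℝ, 0 ≤ t → InFock c (ψ t) ∧ InFock c (shift t (ψ t))) ∧
        -- partial derivatives and one-sided limits in the ordinary sense, for regular `H`
        (∀ (n : ℕ) (x : Fin n → ℝ) (t : ℝ), StrictMono x → 0 < t →
          (∀ i, x i ≠ 0 ∧ x i ≠ -t) →
          (∀ i, -t < x i → x i < 0 → DifferentiableAt ℝ H (x i + t)) →
          ∃ (Dt : Fibre 𝔥 n) (Dx : Fin n → Fibre 𝔥 n),
            HasDerivAt (fun r => shift r (ψ r) n x) Dt t ∧
            (∀ i, HasDerivAt (fun r => shift t (ψ t) n (Function.update x i r)) (Dx i) (x i)) ∧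
            Complex.I • Dt = Complex.I • ∑ i, Dx i) ∧
        (∀ (n : ℕ) (x : Fin n → ℝ) (t : ℝ) (i : Fin n), StrictMono x → 0 < t → x i = 0 →
          ContinuousAt H t →
          Tendsto (fun r => shift t (ψ t) n (Function.update x i r)) (𝓝[>] 0)
            (𝓝 (shift t (ψ t) n x)) ∧
          Tendsto (fun r => shift t (ψ t) n (Function.update x i r)) (𝓝[<] 0)
            (𝓝 (legAct (sigmaOp H t) i (shift t (ψ t) n x))))) ∧
    -- reflection of the negative time domain: the Dirac boundary value problem
    (∀ (ψ₀ : WaveFn 𝔥) (ψ : ℝ → WaveFn 𝔥),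
      (IsSchrodingerBVP H ψ₀ ψ ↔ IsDiracBVP H (reflectNeg ψ₀) fun t => reflectNeg (ψ t)) ∧
      (IsSchrodingerBVP H ψ₀ ψ → IsDiracPair H (fun t => reflectedNegPart (ψ t)) ψ)) := by
  refine ⟨isPseudoUnitary_shift c, shift_shift, isItoSchrodinger_iff_isSchrodingerBVP H,
    fun t ht => ⟨legAct_sigmaOp_pseudoUnitary (hsa t ht),
      momentumIsPseudoSelfAdjoint_sigmaOp hc (hsa t ht)⟩,
    fun η => ⟨⟨vacuumSolution H η, isItoSchrodinger_vacuumSolution H η⟩, fun ψ h => ⟨fun t ht => ?_,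
      fun n x t hx ht h0 hd => vacuumSolution_regular h hx ht h0 hd,
      fun n x t i hx ht hi hH => vacuumSolution_boundary h hx ht hi hH⟩⟩,
    fun ψ₀ ψ => ⟨isSchrodingerBVP_iff_isDiracBVP H ψ₀ ψ, fun h => h.isDiracPair⟩⟩
  have h1 : InFock c (ψ t) :=
    (inFock_vacuumSolution hH c hc η t).congr fun n x hx => (h.eq_vacuumSolution hx ht).symm
  exact ⟨h1, h1.shift t⟩
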